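/- Let $\Omega\subset\mathbb R^2$ be a bounded domain with smooth boundary whose closure $\overline\Omega$ is diffeomorphic to a closed annulus, with inner and outer boundary components $\Gamma_i$ and $\Gamma_o$. Let $\mathcal F$ be the space of functions in $C^\infty(\overline\Omega)$ that are constant on $\Gamma_i$ and constant on $\Gamma_o$; let $\mathcal U=\{\alpha\in\mathcal F:\alpha|_{\Gamma_o}=0\}$; and let $\mathcal F_+$ be the set of $\omega\in\mathcal F$ with $\nabla\omega\neq0$ everywhere on $\overline\Omega$ and $\omega|_{\Gamma_i}<\omega|_{\Gamma_o}$. Write $\{f,g\}=f_{x_1}g_{x_2}-f_{x_2}g_{x_1}$ and $A_\omega(\lambda)=|\{x\in\Omega:\omega(x)<\lambda\}|$ for $\lambda\in\mathbb R$. (1) If $\omega,\omega_1\in\mathcal F_+$ and $A_{\omega_1}=A_\omega$, then there is an area-preserving smooth diffeomorphism $\eta$ of $\overline\Omega$ onto itself ($\det D\eta=1$) such that $\omega=\omega_1\circ\eta$. (2) Let $\omega\in\mathcal F_+$ and let $\nu\in\mathcal F$ with $\nu|_{\partial\Omega}=0$. Then there exists $\alpha\in\mathcal U$ with $\nu=\{\omega,\alpha\}$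 on $\overline\Omega$ if and only if $$\int_{\{x\in\overline\Omega:\,\omega(x)=\lambda\}}\frac{\nu}{|\nabla\omega|}\,dl=0\qquad\text{for all }\lambda\in\omega(\overline\Omega),$$ where $dl$ is arc length. (3) Let $(\omega_\epsilon)$ be a family, defined for real $\epsilon$ near $0$, of elements of $\mathcal F_+$ with $\omega_0=\omega$, which as a curve in the Fréchet space $C^\infty(\overline\Omega)$ is differentiable at $\epsilon=0$ with derivative $\nu=\frac{d\omega_\epsilon}{d\epsilon}\big|_{\epsilon=0}$. Then $\frac{d}{d\epsilon}\big|_{\epsilon=0}A_{\omega_\epsilon}(\lambda)$ exists and equals $0$ for every $\lambda\in\mathbb R$ if and only if $\nu$ is tangent at $\omega$ to the orbit of $\omega$, i.e. $\nu=\{\omega,\alpha\}$ on $\overline\Omega$ for some $\alpha\in\mathcal U$. -/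

import Mathlib

open Set Filter Topology MeasureTheory

noncomputable section

/-- The Euclidean plane. -/
abbrev Plane : Type := EuclideanSpace ℝ (Fin 2)

/-- `f` restricts to a smooth diffeomorphism of `s` onto `t`. For closed `s`, `t`, smoothness is
smoothness up to the boundary. -/
def IsDiffeoOn (f : Plane → Plane) (s t : Set Plane) : Prop :=
  ContDiffOn ℝ (⊤ : ℕ∞) f s ∧ MapsTo f s t ∧
    ∃ g : Plane → Plane, ContDiffOn ℝ (⊤ : ℕ∞) g t ∧ MapsTo g t s ∧ InvOn g f s t

/-- The open round annulus with radii `1` and `2`. -/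
def roundAnnulus : Set Plane := {x | 1 < ‖x‖ ∧ ‖x‖ < 2}

/-- The closed round annulus with radii `1` and `2`. -/
def closedRoundAnnulus : Set Plane := {x | 1 ≤ ‖x‖ ∧ ‖x‖ ≤ 2}

/-- `Ω` is a smooth bounded plane domain diffeomorphic (up to the boundary) to an annulus, with
inner boundary component `Γi` and outer boundary component `Γo`. The last clause says that `Γo`
surrounds `Ω`. -/
def IsAnnularDomain (Ω Γi Γo : Set Plane) : Prop :=
  (∃ Φ : Plane → Plane, IsDiffeoOn Φ closedRoundAnnulus (closure Ω) ∧
      Φ '' roundAnnulus = Ω ∧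
      Φ '' Metric.sphere 0 1 = Γi ∧
      Φ '' Metric.sphere 0 2 = Γo) ∧
    ∀ x ∈ Ω, Bornology.IsBounded (connectedComponentIn Γoᶜ x)

/-- The group of area preserving diffeomorphisms: smooth diffeomorphisms of `closure Ω` onto
itself with Jacobian determinant `1`. -/
def IsVolDiffeo (Ω : Set Plane) (η : Plane → Plane) : Prop :=
  IsDiffeoOn η (closure Ω) (closure Ω) ∧
    ∀ x ∈ closure Ω, (fderivWithin ℝ η (closure Ω) x).det = 1

/-- The space `ℱ`: functions smooth on `closure Ω` and constant on each of the two boundary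
components. -/
def MemF (Ω Γi Γo : Set Plane) (ω : Plane → ℝ) : Prop :=
  ContDiffOn ℝ (⊤ : ℕ∞) ω (closure Ω) ∧
    (∀ x ∈ Γi, ∀ y ∈ Γi, ω x = ω y) ∧ (∀ x ∈ Γo, ∀ y ∈ Γo, ω x = ω y)

/-- The space `ℱ₊`: members of `ℱ` without critical points in `closure Ω`, whose value on `Γi` is
less than their value on `Γo`. -/
def MemFPlus (Ω Γi Γo : Set Plane) (ω : Plane → ℝ) : Prop :=
  MemF Ω Γi Γo ω ∧ (∀ x ∈ closure Ω, gradientWithin ω (closure Ω) x ≠ 0) ∧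
    ∀ x ∈ Γi, ∀ y ∈ Γo, ω x < ω y

/-- The space `𝒰` of stream functions: members of `ℱ` that vanish on `Γo`. -/
def MemU (Ω Γi Γo : Set Plane) (α : Plane → ℝ) : Prop :=
  MemF Ω Γi Γo α ∧ ∀ x ∈ Γo, α x = 0

/-- The `j`-th partial derivative on `closure Ω`. -/
def partialOn (Ω : Set Plane) (j : Fin 2) (f : Plane → ℝ) (x : Plane) : ℝ :=
  fderivWithin ℝ f (closure Ω) x (EuclideanSpace.single j 1)

/-- The Poisson bracket `{f, g} = ∂₁f ∂₂g - ∂₂f ∂₁g` on `closure Ω`. -/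
def poissonBracket (Ω : Set Plane) (f g : Plane → ℝ) (x : Plane) : ℝ :=
  partialOn Ω 0 f x * partialOn Ω 1 g x - partialOn Ω 1 f x * partialOn Ω 0 g x

/-- `ν` is tangent at `ω` to the orbit of `ω`: `ν = {ω, α}` on `closure Ω` for some stream
function `α`. -/
def IsTangentToOrbit (Ω Γi Γo : Set Plane) (ω ν : Plane → ℝ) : Prop :=
  ∃ α : Plane → ℝ, MemU Ω Γi Γo α ∧ ∀ x ∈ closure Ω, ν x = poissonBracket Ω ω α x

/-- The distribution function `A_ω(l) = |{x ∈ Ω : ω x < l}|`. -/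
def distributionFn (Ω : Set Plane) (ω : Plane → ℝ) (l : ℝ) : ℝ :=
  volume.real {x | x ∈ Ω ∧ ω x < l}

/-- The line integral `J_ω u (l) = ∫_{ω = l} u dl` over the level set in `closure Ω`, with respect
to arc length (one-dimensional Hausdorff measure). -/
def levelIntegral (Ω : Set Plane) (ω u : Plane → ℝ) (l : ℝ) : ℝ :=
  ∫ x in {x | x ∈ closure Ω ∧ ω x = l}, u x ∂(Measure.hausdorffMeasure 1 : Measure Plane)

/-- The curve `ε ↦ w ε` in the Fréchet space `C^∞(closure Ω)` has derivative `ν ∈ C^∞(closure Ω)`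
at `ε = 0`: all derivatives of `(w ε - w 0) / ε - ν` tend to `0` uniformly on `closure Ω`. -/
def HasSmoothDerivAtZero (Ω : Set Plane) (w : ℝ → Plane → ℝ) (ν : Plane → ℝ) : Prop :=
  ContDiffOn ℝ (⊤ : ℕ∞) ν (closure Ω) ∧
    ∀ k : ℕ, TendstoUniformlyOn
      (fun (ε : ℝ) (x : Plane) => iteratedFDerivWithin ℝ k
        (fun y => (w ε y - w 0 y) / ε - ν y) (closure Ω) x)
      (fun _ => 0) (𝓝[≠] (0 : ℝ)) (closure Ω)

end

/-! Everything rests on action-angle coordinates: a map `Z (s, t)` from a strip `[a, b] × ℝ` onto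
the closed domain, of period one in `t`, with `ω (Z (s, t)) = s` and a Jacobian `T s > 0` that
depends on `s` alone (`exists_isActionAngle`). In them the area below level `λ` is the integral of
`T` over the part of `[a, b]` below `λ`, the bracket `{ω, α}` is `∂ₜα / T`, and the level integral
of `ν / |∇ω|` is `T λ * ∫₀¹ ν (Z (λ, t)) dt`.

For (1), the area function determines `a`, `b` and `T` (`eq_of_areaBelow_eq`), so `Z₁ ∘ Z⁻¹` is well
defined, carries levels to levels and has determinant `T₁ / T = 1`. For (2), `∂ₜα = T ν` is solvable
on each level circle exactly when `ν` has mean zero there; since `ν` vanishes on the boundary, the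
primitive that starts at `t = 0` vanishes on both components (`exists_stream`). For (3), the set
where `w ε < λ` is, up to `o(ε)`, the region `s < λ - ε ν (Z (λ, t))` (`sandwich`), so at interior
levels its area has derivative `-T λ * ∫₀¹ ν (Z (λ, t)) dt`. At `λ = a` and `λ = b` the area
function has a corner, with one-sided slopes `0` and `T λ`; as `ν` is constant on each boundary
component, differentiability forces it to vanish there, and the construction of (2) applies.

To build `Z`, polar coordinates lift `ω` to a periodic function on a strip. A fibrewise change of
coordinates makes it affine near both boundary lines (`exists_straightening`), so that it extends to
a periodic `F` on the plane with bounded first and second derivatives and gradient bounded away from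
zero. In place of a gradient flow, `F` is raised by `l` through the implicit step `y = x + l W(x,
y)`, where `W(x, y)` is dual to the mean derivative of `F` on the segment from `x` to `y`. The
increment is then exactly `l`, and the symmetry of `W` makes the step by `-l` the inverse
(`exists_raising_family`). Finitely many steps starting on one boundary line give coordinates whose
first component is `ω`; reparametrizing each level circle by the accumulated Jacobian yields `T`. -/

noncomputable section

/-! ### Calculus on sets with boundary: inverse maps and parameter integrals -/

/-- A continuous right inverse of a smooth map with invertible derivatives is smooth, also on sets
with boundary. -/
theorem contDiffOn_of_rightInverse {E F : Type*} [NormedAddCommGroup E] [NormedSpace ℝ E]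
    [CompleteSpace E] [NormedAddCommGroup F] [NormedSpace ℝ F] {s : Set E} {t : Set F}
    {f : E → F} {g : F → E} (hs : UniqueDiffOn ℝ s) (ht : UniqueDiffOn ℝ t)
    (hf : ContDiffOn ℝ (⊤ : ℕ∞) f s) (hg : ContinuousOn g t) (hgt : MapsTo g t s)
    (hfg : ∀ y ∈ t, f (g y) = y) (hinv : ∀ x ∈ s, (fderivWithin ℝ f s x).IsInvertible) :
    ContDiffOn ℝ (⊤ : ℕ∞) g t := by
  have hd : ∀ y ∈ t, HasFDerivWithinAt g (fderivWithin ℝ f s (g y)).inverse t y := by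
    intro y hy
    obtain ⟨e, he⟩ := hinv (g y) (hgt hy)
    have h1 : HasFDerivWithinAt f (e : E →L[ℝ] F) s (g y) := by
      rw [he]
      exact ((hf.differentiableOn (by simp)) _ (hgt hy)).hasFDerivWithinAt
    have h2 := h1.of_local_left_inverse (a := y) (s := t) (g := g)
      (tendsto_nhdsWithin_of_tendsto_nhds_of_eventually_within _ (hg y hy)
        (eventually_mem_nhdsWithin.mono fun z hz => hgt hz)) hy
      (eventually_mem_nhdsWithin.mono fun z hz => hfg z hz)
    rw [← he]
    simpa using h2
  have hf' : ContDiffOn ℝ (⊤ : ℕ∞) (fderivWithin ℝ f s) s :=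
    ((contDiffOn_infty_iff_fderivWithin hs).1 hf).2
  rw [contDiffOn_infty]
  intro n
  induction n with
  | zero => exact contDiffOn_zero.2 hg
  | succ n ih =>
    rw [Nat.cast_add, Nat.cast_one, contDiffOn_succ_iff_hasFDerivWithinAt_of_uniqueDiffOn ht]
    refine ⟨by simp, _, ?_, hd⟩
    have h3 : ContDiffOn ℝ n (fun y => fderivWithin ℝ f s (g y)) t :=
      (hf'.of_le (by exact_mod_cast le_top)).comp ih hgt
    intro y hy
    exact ((hinv (g y) (hgt hy)).contDiffAt_map_inverse).comp_contDiffWithinAt y (h3 y hy)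

/-- Compactness of `[0, 1]` makes `g'` near `x` uniformly close to its value at `x`, and convexity
of `S` turns this into a uniform first-order estimate by the mean value inequality. Both work within
`S`, hence also at its boundary points. -/
theorem hasFDerivWithinAt_integral_unitInterval {H V : Type*} [NormedAddCommGroup H]
    [NormedSpace ℝ H] [NormedAddCommGroup V] [NormedSpace ℝ V] [CompleteSpace V] {S : Set H}
    (hS : Convex ℝ S) {g : H → ℝ → V} {g' : H → ℝ → H →L[ℝ] V}
    (hg : ContinuousOn (Function.uncurry g) (S ×ˢ univ))
    (hg' : ContinuousOn (Function.uncurry g') (S ×ˢ univ))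
    (hd : ∀ x ∈ S, ∀ u : ℝ, HasFDerivWithinAt (fun y => g y u) (g' x u) S x) {x : H}
    (hx : x ∈ S) :
    HasFDerivWithinAt (fun y => ∫ u in (0 : ℝ)..1, g y u) (∫ u in (0 : ℝ)..1, g' x u) S x := by
  have hc : ∀ y ∈ S, Continuous (g y) := fun y hy => by
    rw [← continuousOn_univ]
    exact hg.comp (f := fun u => (y, u)) (by fun_prop) (fun u _ => ⟨hy, mem_univ _⟩)
  have hc' : ∀ y ∈ S, Continuous (g' y) := fun y hy => by
    rw [← continuousOn_univ]
    exact hg'.comp (f := fun u => (y, u)) (by fun_prop) (fun u _ => ⟨hy, mem_univ _⟩)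
  rw [hasFDerivWithinAt_iff_isLittleO, Asymptotics.isLittleO_iff]
  intro c hcpos
  obtain ⟨v, hv, hvu⟩ := (isCompact_Icc (a := (0 : ℝ)) (b := 1)).mem_uniformity_of_prod
    (hg'.mono (prod_mono subset_rfl (subset_univ _))) hx (Metric.dist_mem_uniformity hcpos)
  obtain ⟨r, hr, hrv⟩ := Metric.mem_nhdsWithin_iff.1 hv
  have hmem : S ∩ Metric.ball x r ∈ 𝓝[S] x :=
    inter_mem self_mem_nhdsWithin (mem_nhdsWithin_of_mem_nhds (Metric.ball_mem_nhds x hr))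
  filter_upwards [hmem] with y hy
  have hconv : Convex ℝ (S ∩ Metric.ball x r) := hS.inter (convex_ball x r)
  have key : ∀ u ∈ Icc (0 : ℝ) 1, ‖g y u - g x u - g' x u (y - x)‖ ≤ c * ‖y - x‖ := by
    intro u hu
    refine hconv.norm_image_sub_le_of_norm_hasFDerivWithin_le' (f := fun z => g z u)
      (f' := fun z => g' z u) (fun z hz => (hd z hz.1 u).mono inter_subset_left) ?_
      ⟨hx, Metric.mem_ball_self hr⟩ hy
    intro z hz
    have := hvu z (hrv ⟨hz.2, hz.1⟩) u hu
    rw [← dist_eq_norm]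
    exact le_of_lt this
  have e : (∫ u in (0 : ℝ)..1, g y u) - (∫ u in (0 : ℝ)..1, g x u)
      - (∫ u in (0 : ℝ)..1, g' x u) (y - x)
      = ∫ u in (0 : ℝ)..1, (g y u - g x u - g' x u (y - x)) := by
    have i1 := (hc y hy.1).intervalIntegrable (μ := volume) 0 1
    have i2 := (hc x hx).intervalIntegrable (μ := volume) 0 1
    have i3 := (hc' x hx).intervalIntegrable (μ := volume) 0 1
    rw [intervalIntegral.integral_sub (i1.sub i2) (by
      exact ((hc' x hx).clm_apply continuous_const).intervalIntegrable 0 1),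
      intervalIntegral.integral_sub i1 i2, ContinuousLinearMap.intervalIntegral_apply i3]
  rw [e]
  have := intervalIntegral.norm_integral_le_of_norm_le_const (a := (0 : ℝ)) (b := 1)
    (f := fun u => g y u - g x u - g' x u (y - x)) (C := c * ‖y - x‖)
    (fun u hu => key u ⟨by rw [uIoc_of_le zero_le_one] at hu; exact hu.1.le,
      by rw [uIoc_of_le zero_le_one] at hu; exact hu.2⟩)
  simpa using this

theorem hasFDerivWithinAt_uncurry_left {H V : Type*} [NormedAddCommGroup H]
    [NormedSpace ℝ H] [NormedAddCommGroup V] [NormedSpace ℝ V] {S : Set H} {T : Set ℝ}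
    {g : H → ℝ → V} {z : H} {u : ℝ}
    (hg : DifferentiableWithinAt ℝ (Function.uncurry g) (S ×ˢ T) (z, u)) (hu : u ∈ T) :
    HasFDerivWithinAt (fun y => g y u) ((fderivWithin ℝ (Function.uncurry g) (S ×ˢ T) (z, u)).comp
        (ContinuousLinearMap.inl ℝ H ℝ)) S z := by
  have h1 : HasFDerivWithinAt (fun y : H => (y, u)) (ContinuousLinearMap.inl ℝ H ℝ) S z :=
    (hasFDerivAt_prodMk_left z u).hasFDerivWithinAt
  have h2 : MapsTo (fun y : H => (y, u)) S (S ×ˢ T) := fun y hy => ⟨hy, hu⟩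
  exact hg.hasFDerivWithinAt.comp z h1 h2

/-- Induction on the order: the derivative is again a unit-interval integral of a smooth integrand,
now with values in `H →L[ℝ] V`. Hence `V` is generalized, and both spaces lie in `Type` so that the
target stays in one universe. -/
theorem ContDiffOn.integral_unitInterval {H : Type} [NormedAddCommGroup H]
    [NormedSpace ℝ H] {V : Type} [NormedAddCommGroup V] [NormedSpace ℝ V] [CompleteSpace V]
    {S : Set H} (hS : Convex ℝ S) (hSu : UniqueDiffOn ℝ S) {g : H → ℝ → V}
    (hg : ContDiffOn ℝ (⊤ : ℕ∞) (Function.uncurry g) (S ×ˢ univ)) :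
    ContDiffOn ℝ (⊤ : ℕ∞) (fun y => ∫ u in (0 : ℝ)..1, g y u) S := by
  rw [contDiffOn_infty]
  intro n
  have hSu' : UniqueDiffOn ℝ (S ×ˢ (univ : Set ℝ)) := hSu.prod uniqueDiffOn_univ
  induction n generalizing V with
  | zero =>
    refine contDiffOn_zero.2 fun x hx => ?_
    have h1 : ContDiffOn ℝ (⊤ : ℕ∞) (fderivWithin ℝ (Function.uncurry g) (S ×ˢ univ))
      (S ×ˢ univ) := ((contDiffOn_infty_iff_fderivWithin hSu').1 hg).2
    refine HasFDerivWithinAt.continuousWithinAt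
      (hasFDerivWithinAt_integral_unitInterval hS
      (g' := fun x u => (fderivWithin ℝ (Function.uncurry g) (S ×ˢ univ) (x, u)).comp
        (ContinuousLinearMap.inl ℝ H ℝ)) hg.continuousOn
        (h1.continuousOn.clm_comp continuousOn_const) ?_ hx)
    intro z hz u
    exact hasFDerivWithinAt_uncurry_left ((hg.differentiableOn (by simp)) (z, u) ⟨hz, mem_univ _⟩)
      (mem_univ u)
  | succ n ih =>
    have h1 : ContDiffOn ℝ (⊤ : ℕ∞) (fderivWithin ℝ (Function.uncurry g) (S ×ˢ univ))
      (S ×ˢ univ) := ((contDiffOn_infty_iff_fderivWithin hSu').1 hg).2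
    have h2 : ContDiffOn ℝ (⊤ : ℕ∞) (Function.uncurry fun x u =>
      (fderivWithin ℝ (Function.uncurry g) (S ×ˢ univ) (x, u)).comp
        (ContinuousLinearMap.inl ℝ H ℝ)) (S ×ˢ univ) := h1.clm_comp contDiffOn_const
    rw [Nat.cast_add, Nat.cast_one, contDiffOn_succ_iff_hasFDerivWithinAt_of_uniqueDiffOn hSu]
    refine ⟨by simp, _, ih h2, fun x hx => ?_⟩
    refine hasFDerivWithinAt_integral_unitInterval hS hg.continuousOn h2.continuousOn ?_ hx
    intro z hz u
    exact hasFDerivWithinAt_uncurry_left ((hg.differentiableOn (by simp)) (z, u) ⟨hz, mem_univ _⟩)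
      (mem_univ u)

/-- The fibrewise inverse of a continuous fibrewise strictly increasing map is continuous. -/
theorem continuousOn_fiberwise_inverse {S I I' : Set ℝ} (hI : I.OrdConnected) {g ρ : ℝ → ℝ → ℝ}
    (hg : ContinuousOn (Function.uncurry g) (S ×ˢ I))
    (hmono : ∀ s ∈ S, StrictMonoOn (g s) I) (hρ : ∀ s ∈ S, ∀ y ∈ I', ρ s y ∈ I)
    (hgρ : ∀ s ∈ S, ∀ y ∈ I', g s (ρ s y) = y) :
    ContinuousOn (Function.uncurry ρ) (S ×ˢ I') := by
  have hfib : ∀ x ∈ I, ContinuousOn (fun q : ℝ × ℝ => g q.1 x) (S ×ˢ I') := fun x hx =>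
    hg.comp (f := fun q : ℝ × ℝ => (q.1, x)) (by fun_prop) (fun q hq => ⟨hq.1, hx⟩)
  rintro ⟨s₀, y₀⟩ ⟨hs₀, hy₀⟩
  have hx₀ := hρ s₀ hs₀ y₀ hy₀
  refine tendsto_order.2 ⟨fun l hl => ?_, fun l hl => ?_⟩
  · change l < ρ s₀ y₀ at hl
    by_cases hlI : l ∈ I
    · have h1 : g s₀ l < y₀ := by
        rw [← hgρ s₀ hs₀ y₀ hy₀]; exact hmono s₀ hs₀ hlI hx₀ hl
      have h2 := (hfib l hlI (s₀, y₀) ⟨hs₀, hy₀⟩).eventually_lt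
        (continuousWithinAt_snd (s := S ×ˢ I') (p := (s₀, y₀))) h1
      filter_upwards [h2, self_mem_nhdsWithin] with q hq hqm
      by_contra! hle
      have := (hmono q.1 hqm.1).monotoneOn (hρ q.1 hqm.1 q.2 hqm.2) hlI hle
      rw [hgρ q.1 hqm.1 q.2 hqm.2] at this
      exact absurd hq (not_lt.2 this)
    · filter_upwards [self_mem_nhdsWithin] with q hqm
      by_contra! hle
      exact hlI (hI.out (hρ q.1 hqm.1 q.2 hqm.2) hx₀ ⟨hle, hl.le⟩)
  · change ρ s₀ y₀ < l at hl
    by_cases hlI : l ∈ I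
    · have h1 : y₀ < g s₀ l := by
        rw [← hgρ s₀ hs₀ y₀ hy₀]; exact hmono s₀ hs₀ hx₀ hlI hl
      have h2 := (continuousWithinAt_snd (s := S ×ˢ I') (p := (s₀, y₀))).eventually_lt
        (hfib l hlI (s₀, y₀) ⟨hs₀, hy₀⟩) h1
      filter_upwards [h2, self_mem_nhdsWithin] with q hq hqm
      by_contra! hle
      have := (hmono q.1 hqm.1).monotoneOn hlI (hρ q.1 hqm.1 q.2 hqm.2) hle
      rw [hgρ q.1 hqm.1 q.2 hqm.2] at this
      exact absurd hq (not_lt.2 this)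
    · filter_upwards [self_mem_nhdsWithin] with q hqm
      by_contra! hle
      exact hlI (hI.out hx₀ (hρ q.1 hqm.1 q.2 hqm.2) ⟨hl.le, hle⟩)

theorem isInvertible_of_injective_real_prod {V : Type*} [NormedAddCommGroup V] [NormedSpace ℝ V]
    [FiniteDimensional ℝ V] {W : Type*} [NormedAddCommGroup W] [NormedSpace ℝ W]
    [FiniteDimensional ℝ W] (hd : Module.finrank ℝ V = Module.finrank ℝ W) (A : V →L[ℝ] W)
    (hA : ∀ v, A v = 0 → v = 0) : A.IsInvertible := by
  have hinj : Function.Injective (A : V →ₗ[ℝ] W) := by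
    rw [← LinearMap.ker_eq_bot, LinearMap.ker_eq_bot']
    exact hA
  refine ⟨(LinearEquiv.ofInjectiveOfFinrankEq (A : V →ₗ[ℝ] W) hinj hd).toContinuousLinearEquiv, ?_⟩
  ext v
  rfl

/-- A smooth map `(s, x) ↦ (s, g s x)` with `∂ₓ g > 0` has a smooth fibrewise inverse. -/
theorem contDiffOn_fiberwise_inverse {S I I' : Set ℝ} (hI : Convex ℝ I)
    (hSu : UniqueDiffOn ℝ S) (hIu : UniqueDiffOn ℝ I) (hIu' : UniqueDiffOn ℝ I')
    {g ρ : ℝ → ℝ → ℝ} (hg : ContDiffOn ℝ (⊤ : ℕ∞) (Function.uncurry g) (S ×ˢ I))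
    (hpos : ∀ s ∈ S, ∀ x ∈ I, 0 < fderivWithin ℝ (Function.uncurry g) (S ×ˢ I) (s, x) (0, 1))
    (hmono : ∀ s ∈ S, StrictMonoOn (g s) I) (hρ : ∀ s ∈ S, ∀ y ∈ I', ρ s y ∈ I)
    (hgρ : ∀ s ∈ S, ∀ y ∈ I', g s (ρ s y) = y) :
    ContDiffOn ℝ (⊤ : ℕ∞) (Function.uncurry ρ) (S ×ˢ I') := by
  have hu : UniqueDiffOn ℝ (S ×ˢ I) := hSu.prod hIu
  have hG : ContDiffOn ℝ (⊤ : ℕ∞) (fun p : ℝ × ℝ => (p.1, Function.uncurry g p)) (S ×ˢ I) :=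
    contDiffOn_fst.prodMk hg
  have hcont := continuousOn_fiberwise_inverse hI.ordConnected hg.continuousOn hmono hρ hgρ
  have := contDiffOn_of_rightInverse (g := fun q : ℝ × ℝ => (q.1, Function.uncurry ρ q)) hu
    (hSu.prod hIu') hG (continuousOn_fst.prodMk hcont)
    (fun q hq => ⟨hq.1, hρ q.1 hq.1 q.2 hq.2⟩)
    (fun q hq => Prod.ext rfl (hgρ q.1 hq.1 q.2 hq.2)) ?_
  · exact contDiff_snd.comp_contDiffOn this
  rintro ⟨s, x⟩ ⟨hs, hx⟩
  apply isInvertible_of_injective_real_prod rfl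
  have h1 : HasFDerivWithinAt (Function.uncurry g)
      (fderivWithin ℝ (Function.uncurry g) (S ×ˢ I) (s, x)) (S ×ˢ I) (s, x) :=
    ((hg.differentiableOn (by simp)) (s, x) ⟨hs, hx⟩).hasFDerivWithinAt
  rw [(hasFDerivWithinAt_fst.prodMk h1).fderivWithin (hu _ ⟨hs, hx⟩)]
  rintro ⟨v, w⟩ hv
  have hv1 : v = 0 := congrArg Prod.fst hv
  have hv2 := congrArg Prod.snd hv
  subst hv1
  simp only [ContinuousLinearMap.prod_apply, Prod.snd_zero] at hv2
  have e : ((0, w) : ℝ × ℝ) = w • (0, 1) := by simp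
  rw [e, map_smul, smul_eq_mul] at hv2
  have := (mul_eq_zero.1 hv2).resolve_right (hpos s hs x hx).ne'
  rw [this]; rfl

/-! ### The implicit step that raises a function by a prescribed amount -/

/-- The equation `y = x + l • W x y` defines, for small `l`, a smooth family of maps. -/
theorem exists_implicit_step {E : Type*} [NormedAddCommGroup E] [NormedSpace ℝ E]
    [FiniteDimensional ℝ E] {W : E → E → E} (hW : ContDiff ℝ (⊤ : ℕ∞) (Function.uncurry W))
    {τ Λ : ℝ} (hτΛ : τ * Λ ≤ 1 / 2)
    (hlip : ∀ x y z, ‖W x y - W x z‖ ≤ Λ * ‖y - z‖) :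
    ∃ φ : ℝ → E → E, ContDiffOn ℝ (⊤ : ℕ∞) (Function.uncurry φ) (Ioo (-τ) τ ×ˢ univ) ∧
      ∀ l ∈ Ioo (-τ) τ, ∀ x, φ l x = x + l • W x (φ l x) ∧
        ∀ z, z = x + l • W x z → z = φ l x := by
  have hcomplete : CompleteSpace E := FiniteDimensional.complete ℝ E
  have hL : ∀ l ∈ Ioo (-τ) τ, ∀ x, LipschitzWith (1 / 2) fun y => x + l • W x y := by
    intro l hl x
    refine LipschitzWith.of_dist_le_mul fun y z => ?_
    rw [dist_eq_norm, dist_eq_norm, add_sub_add_left_eq_sub, ← smul_sub, norm_smul]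
    have h1 : ‖l‖ ≤ τ := (abs_lt.2 hl).le
    calc ‖l‖ * ‖W x y - W x z‖ ≤ τ * (Λ * ‖y - z‖) := by
          gcongr
          · exact (norm_nonneg _).trans h1
          · exact hlip x y z
      _ = τ * Λ * ‖y - z‖ := by ring
      _ ≤ 1 / 2 * ‖y - z‖ := by gcongr
      _ = _ := by simp
  have hC : ∀ l ∈ Ioo (-τ) τ, ∀ x, ContractingWith (1 / 2) fun y => x + l • W x y :=
    fun l hl x => ⟨by rw [← NNReal.coe_lt_coe]; norm_num, hL l hl x⟩
  have hex : ∀ l x, ∃ y, l ∈ Ioo (-τ) τ → y = x + l • W x y ∧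
      ∀ z, z = x + l • W x z → z = y := by
    intro l x
    by_cases hl : l ∈ Ioo (-τ) τ
    · exact ⟨(hC l hl x).fixedPoint _, fun _ => ⟨(hC l hl x).fixedPoint_isFixedPt.symm,
        fun z hz => (hC l hl x).fixedPoint_unique hz.symm⟩⟩
    · exact ⟨x, fun h => absurd h hl⟩
  choose φ hφ using hex
  refine ⟨φ, ?_, fun l hl x => hφ l x hl⟩
  rintro ⟨l, x⟩ ⟨hl, -⟩
  apply ContDiffAt.contDiffWithinAt
  set H : (ℝ × E) × E → E := fun u => u.2 - u.1.2 - u.1.1 • Function.uncurry W (u.1.2, u.2)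
    with hH
  have hHs : ContDiff ℝ (⊤ : ℕ∞) H := by
    rw [hH]; fun_prop
  have cdf : ContDiffAt ℝ (⊤ : ℕ∞) H ((l, x), φ l x) := hHs.contDiffAt
  -- The derivative of `H` in the last variable is the identity minus the derivative of a
  -- `1/2`-Lipschitz map. A kernel vector `v` thus satisfies `‖v‖ ≤ ‖v‖ / 2`.
  have hinv : (fderiv ℝ H ((l, x), φ l x) ∘L .inr ℝ (ℝ × E) E).IsInvertible := by
    apply isInvertible_of_injective_real_prod rfl
    intro v hv
    have hA : HasFDerivAt (fun y => H ((l, x), y))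
        (fderiv ℝ H ((l, x), φ l x) ∘L .inr ℝ (ℝ × E) E) (φ l x) :=
      (hHs.differentiable (by simp) _).hasFDerivAt.comp (φ l x)
        (hasFDerivAt_prodMk_right (l, x) (φ l x))
    have hB : HasFDerivAt (fun y => x + l • W x y)
        (ContinuousLinearMap.id ℝ E - fderiv ℝ H ((l, x), φ l x) ∘L .inr ℝ (ℝ × E) E)
        (φ l x) := by
      refine ((hasFDerivAt_id (φ l x)).sub hA).congr_of_eventuallyEq
        (Eventually.of_forall fun y => ?_)
      change x + l • W x y = y - (y - x - l • W x y)
      abel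
    have hB' := norm_fderiv_le_of_lipschitz ℝ (hL l hl x) (x₀ := φ l x)
    rw [hB.fderiv] at hB'
    have h3 := (ContinuousLinearMap.id ℝ E -
      fderiv ℝ H ((l, x), φ l x) ∘L .inr ℝ (ℝ × E) E).le_of_opNorm_le hB' v
    rw [_root_.sub_apply, hv, sub_zero, ContinuousLinearMap.id_apply] at h3
    have h4 : ((1 / 2 : NNReal) : ℝ) = 1 / 2 := by norm_num
    rw [h4] at h3
    have : ‖v‖ ≤ 0 := by linarith
    simpa using this
  have hn : ((⊤ : ℕ∞) : WithTop ℕ∞) ≠ 0 := by simp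
  have h1 := cdf.contDiffAt_implicitFunction hn hinv
  -- The implicit function solves the same fixed-point equation, so uniqueness of the fixed point
  -- identifies it with `φ` near `(l, x)`.
  refine h1.congr_of_eventuallyEq ?_
  have h0 : H ((l, x), φ l x) = 0 := by
    have := (hφ l x hl).1
    simp only [hH, Function.uncurry]
    rw [sub_sub, sub_eq_zero]; exact this
  have hmem : ∀ᶠ p : ℝ × E in 𝓝 (l, x), p.1 ∈ Ioo (-τ) τ :=
    continuousAt_fst.eventually (isOpen_Ioo.mem_nhds hl)
  filter_upwards [cdf.eventually_apply_implicitFunction hn hinv, hmem] with p hp hpm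
  refine ((hφ p.1 p.2 hpm).2 _ ?_).symm
  rw [h0] at hp
  simp only [hH, Function.uncurry] at hp
  rwa [sub_sub, sub_eq_zero] at hp

/-- The mean derivative of `F` along the segment from `x` to `y`. -/
def meanDeriv (F : ℝ × ℝ → ℝ) (x y : ℝ × ℝ) : ℝ × ℝ →L[ℝ] ℝ :=
  ∫ t in (0 : ℝ)..1, fderiv ℝ F (x + t • (y - x))

theorem continuous_fderiv_segment {F : ℝ × ℝ → ℝ} (hF : ContDiff ℝ (⊤ : ℕ∞) F)
    (x y : ℝ × ℝ) : Continuous fun t : ℝ => fderiv ℝ F (x + t • (y - x)) :=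
  (hF.continuous_fderiv (by simp)).comp (by fun_prop)

theorem contDiff_meanDeriv {F : ℝ × ℝ → ℝ} (hF : ContDiff ℝ (⊤ : ℕ∞) F) :
    ContDiff ℝ (⊤ : ℕ∞) (Function.uncurry (meanDeriv F)) := by
  rw [← contDiffOn_univ]
  refine ContDiffOn.integral_unitInterval
    (g := fun (p : (ℝ × ℝ) × (ℝ × ℝ)) t => fderiv ℝ F (p.1 + t • (p.2 - p.1))) convex_univ
    uniqueDiffOn_univ ?_
  have h : ContDiff ℝ (⊤ : ℕ∞) (fderiv ℝ F) := hF.fderiv_right (by simp)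
  exact (h.comp (f := fun q : ((ℝ × ℝ) × (ℝ × ℝ)) × ℝ => q.1.1 + q.2 • (q.1.2 - q.1.1))
    (by fun_prop)).contDiffOn

/-- The fundamental theorem of calculus along the segment. The identity is exact, not of first
order, so an implicit step can raise `F` by exactly `l`. -/
theorem meanDeriv_sub {F : ℝ × ℝ → ℝ} (hF : ContDiff ℝ (⊤ : ℕ∞) F)
    (x y : ℝ × ℝ) : meanDeriv F x y (y - x) = F y - F x := by
  have hc := continuous_fderiv_segment hF x y
  rw [meanDeriv, ContinuousLinearMap.intervalIntegral_apply (hc.intervalIntegrable _ _)]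
  rw [intervalIntegral.integral_eq_sub_of_hasDerivAt (f := fun t : ℝ => F (x + t • (y - x)))]
  · simp
  · intro t _
    have h1 : HasDerivAt (fun t : ℝ => x + t • (y - x)) (y - x) t := by
      simpa using ((hasDerivAt_id t).smul_const (y - x)).const_add x
    exact (hF.differentiable (by simp) _).hasFDerivAt.comp_hasDerivAt t h1
  · exact (hc.clm_apply continuous_const).intervalIntegrable _ _

/-- Substitute `1 - t` for `t`. This symmetry is what makes the step by `-l` undo the step by `l`.
-/
theorem meanDeriv_comm {F : ℝ × ℝ → ℝ} (x y : ℝ × ℝ) : meanDeriv F x y = meanDeriv F y x := by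
  have := intervalIntegral.integral_comp_sub_left (a := 0) (b := 1)
    (fun t : ℝ => fderiv ℝ F (x + t • (y - x))) 1
  simp only [sub_self, sub_zero] at this
  rw [meanDeriv, meanDeriv, ← this]
  congr 1
  ext1 t
  congr 1
  module

theorem norm_meanDeriv_le {F : ℝ × ℝ → ℝ} {M : ℝ} (hM : ∀ x, ‖fderiv ℝ F x‖ ≤ M) (x y : ℝ × ℝ) :
    ‖meanDeriv F x y‖ ≤ M := by
  rw [meanDeriv]
  have := intervalIntegral.norm_integral_le_of_norm_le_const (a := (0 : ℝ)) (b := 1)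
    (f := fun t : ℝ => fderiv ℝ F (x + t • (y - x))) (C := M) (fun u _ => hM _)
  simpa using this

theorem norm_meanDeriv_sub_le {F : ℝ × ℝ → ℝ} (hF : ContDiff ℝ (⊤ : ℕ∞) F)
    {M : ℝ} (hM0 : 0 ≤ M)
    (hM : ∀ x y, ‖fderiv ℝ F x - fderiv ℝ F y‖ ≤ M * ‖x - y‖)
    (x y z : ℝ × ℝ) : ‖meanDeriv F x y - meanDeriv F x z‖ ≤ M * ‖y - z‖ := by
  rw [meanDeriv, meanDeriv, ← intervalIntegral.integral_sub
    ((continuous_fderiv_segment hF x y).intervalIntegrable _ _)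
    ((continuous_fderiv_segment hF x z).intervalIntegrable _ _)]
  have := intervalIntegral.norm_integral_le_of_norm_le_const (a := (0 : ℝ)) (b := 1)
    (f := fun t : ℝ => fderiv ℝ F (x + t • (y - x)) - fderiv ℝ F (x + t • (z - x)))
    (C := M * ‖y - z‖) (fun u hu => by
      rw [uIoc_of_le zero_le_one] at hu
      refine (hM _ _).trans ?_
      have e : x + u • (y - x) - (x + u • (z - x)) = u • (y - z) := by module
      rw [e, norm_smul, Real.norm_eq_abs, abs_of_pos hu.1]
      gcongr
      exact mul_le_of_le_one_left (norm_nonneg _) hu.2)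
  simpa using this

theorem meanDeriv_self {F : ℝ × ℝ → ℝ} (x : ℝ × ℝ) : meanDeriv F x x = fderiv ℝ F x := by
  simp [meanDeriv]

/-- Used with periods `v` of `F`, so that the steps commute with the deck translation. -/
theorem meanDeriv_add {F : ℝ × ℝ → ℝ} {v : ℝ × ℝ} (hv : ∀ x, F (x + v) = F x) (x y : ℝ × ℝ) :
    meanDeriv F (x + v) (y + v) = meanDeriv F x y := by
  have h : ∀ x, fderiv ℝ F (x + v) = fderiv ℝ F x := fun x => by
    have := fderiv_comp_add_right (𝕜 := ℝ) (f := F) (x := x) v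
    rw [← this]
    congr 1
    exact funext hv
  rw [meanDeriv, meanDeriv]
  congr 1
  ext1 t
  rw [← h (x + t • (y - x))]
  congr 1
  module

/-- A smooth positive function equal to the identity on `[c, ∞)`. -/
def posCutoff (c z : ℝ) : ℝ := z + (1 - Real.smoothTransition (2 * z / c - 1))

theorem contDiff_posCutoff (c : ℝ) : ContDiff ℝ (⊤ : ℕ∞) (posCutoff c) := by
  unfold posCutoff
  have := (Real.smoothTransition.contDiff (n := ⊤)).comp
    (f := fun z : ℝ => 2 * z / c - 1) (by fun_prop)
  exact contDiff_id.add (contDiff_const.sub this)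

theorem posCutoff_pos {c z : ℝ} (hz : 0 ≤ z) : 0 < posCutoff c z := by
  unfold posCutoff
  rcases hz.eq_or_lt with rfl | hz
  · rw [Real.smoothTransition.zero_of_nonpos (by simp)]; norm_num
  · have := Real.smoothTransition.le_one (2 * z / c - 1)
    linarith

theorem posCutoff_of_le {c z : ℝ} (hc : 0 < c) (hz : c ≤ z) : posCutoff c z = z := by
  unfold posCutoff
  rw [Real.smoothTransition.one_of_one_le]
  · ring
  · have : 1 ≤ z / c := (one_le_div hc).2 hz
    rw [mul_div_assoc]; linarith

/-- The vector dual to `l`, normalized so that `l` takes the value `1` on it if `l` is not small. -/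
def dualVec (c : ℝ) (l : ℝ × ℝ →L[ℝ] ℝ) : ℝ × ℝ :=
  (posCutoff c (l (1, 0) ^ 2 + l (0, 1) ^ 2))⁻¹ • (l (1, 0), l (0, 1))

theorem clm_apply_eq (l : ℝ × ℝ →L[ℝ] ℝ) (v : ℝ × ℝ) :
    l v = v.1 * l (1, 0) + v.2 * l (0, 1) := by
  have : v = v.1 • ((1, 0) : ℝ × ℝ) + v.2 • ((0, 1) : ℝ × ℝ) := by simp
  conv_lhs => rw [this]
  rw [map_add, map_smul, map_smul, smul_eq_mul, smul_eq_mul]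

theorem apply_dualVec {c : ℝ} (hc : 0 < c) {l : ℝ × ℝ →L[ℝ] ℝ}
    (hl : c ≤ l (1, 0) ^ 2 + l (0, 1) ^ 2) : l (dualVec c l) = 1 := by
  rw [dualVec, posCutoff_of_le hc hl, map_smul, clm_apply_eq l (l (1, 0), l (0, 1)), smul_eq_mul]
  have : l (1, 0) ^ 2 + l (0, 1) ^ 2 ≠ 0 := by linarith
  field_simp

theorem contDiff_dualVec (c : ℝ) : ContDiff ℝ (⊤ : ℕ∞) (dualVec c) := by
  have h1 : ∀ v : ℝ × ℝ, ContDiff ℝ (⊤ : ℕ∞) fun l : ℝ × ℝ →L[ℝ] ℝ => l v := fun v => by fun_prop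
  have h2 : ContDiff ℝ (⊤ : ℕ∞) fun l : ℝ × ℝ →L[ℝ] ℝ =>
      posCutoff c (l (1, 0) ^ 2 + l (0, 1) ^ 2) :=
    (contDiff_posCutoff c).comp (((h1 _).pow 2).add ((h1 _).pow 2))
  exact (h2.inv fun l => (posCutoff_pos (by positivity)).ne').smul ((h1 _).prodMk (h1 _))

theorem exists_lipschitz_closedBall {E V : Type*} [NormedAddCommGroup E] [NormedSpace ℝ E]
    [FiniteDimensional ℝ E] [NormedAddCommGroup V] [NormedSpace ℝ V] {w : E → V}
    (hw : ContDiff ℝ (⊤ : ℕ∞) w) (M : ℝ) :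
    ∃ C, 0 ≤ C ∧ ∀ x y, ‖x‖ ≤ M → ‖y‖ ≤ M → ‖w x - w y‖ ≤ C * ‖x - y‖ := by
  have : ProperSpace E := FiniteDimensional.proper ℝ E
  obtain ⟨C, hC⟩ := (isCompact_closedBall (0 : E) M).exists_bound_of_continuousOn
    (hw.continuous_fderiv (by simp)).continuousOn
  refine ⟨max C 0, le_max_right _ _, fun x y hx hy => ?_⟩
  refine (convex_closedBall (0 : E) M).norm_image_sub_le_of_norm_fderiv_le (𝕜 := ℝ)
    (fun z _ => hw.differentiable (by simp) z)
    (fun z hz => (hC z hz).trans (le_max_left _ _)) ?_ ?_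
  · simpa using hy
  · simpa using hx

/-- A family of diffeomorphisms of the plane, defined for small `l`, which raises `F` by `l`. -/
theorem exists_raising_family {F : ℝ × ℝ → ℝ} (hF : ContDiff ℝ (⊤ : ℕ∞) F) {M₁ M₂ m : ℝ}
    (hM₁ : ∀ x, ‖fderiv ℝ F x‖ ≤ M₁)
    (hM₂ : ∀ x y, ‖fderiv ℝ F x - fderiv ℝ F y‖ ≤ M₂ * ‖x - y‖) (hM₂0 : 0 ≤ M₂) (hm : 0 < m)
    (hmF : ∀ x, m ≤ fderiv ℝ F x (1, 0) ^ 2 + fderiv ℝ F x (0, 1) ^ 2) :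
    ∃ τ > 0, ∃ φ : ℝ → ℝ × ℝ → ℝ × ℝ,
      ContDiffOn ℝ (⊤ : ℕ∞) (Function.uncurry φ) (Ioo (-τ) τ ×ˢ univ) ∧
      ∀ l ∈ Ioo (-τ) τ, ∀ x, F (φ l x) = F x + l ∧ φ (-l) (φ l x) = x ∧
        ∀ v, (∀ y, F (y + v) = F y) → φ l (x + v) = φ l x + v := by
  have hM₁0 : 0 ≤ M₁ := (norm_nonneg _).trans (hM₁ 0)
  have hc : 0 < m / 2 := by positivity
  obtain ⟨C, hC0, hC⟩ := exists_lipschitz_closedBall (contDiff_dualVec (m / 2)) M₁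
  -- As long as the mean derivative stays above the threshold `m / 2`, it takes the value `1` on `W
  -- x y`; then `y = x + l • W x y` gives `F y - F x = l`.
  set W : ℝ × ℝ → ℝ × ℝ → ℝ × ℝ := fun x y => dualVec (m / 2) (meanDeriv F x y) with hWdef
  have hW : ContDiff ℝ (⊤ : ℕ∞) (Function.uncurry W) :=
    (contDiff_dualVec (m / 2)).comp (contDiff_meanDeriv hF)
  have hlip : ∀ x y z, ‖W x y - W x z‖ ≤ (C * M₂) * ‖y - z‖ := fun x y z => by
    refine (hC _ _ (norm_meanDeriv_le hM₁ x y) (norm_meanDeriv_le hM₁ x z)).trans ?_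
    rw [mul_assoc]
    gcongr
    exact norm_meanDeriv_sub_le hF hM₂0 hM₂ x y z
  have hWb : ∀ x y, ‖W x y‖ ≤ C * M₁ := fun x y => by
    have := hC _ 0 (norm_meanDeriv_le hM₁ x y) (by simpa using hM₁0)
    have e : dualVec (m / 2) 0 = 0 := by simp [dualVec]
    rw [e, sub_zero, sub_zero] at this
    exact this.trans (by gcongr; exact norm_meanDeriv_le hM₁ x y)
  set A := C * M₂ with hA
  set D := 4 * M₁ * M₂ * (C * M₁) with hD
  have hA0 : 0 ≤ A := by positivity
  have hD0 : 0 ≤ D := by positivity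
  -- The first bound makes the step a `1/2`-contraction. The second keeps the mean derivative on the
  -- short segment close enough to `fderiv ℝ F x` to stay above the threshold.
  set τ := min (1 / (2 * (A + 1))) (m / (2 * (D + 1))) with hτ
  have hτ0 : 0 < τ := by positivity
  have hτA : τ * A ≤ 1 / 2 := by
    have : τ ≤ 1 / (2 * (A + 1)) := min_le_left _ _
    calc τ * A ≤ 1 / (2 * (A + 1)) * A := by gcongr
      _ ≤ 1 / 2 := by rw [div_mul_eq_mul_div, div_le_div_iff₀] <;> nlinarith
  have hτD : τ * D ≤ m / 2 := by
    have : τ ≤ m / (2 * (D + 1)) := min_le_right _ _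
    calc τ * D ≤ m / (2 * (D + 1)) * D := by gcongr
      _ ≤ m / 2 := by rw [div_mul_eq_mul_div, div_le_div_iff₀] <;> nlinarith
  obtain ⟨φ, hφs, hφ⟩ := exists_implicit_step hW hτA hlip
  have hneg : ∀ l ∈ Ioo (-τ) τ, -l ∈ Ioo (-τ) τ := fun l hl => ⟨neg_lt_neg hl.2, neg_lt.1 hl.1⟩
  refine ⟨τ, hτ0, φ, hφs, fun l hl x => ⟨?_, ?_, ?_⟩⟩
  · have h1 := (hφ l hl x).1
    set y := φ l x
    have hl' : |l| ≤ τ := (abs_lt.2 hl).le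
    have h2 : y - x = l • W x y := by rw [sub_eq_iff_eq_add']; exact h1
    have h3 : ‖y - x‖ ≤ τ * (C * M₁) := by
      rw [h2, norm_smul]
      exact mul_le_mul hl' (hWb x y) (norm_nonneg _) hτ0.le
    have h4 : ‖meanDeriv F x y - fderiv ℝ F x‖ ≤ M₂ * (τ * (C * M₁)) := by
      rw [← meanDeriv_self (F := F) x]
      exact (norm_meanDeriv_sub_le hF hM₂0 hM₂ x y x).trans (by gcongr)
    -- Each of the two squared components loses at most `m / 4`, so their sum, at least `m` for the
    -- derivative at `x`, remains at least `m / 2`.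
    have h5 : ∀ e : ℝ × ℝ, ‖e‖ ≤ 1 →
        (fderiv ℝ F x e) ^ 2 - m / 4 ≤ (meanDeriv F x y e) ^ 2 := by
      intro e he
      have b1 : |meanDeriv F x y e - fderiv ℝ F x e| ≤ M₂ * (τ * (C * M₁)) := by
        have := (meanDeriv F x y - fderiv ℝ F x).le_of_opNorm_le h4 e
        rw [_root_.sub_apply] at this
        exact this.trans (mul_le_of_le_one_right (by positivity) he)
      have b2 : |meanDeriv F x y e| ≤ M₁ :=
        ((meanDeriv F x y).le_of_opNorm_le (norm_meanDeriv_le hM₁ x y) e).trans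
          (mul_le_of_le_one_right hM₁0 he)
      have b3 : |fderiv ℝ F x e| ≤ M₁ :=
        ((fderiv ℝ F x).le_of_opNorm_le (hM₁ x) e).trans (mul_le_of_le_one_right hM₁0 he)
      have b4 : |(meanDeriv F x y e) ^ 2 - (fderiv ℝ F x e) ^ 2| ≤ m / 4 := by
        have e1 : (meanDeriv F x y e) ^ 2 - (fderiv ℝ F x e) ^ 2
          = (meanDeriv F x y e - fderiv ℝ F x e) * (meanDeriv F x y e + fderiv ℝ F x e) := by ring
        rw [e1, abs_mul]
        calc _ ≤ M₂ * (τ * (C * M₁)) * (M₁ + M₁) := by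
              gcongr
              exact (abs_add_le _ _).trans (add_le_add b2 b3)
          _ = (τ * D) / 2 := by rw [hD]; ring
          _ ≤ m / 4 := by linarith
      linarith [(abs_le.1 b4).1]
    have h6 : m / 2 ≤ meanDeriv F x y (1, 0) ^ 2 + meanDeriv F x y (0, 1) ^ 2 := by
      have := h5 (1, 0) (by simp [Prod.norm_def])
      have := h5 (0, 1) (by simp [Prod.norm_def])
      have := hmF x
      linarith
    have h7 := meanDeriv_sub hF x y
    rw [h2, map_smul, hWdef] at h7
    simp only [apply_dualVec hc h6, smul_eq_mul, mul_one] at h7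
    linarith
  -- By symmetry of `W`, the point `x` solves the equation of the step by `-l` issued from `φ l x`;
  -- uniqueness does the rest.
  · symm
    apply (hφ (-l) (hneg l hl) _).2
    have h1 := (hφ l hl x).1
    have h2 : W (φ l x) x = W x (φ l x) := by simp only [hWdef, meanDeriv_comm]
    rw [h2, neg_smul, eq_add_neg_iff_add_eq]
    exact h1.symm
  · intro v hv
    symm
    apply (hφ l hl (x + v)).2
    have h1 := (hφ l hl x).1
    have h2 : W (x + v) (φ l x + v) = W x (φ l x) := by simp only [hWdef, meanDeriv_add hv]
    rw [h2]
    conv_lhs => rw [h1]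
    abel

/-! ### Translation-equivariant diffeomorphisms of strips and conjugation to the first coordinate -/

/-- The closed strip over `[a, b]`. -/
def strip (a b : ℝ) : Set (ℝ × ℝ) := Icc a b ×ˢ univ

theorem mem_strip {a b : ℝ} {p : ℝ × ℝ} : p ∈ strip a b ↔ a ≤ p.1 ∧ p.1 ≤ b := by
  simp [strip]

theorem convex_strip (a b : ℝ) : Convex ℝ (strip a b) := (convex_Icc a b).prod convex_univ

theorem uniqueDiffOn_strip {a b : ℝ} (h : a < b) : UniqueDiffOn ℝ (strip a b) :=
  (uniqueDiffOn_Icc h).prod uniqueDiffOn_univ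

theorem add_mem_strip {a b : ℝ} {p : ℝ × ℝ} (t : ℝ) : p + (0, t) ∈ strip a b ↔ p ∈ strip a b := by
  simp [mem_strip]

/-- `R` is a smooth diffeomorphism, with inverse `R'`, of the strip over `[a, b]` onto the strip
over `[c, d]`, commuting with the unit translation. -/
structure IsStripDiffeo (a b c d : ℝ) (R R' : ℝ × ℝ → ℝ × ℝ) : Prop where
  smooth : ContDiffOn ℝ (⊤ : ℕ∞) R (strip a b)
  smooth' : ContDiffOn ℝ (⊤ : ℕ∞) R' (strip c d)
  mapsTo : MapsTo R (strip a b) (strip c d)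
  mapsTo' : MapsTo R' (strip c d) (strip a b)
  left_inv : ∀ p ∈ strip a b, R' (R p) = p
  right_inv : ∀ p ∈ strip c d, R (R' p) = p
  shift : ∀ p ∈ strip a b, R (p + (0, 1)) = R p + (0, 1)

namespace IsStripDiffeo

variable {a b c d e f : ℝ} {R R' S S' : ℝ × ℝ → ℝ × ℝ}

theorem symm (h : IsStripDiffeo a b c d R R') : IsStripDiffeo c d a b R' R where
  smooth := h.smooth'
  smooth' := h.smooth
  mapsTo := h.mapsTo'
  mapsTo' := h.mapsTo
  left_inv := h.right_inv
  right_inv := h.left_inv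
  shift p hp := by
    have h1 := h.left_inv _ ((add_mem_strip 1).2 (h.mapsTo' hp))
    rw [h.shift _ (h.mapsTo' hp), h.right_inv p hp] at h1
    exact h1

theorem trans (h : IsStripDiffeo a b c d R R') (k : IsStripDiffeo c d e f S S') :
    IsStripDiffeo a b e f (S ∘ R) (R' ∘ S') where
  smooth := k.smooth.comp h.smooth h.mapsTo
  smooth' := h.smooth'.comp k.smooth' k.mapsTo'
  mapsTo := k.mapsTo.comp h.mapsTo
  mapsTo' := h.mapsTo'.comp k.mapsTo'
  left_inv p hp := by simp [k.left_inv _ (h.mapsTo hp), h.left_inv p hp]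
  right_inv p hp := by simp [h.right_inv _ (k.mapsTo' hp), k.right_inv p hp]
  shift p hp := by simp [h.shift p hp, k.shift _ (h.mapsTo hp)]

theorem shift_nat (h : IsStripDiffeo a b c d R R') {p : ℝ × ℝ} (hp : p ∈ strip a b) (n : ℕ) :
    R (p + (0, (n : ℝ))) = R p + (0, (n : ℝ)) := by
  induction n with
  | zero => simp [Prod.mk_zero_zero]
  | succ n ih =>
    have h1 := h.shift _ ((add_mem_strip (n : ℝ)).2 hp)
    rw [ih, add_assoc, add_assoc] at h1
    simpa using h1

theorem shift_int (h : IsStripDiffeo a b c d R R') {p : ℝ × ℝ} (hp : p ∈ strip a b) (n : ℤ) :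
    R (p + (0, (n : ℝ))) = R p + (0, (n : ℝ)) := by
  obtain ⟨k, rfl | rfl⟩ := n.eq_nat_or_neg
  · exact_mod_cast h.shift_nat hp k
  · have h1 := h.shift_nat ((add_mem_strip (-(k : ℝ))).2 hp) k
    rw [add_assoc] at h1
    have e : ((0, -(k : ℝ)) : ℝ × ℝ) + (0, (k : ℝ)) = 0 := by ext <;> simp
    rw [e, add_zero] at h1
    push_cast
    rw [h1, add_assoc, add_comm ((0, (k : ℝ)) : ℝ × ℝ), e, add_zero]

theorem shift_iff (h : IsStripDiffeo a b c d R R') {p q : ℝ × ℝ} (hp : p ∈ strip a b)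
    (hq : q ∈ strip a b) :
    (∃ n : ℤ, R q = R p + (0, (n : ℝ))) ↔ ∃ n : ℤ, q = p + (0, (n : ℝ)) := by
  refine exists_congr fun n => ?_
  rw [← h.shift_int hp]
  exact ⟨fun e => by
    rw [← h.left_inv q hq, e, h.left_inv _ ((add_mem_strip _).2 hp)], fun e => by rw [e]⟩

end IsStripDiffeo

/-- A periodic function on the plane not depending on the first coordinate outside `[1, 2]` takes
all its values on a compact rectangle. -/
theorem exists_mem_rectangle_eq {V : Type*} {k : ℝ × ℝ → V} (hper : ∀ p, k (p + (0, 1)) = k p)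
    {k₀ : V} (hk : ∀ p, p.1 ≤ 1 ∨ 2 ≤ p.1 → k p = k₀) (p : ℝ × ℝ) :
    ∃ q ∈ Icc (1 : ℝ) 2 ×ˢ Icc (0 : ℝ) 1, k q = k p := by
  by_cases hp : p.1 ≤ 1 ∨ 2 ≤ p.1
  · exact ⟨(1, 0), by simp, by rw [hk p hp, hk (1, 0) (by simp)]⟩
  · push Not at hp
    have hP : Function.Periodic (fun t => k (p.1, t)) 1 := fun t => by
      simpa using hper (p.1, t)
    obtain ⟨t, ht, htp⟩ := hP.exists_mem_Ico₀ one_pos p.2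
    exact ⟨(p.1, t), ⟨⟨hp.1.le, hp.2.le⟩, ⟨ht.1, ht.2.le⟩⟩, htp.symm⟩

theorem contDiffOn_iterate_family {φ : ℝ → ℝ × ℝ → ℝ × ℝ} {T : Set ℝ}
    (hφ : ContDiffOn ℝ (⊤ : ℕ∞) (Function.uncurry φ) (T ×ˢ univ)) (n : ℕ) :
    ContDiffOn ℝ (⊤ : ℕ∞) (fun q : ℝ × (ℝ × ℝ) => (φ q.1)^[n] q.2) (T ×ˢ univ) := by
  induction n with
  | zero => exact contDiffOn_snd
  | succ n ih =>
    simp only [Function.iterate_succ_apply']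
    exact hφ.comp (contDiffOn_fst.prodMk ih) fun q hq => ⟨hq.1, mem_univ _⟩

/-- A function without critical points which is standard near the boundary of the strip is
conjugate to the first coordinate. -/
theorem exists_stripDiffeo_of_standard_near_boundary {F : ℝ × ℝ → ℝ}
    (hF : ContDiff ℝ (⊤ : ℕ∞) F)
    (hper : ∀ p, F (p + (0, 1)) = F p) {a b c δ : ℝ} (hab : a < b) (hc : 0 < c) (hδ : 0 < δ)
    (hl : ∀ p, p.1 ≤ 1 + δ → F p = a + c * (p.1 - 1))
    (hr : ∀ p, 2 - δ ≤ p.1 → F p = b + c * (p.1 - 2))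
    (hcrit : ∀ p, fderiv ℝ F p ≠ 0) (hin : ∀ p, 1 < p.1 → p.1 < 2 → a < F p ∧ F p < b) :
    ∃ Ψ Ψ', IsStripDiffeo a b 1 2 Ψ Ψ' ∧ ∀ p ∈ strip a b, F (Ψ p) = p.1 := by
  -- Equality on a neighbourhood rather than at the point alone, so that it can be differentiated
  -- once more: the second derivative vanishes there too, and a compact rectangle suffices for all
  -- the bounds below.
  have hD : ∀ p : ℝ × ℝ, p.1 ≤ 1 ∨ 2 ≤ p.1 →
      fderiv ℝ F =ᶠ[𝓝 p] fun _ => c • ContinuousLinearMap.fst ℝ ℝ ℝ := by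
    have hlin : ∀ (e r : ℝ) (q : ℝ × ℝ), HasFDerivAt (fun p : ℝ × ℝ => e + c * (p.1 - r))
        (c • ContinuousLinearMap.fst ℝ ℝ ℝ) q := fun e r q =>
      ((hasFDerivAt_fst.sub_const r).const_mul c).const_add e
    rintro p (hp | hp)
    · have h1 : ∀ᶠ q : ℝ × ℝ in 𝓝 p, q.1 < 1 + δ :=
        continuousAt_fst.eventually_lt continuousAt_const (by linarith)
      filter_upwards [h1.eventually_nhds] with q hq
      exact ((hlin a 1 q).congr_of_eventuallyEq (hq.mono fun z hz => hl z hz.le)).fderiv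
    · have h1 : ∀ᶠ q : ℝ × ℝ in 𝓝 p, 2 - δ < q.1 :=
        continuousAt_const.eventually_lt continuousAt_fst (by linarith)
      filter_upwards [h1.eventually_nhds] with q hq
      exact ((hlin b 2 q).congr_of_eventuallyEq (hq.mono fun z hz => hr z hz.le)).fderiv
  have hD0 : ∀ p : ℝ × ℝ, p.1 ≤ 1 ∨ 2 ≤ p.1 →
      fderiv ℝ F p = c • ContinuousLinearMap.fst ℝ ℝ ℝ := fun p hp => (hD p hp).eq_of_nhds
  have hDD0 : ∀ p : ℝ × ℝ, p.1 ≤ 1 ∨ 2 ≤ p.1 → fderiv ℝ (fderiv ℝ F) p = 0 := fun p hp => by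
    rw [(hD p hp).fderiv_eq]
    exact congrFun (fderiv_const _) p
  have hDper : ∀ p, fderiv ℝ F (p + (0, 1)) = fderiv ℝ F p := fun p => by
    rw [← fderiv_comp_add_right]
    congr 1
    exact funext hper
  have hDDper : ∀ p, fderiv ℝ (fderiv ℝ F) (p + (0, 1)) = fderiv ℝ (fderiv ℝ F) p := fun p => by
    rw [← fderiv_comp_add_right]
    congr 1
    exact funext hDper
  have hDs : ContDiff ℝ (⊤ : ℕ∞) (fderiv ℝ F) := hF.fderiv_right (by simp)
  have hcpt : IsCompact (Icc (1 : ℝ) 2 ×ˢ Icc (0 : ℝ) 1) := isCompact_Icc.prod isCompact_Icc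
  obtain ⟨M₁, hM₁⟩ := hcpt.exists_bound_of_continuousOn hDs.continuous.continuousOn
  obtain ⟨M₂, hM₂⟩ := hcpt.exists_bound_of_continuousOn
    (hDs.continuous_fderiv (by simp)).continuousOn
  have hM₁' : ∀ x, ‖fderiv ℝ F x‖ ≤ M₁ := fun x => by
    obtain ⟨q, hq, e⟩ := exists_mem_rectangle_eq hDper hD0 x
    rw [← e]; exact hM₁ q hq
  have hM₂'' : ∀ x, ‖fderiv ℝ (fderiv ℝ F) x‖ ≤ M₂ := fun x => by
    obtain ⟨q, hq, e⟩ := exists_mem_rectangle_eq hDDper hDD0 x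
    rw [← e]; exact hM₂ q hq
  have hM₂' : ∀ x y, ‖fderiv ℝ F x - fderiv ℝ F y‖ ≤ M₂ * ‖x - y‖ := fun x y =>
    convex_univ.norm_image_sub_le_of_norm_fderiv_le (𝕜 := ℝ)
      (fun z _ => hDs.differentiable (by simp) z) (fun z _ => hM₂'' z) (mem_univ y) (mem_univ x)
  set N : ℝ × ℝ → ℝ := fun x => fderiv ℝ F x (1, 0) ^ 2 + fderiv ℝ F x (0, 1) ^ 2 with hN
  have hNc : Continuous N := by
    have := hDs.continuous
    fun_prop
  obtain ⟨x₀, -, hx₀⟩ := hcpt.exists_isMinOn ⟨(1, 0), by simp⟩ hNc.continuousOn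
  have hNpos : 0 < N x₀ := by
    by_contra! h
    have h0 : 0 ≤ fderiv ℝ F x₀ (1, 0) ^ 2 := sq_nonneg _
    have h1 : 0 ≤ fderiv ℝ F x₀ (0, 1) ^ 2 := sq_nonneg _
    have h2 : fderiv ℝ F x₀ (1, 0) = 0 := pow_eq_zero_iff two_ne_zero |>.1 (by
      simp only [hN] at h; linarith)
    have h3 : fderiv ℝ F x₀ (0, 1) = 0 := pow_eq_zero_iff two_ne_zero |>.1 (by
      simp only [hN] at h; linarith)
    refine hcrit x₀ (ContinuousLinearMap.ext fun v => ?_)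
    rw [clm_apply_eq, h2, h3]; simp
  have hmF : ∀ x, N x₀ ≤ N x := fun x => by
    obtain ⟨q, hq, e⟩ := exists_mem_rectangle_eq hDper hD0 x
    have : N q = N x := by simp only [hN, e]
    rw [← this]; exact hx₀ hq
  obtain ⟨τ, hτ, φ, hφs, hφ⟩ := exists_raising_family hF hM₁' hM₂'
    ((norm_nonneg (fderiv ℝ (fderiv ℝ F) 0)).trans (hM₂'' 0)) hNpos hmF
  -- With this `n`, the step `(s - a) / n` is admissible for every `s` in `[a, b]`, and `n` such
  -- steps climb from level `a` to level `s`.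
  obtain ⟨n, hn⟩ := exists_nat_gt ((b - a) / τ)
  have hn0 : (0 : ℝ) < n := lt_of_le_of_lt (div_nonneg (by linarith) hτ.le) hn
  have hl1 : ∀ s ∈ Icc a b, (s - a) / n ∈ Ioo (-τ) τ := fun s hs => by
    have h1 : 0 ≤ (s - a) / n := div_nonneg (by linarith [hs.1]) hn0.le
    refine ⟨by linarith, ?_⟩
    rw [div_lt_iff₀ hτ] at hn
    rw [div_lt_iff₀ hn0]
    nlinarith [hs.2]
  have hl2 : ∀ s ∈ Icc a b, -((s - a) / n) ∈ Ioo (-τ) τ := fun s hs =>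
    ⟨neg_lt_neg (hl1 s hs).2, neg_lt.1 (hl1 s hs).1⟩
  have hFit : ∀ l ∈ Ioo (-τ) τ, ∀ (k : ℕ) x, F ((φ l)^[k] x) = F x + k * l := by
    intro l hl k x
    induction k with
    | zero => simp
    | succ k ih => rw [Function.iterate_succ_apply', (hφ l hl _).1, ih]; push_cast; ring
  have hinv : ∀ l ∈ Ioo (-τ) τ, ∀ x, (φ (-l))^[n] ((φ l)^[n] x) = x := fun l hl =>
    Function.LeftInverse.iterate (fun x => (hφ l hl x).2.1) n
  have hshift : ∀ l ∈ Ioo (-τ) τ, ∀ x, (φ l)^[n] (x + (0, 1)) = (φ l)^[n] x + (0, 1) :=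
    fun l hl x => by
      have : Function.Commute (φ l) (fun x => x + (0, 1)) := fun x => (hφ l hl x).2.2 _ hper
      exact (this.iterate_left n) x
  have hF1 : ∀ p : ℝ × ℝ, p.1 = 1 → F p = a := fun p hp => by
    rw [hl p (by linarith), hp]; ring
  have hFmem : ∀ p, F p ∈ Icc a b ↔ p ∈ strip 1 2 := by
    intro p
    rw [mem_strip, mem_Icc]
    rcases lt_or_ge p.1 1 with h | h
    · have h0 := hl p (by linarith)
      exact ⟨fun h' => by nlinarith, fun h' => by linarith⟩
    rcases lt_or_ge 2 p.1 with h2 | h2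
    · have h0 := hr p (by linarith)
      exact ⟨fun h' => by nlinarith, fun h' => by linarith⟩
    refine ⟨fun _ => ⟨h, h2⟩, fun _ => ?_⟩
    rcases h.eq_or_lt with h3 | h3
    · rw [hF1 p h3.symm]; exact ⟨le_rfl, hab.le⟩
    rcases h2.eq_or_lt with h4 | h4
    · rw [hr p (by linarith), h4]; constructor <;> linarith
    exact ⟨(hin p h3 h4).1.le, (hin p h3 h4).2.le⟩
  have hFa : ∀ p, F p = a → p.1 = 1 := by
    intro p hp
    have h0 := (hFmem p).1 (by rw [hp]; exact ⟨le_rfl, hab.le⟩)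
    rw [mem_strip] at h0
    by_contra hne
    have h3 : 1 < p.1 := lt_of_le_of_ne h0.1 (Ne.symm hne)
    rcases h0.2.eq_or_lt with h4 | h4
    · have := hr p (by linarith)
      rw [h4] at this; linarith
    · linarith [(hin p h3 h4).1]
  have hΨF : ∀ s ∈ Icc a b, ∀ t, F ((φ ((s - a) / n))^[n] (1, t)) = s := fun s hs t => by
    rw [hFit _ (hl1 s hs), hF1 _ rfl]
    field_simp
    ring
  have hΨ' : ∀ p ∈ strip 1 2, ((φ (-((F p - a) / n)))^[n] p).1 = 1 := fun p hp => by
    apply hFa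
    rw [hFit _ (hl2 _ ((hFmem p).2 hp))]
    field_simp
    ring
  -- The map climbs `n` equal steps from the line at `1`, which is the level `a`. Its inverse
  -- descends by as many steps and records the level and the second coordinate of the foot.
  refine ⟨fun p => (φ ((p.1 - a) / n))^[n] (1, p.2),
    fun p => (F p, ((φ (-((F p - a) / n)))^[n] p).2), ⟨?_, ?_, ?_, ?_, ?_, ?_, ?_⟩, ?_⟩
  · refine (contDiffOn_iterate_family hφs n).comp
      (f := fun p : ℝ × ℝ => ((p.1 - a) / n, ((1 : ℝ), p.2))) (by fun_prop) ?_
    exact fun p hp => ⟨hl1 _ hp.1, mem_univ _⟩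
  · refine hF.contDiffOn.prodMk (contDiff_snd.comp_contDiffOn
      ((contDiffOn_iterate_family hφs n).comp
      (f := fun p : ℝ × ℝ => (-((F p - a) / n), p)) ?_ ?_))
    · exact ContDiff.contDiffOn (by fun_prop)
    · exact fun p hp => ⟨hl2 _ ((hFmem p).2 hp), mem_univ _⟩
  · intro p hp
    refine (hFmem _).1 ?_
    rw [hΨF _ hp.1]; exact hp.1
  · exact fun p hp => ⟨(hFmem p).2 hp, mem_univ _⟩
  · intro p hp
    rw [hΨF _ hp.1, hinv _ (hl1 _ hp.1)]
  · intro p hp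
    simp only
    have h1 : ((1 : ℝ), ((φ (-((F p - a) / n)))^[n] p).2) = (φ (-((F p - a) / n)))^[n] p :=
      Prod.ext (hΨ' p hp).symm rfl
    rw [h1]
    have := hinv _ (hl2 _ ((hFmem p).2 hp)) p
    rwa [neg_neg] at this
  · intro p hp
    have := hshift _ (hl1 _ hp.1) (1, p.2)
    simpa using this
  · exact fun p hp => hΨF _ hp.1 _

/-! ### Straightening near the boundary lines and extension to the plane -/

theorem HasDerivWithinAt.nonneg_of_mul_nonneg {f : ℝ → ℝ} {f' x : ℝ} {s : Set ℝ}
    (hf : HasDerivWithinAt f f' s x) (hs : UniqueDiffWithinAt ℝ s x)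
    (h : ∀ y ∈ s, 0 ≤ (f y - f x) * (y - x)) : 0 ≤ f' := by
  have hne : (𝓝[s \ {x}] x).NeBot := by
    have := uniqueDiffWithinAt_iff_accPt.1 hs
    rwa [accPt_principal_iff_nhdsWithin] at this
  refine ge_of_tendsto (hasDerivWithinAt_iff_tendsto_slope.1 hf) ?_
  filter_upwards [self_mem_nhdsWithin] with y hy
  rw [slope_def_field]
  have h1 : y - x ≠ 0 := sub_ne_zero.2 hy.2
  rw [← mul_div_mul_right _ _ h1]
  exact div_nonneg (h y hy.1) (mul_self_nonneg _)

theorem exists_pos_lower_bound_of_periodic {h : ℝ → ℝ} (hc : Continuous h)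
    (hp : ∀ t, h (t + 1) = h t) (hpos : ∀ t, 0 < h t) : ∃ m > 0, ∀ t, m ≤ h t := by
  obtain ⟨t₀, -, ht₀⟩ := (isCompact_Icc (a := (0 : ℝ)) (b := 1)).exists_isMinOn
    ⟨0, by simp⟩ hc.continuousOn
  refine ⟨h t₀, hpos t₀, fun t => ?_⟩
  obtain ⟨u, hu, e⟩ := (show Function.Periodic h 1 from hp).exists_mem_Ico₀ one_pos t
  rw [e]
  exact ht₀ ⟨hu.1, hu.2.le⟩

open Pointwise in
theorem fderivWithin_strip_add {V : Type*} [NormedAddCommGroup V] [NormedSpace ℝ V] {a b t : ℝ}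
    {f : ℝ × ℝ → V} (hper : ∀ p ∈ strip a b, f (p + (0, t)) = f p) {p : ℝ × ℝ}
    (hp : p ∈ strip a b) :
    fderivWithin ℝ f (strip a b) (p + (0, t)) = fderivWithin ℝ f (strip a b) p := by
  have h1 : ((0, t) : ℝ × ℝ) +ᵥ strip a b = strip a b := by
    ext q
    rw [mem_vadd_set_iff_neg_vadd_mem, mem_strip, mem_strip]
    simp
  have h2 := fderivWithin_comp_add_right (𝕜 := ℝ) (f := f) (s := strip a b) (x := p) (0, t)
  rw [h1] at h2
  rw [← h2]
  exact fderivWithin_congr hper (hper p hp)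

theorem HasFDerivWithinAt.strip_fst {V : Type*} [NormedAddCommGroup V] [NormedSpace ℝ V] {a b : ℝ}
    {f : ℝ × ℝ → V} {f' : ℝ × ℝ →L[ℝ] V} {p : ℝ × ℝ} (h : HasFDerivWithinAt f f' (strip a b) p) :
    HasDerivWithinAt (fun r => f (r, p.2)) (f' (1, 0)) (Icc a b) p.1 := by
  have h1 : HasDerivWithinAt (fun r : ℝ => (r, p.2)) ((1 : ℝ), (0 : ℝ)) (Icc a b) p.1 :=
    (hasDerivWithinAt_id _ _).prodMk (hasDerivWithinAt_const _ _ _)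
  exact HasFDerivWithinAt.comp_hasDerivWithinAt_of_eq (t := strip a b) p.1 h h1
    (fun r hr => ⟨hr, mem_univ _⟩) rfl

theorem HasFDerivWithinAt.strip_snd {V : Type*} [NormedAddCommGroup V] [NormedSpace ℝ V] {a b : ℝ}
    {f : ℝ × ℝ → V} {f' : ℝ × ℝ →L[ℝ] V} {p : ℝ × ℝ} (h : HasFDerivWithinAt f f' (strip a b) p)
    (hp : p ∈ strip a b) :
    HasDerivAt (fun t => f (p.1, t)) (f' (0, 1)) p.2 := by
  have h1 : HasDerivAt (fun t : ℝ => (p.1, t)) ((0 : ℝ), (1 : ℝ)) p.2 :=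
    (hasDerivAt_const _ _).prodMk (hasDerivAt_id _)
  rw [← hasDerivWithinAt_univ]
  exact HasFDerivWithinAt.comp_hasDerivWithinAt_of_eq (t := strip a b) p.2 h
    h1.hasDerivWithinAt (fun r _ => ⟨hp.1, mem_univ _⟩) rfl

/-- Positivity of a periodic function on a vertical line persists on a collar. -/
theorem exists_collar {k : ℝ × ℝ → ℝ} {r₀ : ℝ} (hr₀ : r₀ ∈ Icc (1 : ℝ) 2)
    (hk : ContinuousOn k (strip 1 2)) (hper : ∀ p ∈ strip 1 2, k (p + (0, 1)) = k p)
    (hpos : ∀ t, 0 < k (r₀, t)) :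
    ∃ δ > 0, ∀ p ∈ strip 1 2, |p.1 - r₀| < δ → 0 < k p := by
  have hline : ∀ r ∈ Icc (1 : ℝ) 2, ∀ t, k (r, t + 1) = k (r, t) := fun r hr t => by
    have := hper (r, t) ⟨hr, mem_univ _⟩
    simpa using this
  obtain ⟨m, hm, hmk⟩ := exists_pos_lower_bound_of_periodic (h := fun t => k (r₀, t)) (by
    rw [← continuousOn_univ]
    exact hk.comp (f := fun t => (r₀, t)) (by fun_prop) fun t _ => ⟨hr₀, mem_univ _⟩)
    (hline r₀ hr₀) hpos
  obtain ⟨v, hv, hvu⟩ := (isCompact_Icc (a := (0 : ℝ)) (b := 1)).mem_uniformity_of_prod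
    (f := fun r t => k (r, t)) (hk.mono (prod_mono subset_rfl (subset_univ _))) hr₀
    (Metric.dist_mem_uniformity hm)
  obtain ⟨δ, hδ, hδv⟩ := Metric.mem_nhdsWithin_iff.1 hv
  refine ⟨δ, hδ, fun p hp hpd => ?_⟩
  obtain ⟨u, hu, e⟩ := (show Function.Periodic (fun t => k (p.1, t)) 1 from
    hline p.1 hp.1).exists_mem_Ico₀ one_pos p.2
  have h1 : dist (k (p.1, u)) (k (r₀, u)) < m :=
    hvu p.1 (hδv ⟨by rwa [Metric.mem_ball, Real.dist_eq], hp.1⟩) u ⟨hu.1, hu.2.le⟩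
  have h2 := hmk u
  have h3 : k p = k (p.1, u) := e
  rw [h3]
  rw [Real.dist_eq] at h1
  linarith [(abs_lt.1 h1).1]

/-- Fibrewise increasing self-maps of the strip are strip diffeomorphisms. -/
theorem exists_isStripDiffeo_of_fst_increasing {q : ℝ × ℝ → ℝ}
    (hq : ContDiffOn ℝ (⊤ : ℕ∞) q (strip 1 2)) (hper : ∀ p ∈ strip 1 2, q (p + (0, 1)) = q p)
    (h1 : ∀ t, q (1, t) = 1) (h2 : ∀ t, q (2, t) = 2)
    (hpos : ∀ p ∈ strip 1 2, 0 < fderivWithin ℝ q (strip 1 2) p (1, 0)) :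
    (∃ Q', IsStripDiffeo 1 2 1 2 (fun p => (q p, p.2)) Q') ∧
      ∀ t, StrictMonoOn (fun r => q (r, t)) (Icc 1 2) := by
  have hu : UniqueDiffOn ℝ (strip 1 2) := uniqueDiffOn_strip one_lt_two
  have hd : ∀ p ∈ strip 1 2, HasFDerivWithinAt q (fderivWithin ℝ q (strip 1 2) p) (strip 1 2) p :=
    fun p hp => (hq.differentiableOn (by simp) p hp).hasFDerivWithinAt
  have hc : ∀ t, ContinuousOn (fun r => q (r, t)) (Icc 1 2) := fun t =>
    hq.continuousOn.comp (f := fun r => (r, t)) (by fun_prop) fun r hr => ⟨hr, mem_univ _⟩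
  have hmono : ∀ t, StrictMonoOn (fun r => q (r, t)) (Icc 1 2) := fun t =>
    strictMonoOn_of_hasDerivWithinAt_pos (convex_Icc 1 2) (hc t)
      (f' := fun r => fderivWithin ℝ q (strip 1 2) (r, t) (1, 0))
      (fun r hr => (hd (r, t) ⟨interior_subset hr, mem_univ _⟩).strip_fst.mono interior_subset)
      (fun r hr => hpos (r, t) ⟨interior_subset hr, mem_univ _⟩)
  refine ⟨?_, hmono⟩
  have hex : ∀ t y, ∃ r, y ∈ Icc (1 : ℝ) 2 → r ∈ Icc (1 : ℝ) 2 ∧ q (r, t) = y := by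
    intro t y
    by_cases hy : y ∈ Icc (1 : ℝ) 2
    · have := intermediate_value_Icc one_le_two (hc t)
      rw [h1, h2] at this
      obtain ⟨r, hr, e⟩ := this hy
      exact ⟨r, fun _ => ⟨hr, e⟩⟩
    · exact ⟨0, fun h => absurd h hy⟩
  choose ρ hρ using hex
  have hmaps : ∀ p ∈ strip 1 2, q p ∈ Icc (1 : ℝ) 2 := fun p hp => by
    have m := (hmono p.2).monotoneOn
    have a1 := m (left_mem_Icc.2 one_le_two) hp.1 hp.1.1
    have a2 := m hp.1 (right_mem_Icc.2 one_le_two) hp.1.2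
    simp only [h1, h2] at a1 a2
    exact ⟨a1, a2⟩
  -- The inversion is in the first coordinate with the second as parameter, so the two are swapped
  -- to fit `contDiffOn_fiberwise_inverse`.
  have hswap : ContDiffOn ℝ (⊤ : ℕ∞) (Function.uncurry fun t r => q (r, t))
      (univ ×ˢ Icc (1 : ℝ) 2) :=
    hq.comp (f := fun p : ℝ × ℝ => (p.2, p.1)) (by fun_prop) fun p hp => ⟨hp.2, mem_univ _⟩
  have hρs : ContDiffOn ℝ (⊤ : ℕ∞) (Function.uncurry ρ) (univ ×ˢ Icc (1 : ℝ) 2) := by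
    refine contDiffOn_fiberwise_inverse (convex_Icc 1 2) uniqueDiffOn_univ
      (uniqueDiffOn_Icc one_lt_two) (uniqueDiffOn_Icc one_lt_two) hswap ?_
      (fun t _ => hmono t) (fun t _ y hy => (hρ t y hy).1) (fun t _ y hy => (hρ t y hy).2)
    intro t _ r hr
    have hd1 := (hd (r, t) ⟨hr, mem_univ _⟩)
    have hsw : HasFDerivWithinAt (fun p : ℝ × ℝ => (p.2, p.1))
        ((ContinuousLinearMap.snd ℝ ℝ ℝ).prod (ContinuousLinearMap.fst ℝ ℝ ℝ))
        (univ ×ˢ Icc (1 : ℝ) 2) (t, r) := hasFDerivWithinAt_snd.prodMk hasFDerivWithinAt_fst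
    have hmaps : MapsTo (fun p : ℝ × ℝ => (p.2, p.1)) (univ ×ˢ Icc (1 : ℝ) 2) (strip 1 2) :=
      fun p hp => ⟨hp.2, mem_univ _⟩
    have hcomp : HasFDerivWithinAt (Function.uncurry fun t r => q (r, t)) _
        (univ ×ˢ Icc (1 : ℝ) 2) (t, r) := HasFDerivWithinAt.comp (g := q) (t, r) hd1 hsw hmaps
    rw [hcomp.fderivWithin ((uniqueDiffOn_univ.prod (uniqueDiffOn_Icc one_lt_two)) _
      ⟨mem_univ _, hr⟩)]
    simpa using hpos (r, t) ⟨hr, mem_univ _⟩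
  refine ⟨fun p => (ρ p.2 p.1, p.2), ⟨?_, ?_, ?_, ?_, ?_, ?_, ?_⟩⟩
  · exact hq.prodMk contDiffOn_snd
  · refine ContDiffOn.prodMk ?_ contDiffOn_snd
    exact hρs.comp (f := fun p : ℝ × ℝ => (p.2, p.1)) (by fun_prop) fun p hp => ⟨mem_univ _, hp.1⟩
  · exact fun p hp => ⟨hmaps p hp, mem_univ _⟩
  · exact fun p hp => ⟨(hρ _ _ hp.1).1, mem_univ _⟩
  · intro p hp
    have h3 := hρ p.2 (q p) (hmaps p hp)
    exact Prod.ext ((hmono p.2).injOn h3.1 hp.1 h3.2) rfl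
  · exact fun p hp => Prod.ext (hρ _ _ hp.1).2 rfl
  · intro p hp
    ext
    · simpa using hper p hp
    · simp

/-- A smooth cutoff function, equal to `1` on `(-∞, 1]` and to `0` on `[2, ∞)`. -/
def stepDown (x : ℝ) : ℝ := Real.smoothTransition (2 - x)

theorem contDiff_stepDown : ContDiff ℝ (⊤ : ℕ∞) stepDown :=
  Real.smoothTransition.contDiff.comp (f := fun x : ℝ => 2 - x) (by fun_prop)

theorem stepDown_of_le {x : ℝ} (h : x ≤ 1) : stepDown x = 1 :=
  Real.smoothTransition.one_of_one_le (by linarith)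

theorem stepDown_of_ge {x : ℝ} (h : 2 ≤ x) : stepDown x = 0 :=
  Real.smoothTransition.zero_of_nonpos (by linarith)

theorem stepDown_antitone : Antitone stepDown := fun _ _ h =>
  Real.smoothTransition.monotone (by linarith)

theorem stepDown_nonneg (x : ℝ) : 0 ≤ stepDown x := Real.smoothTransition.nonneg _

theorem stepDown_le_one (x : ℝ) : stepDown x ≤ 1 := Real.smoothTransition.le_one _

theorem deriv_stepDown_nonpos (x : ℝ) : deriv stepDown x ≤ 0 := stepDown_antitone.deriv_nonpos

/-- A function on the strip which is constant on both boundary lines can be made linear near them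
by a fibrewise change of coordinates. -/
theorem exists_straightening {f : ℝ × ℝ → ℝ} (hf : ContDiffOn ℝ (⊤ : ℕ∞) f (strip 1 2))
    (hper : ∀ p ∈ strip 1 2, f (p + (0, 1)) = f p) {a b : ℝ}
    (h1 : ∀ t, f (1, t) = a) (h2 : ∀ t, f (2, t) = b)
    (hin : ∀ p : ℝ × ℝ, 1 < p.1 → p.1 < 2 → a < f p ∧ f p < b)
    (hcrit : ∀ p ∈ strip 1 2, fderivWithin ℝ f (strip 1 2) p ≠ 0) :
    ∃ Q Q', IsStripDiffeo 1 2 1 2 Q Q' ∧ (∀ p ∈ strip 1 2, 1 < p.1 → p.1 < 2 →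
        1 < (Q' p).1 ∧ (Q' p).1 < 2) ∧ ∃ c > 0, ∃ η > 0, η < 1 / 2 ∧
      (∀ p ∈ strip 1 2, p.1 ≤ 1 + η → f (Q' p) = a + c * (p.1 - 1)) ∧
      ∀ p ∈ strip 1 2, 2 - η ≤ p.1 → f (Q' p) = b + c * (p.1 - 2) := by
  have hu : UniqueDiffOn ℝ (strip 1 2) := uniqueDiffOn_strip one_lt_two
  have hd : ∀ p ∈ strip 1 2, HasFDerivWithinAt f (fderivWithin ℝ f (strip 1 2) p) (strip 1 2) p :=
    fun p hp => (hf.differentiableOn (by simp) p hp).hasFDerivWithinAt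
  set k : ℝ × ℝ → ℝ := fun p => fderivWithin ℝ f (strip 1 2) p (1, 0) with hk
  have hkc : ContinuousOn k (strip 1 2) :=
    (hf.continuousOn_fderivWithin hu (by simp)).clm_apply continuousOn_const
  have hkper : ∀ p ∈ strip 1 2, k (p + (0, 1)) = k p := fun p hp => by
    simp only [hk, fderivWithin_strip_add hper hp]
  have hm1 : ∀ t, ((1 : ℝ), t) ∈ strip 1 2 := fun t => by simp [mem_strip]
  have hm2 : ∀ t, ((2 : ℝ), t) ∈ strip 1 2 := fun t => by simp [mem_strip]
  have hrange : ∀ p ∈ strip 1 2, a ≤ f p ∧ f p ≤ b := by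
    have hab : a < b := by
      have := hin (3 / 2, 0) (by norm_num) (by norm_num)
      linarith
    rintro ⟨r, t⟩ hp
    rw [mem_strip] at hp
    rcases hp.1.eq_or_lt with h3 | h3
    · have h3 : (1 : ℝ) = r := h3
      rw [← h3, h1]; exact ⟨le_rfl, hab.le⟩
    rcases hp.2.eq_or_lt with h4 | h4
    · have h4 : r = (2 : ℝ) := h4
      rw [h4, h2]; exact ⟨hab.le, le_rfl⟩
    · exact ⟨(hin _ h3 h4).1.le, (hin _ h3 h4).2.le⟩
  -- Where `f` is constant along the vertical line, its tangential derivative vanishes, so a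
  -- noncritical point must have nonzero transversal derivative.
  have hkne : ∀ p ∈ strip 1 2, (∃ e, ∀ t, f (p.1, t) = e) → k p ≠ 0 := by
    rintro p hp ⟨e, he⟩ h0
    have h3 := (hd p hp).strip_snd hp
    have h4 : HasDerivAt (fun t => f (p.1, t)) 0 p.2 := by
      rw [show (fun t => f (p.1, t)) = fun _ => e from funext he]
      exact hasDerivAt_const _ _
    refine hcrit p hp (ContinuousLinearMap.ext fun v => ?_)
    rw [clm_apply_eq, h3.unique h4]
    change v.1 * k p + _ = _
    rw [h0]; simp
  have hk1 : ∀ t, 0 < k (1, t) := fun t => by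
    refine lt_of_le_of_ne ?_ (hkne _ (hm1 t) ⟨a, h1⟩).symm
    refine (hd _ (hm1 t)).strip_fst.nonneg_of_mul_nonneg
      (uniqueDiffOn_Icc one_lt_two _ (left_mem_Icc.2 one_le_two)) fun y hy => ?_
    have h3 := (hrange (y, t) ⟨hy, mem_univ _⟩).1
    have h4 := h1 t
    simp only [h4]
    exact mul_nonneg (by linarith) (by linarith [hy.1])
  have hk2 : ∀ t, 0 < k (2, t) := fun t => by
    refine lt_of_le_of_ne ?_ (hkne _ (hm2 t) ⟨b, h2⟩).symm
    refine (hd _ (hm2 t)).strip_fst.nonneg_of_mul_nonneg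
      (uniqueDiffOn_Icc one_lt_two _ (right_mem_Icc.2 one_le_two)) fun y hy => ?_
    have h3 := (hrange (y, t) ⟨hy, mem_univ _⟩).2
    have h4 := h2 t
    simp only [h4]
    exact mul_nonneg_of_nonpos_of_nonpos (by linarith) (by linarith [hy.2])
  obtain ⟨δ₁, hδ₁, hδk₁⟩ := exists_collar (left_mem_Icc.2 one_le_two) hkc hkper hk1
  obtain ⟨δ₂, hδ₂, hδk₂⟩ := exists_collar (right_mem_Icc.2 one_le_two) hkc hkper hk2
  set δ := min (min δ₁ δ₂) (1 / 4) with hδ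
  have hδ0 : 0 < δ := by positivity
  have hδ4 : δ ≤ 1 / 4 := min_le_right _ _
  have hkl : ∀ p ∈ strip 1 2, p.1 < 1 + δ → 0 < k p := fun p hp h => by
    refine hδk₁ p hp (abs_lt.2 ⟨by linarith [(mem_strip.1 hp).1], ?_⟩)
    have : δ ≤ δ₁ := (min_le_left _ _).trans (min_le_left _ _)
    linarith
  have hkr : ∀ p ∈ strip 1 2, 2 - δ < p.1 → 0 < k p := fun p hp h => by
    refine hδk₂ p hp (abs_lt.2 ⟨?_, by linarith [(mem_strip.1 hp).2]⟩)
    have : δ ≤ δ₂ := (min_le_left _ _).trans (min_le_right _ _)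
    linarith
  obtain ⟨C, hC⟩ := (isCompact_Icc.prod isCompact_Icc :
    IsCompact (Icc (1 : ℝ) 2 ×ˢ Icc (0 : ℝ) 1)).exists_bound_of_continuousOn
    (hkc.mono (prod_mono subset_rfl (subset_univ _)))
  -- As `c` bounds the transversal derivative, the affine rescaling of `f` normalized at the left
  -- line lies below `p.1`, and the one normalized at the right line above it. These signs make `q`
  -- increasing; the maximum with `1` only keeps `c` positive.
  set c := max C 1 with hc
  have hc0 : 0 < c := by positivity
  have hkC : ∀ p ∈ strip 1 2, k p ≤ c := fun p hp => by
    obtain ⟨u, hu', e⟩ := (show Function.Periodic (fun t => k (p.1, t)) 1 from fun t => by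
      simpa using hkper (p.1, t) ⟨hp.1, mem_univ _⟩).exists_mem_Ico₀ one_pos p.2
    have h3 : k p = k (p.1, u) := e
    rw [h3]
    exact (le_abs_self _).trans ((hC (p.1, u) ⟨hp.1, hu'.1, hu'.2.le⟩).trans (le_max_left _ _))
  have hmean : ∀ t, ∀ x ∈ Icc (1 : ℝ) 2, ∀ y ∈ Icc (1 : ℝ) 2, x ≤ y →
      f (y, t) - f (x, t) ≤ c * (y - x) := by
    intro t x hx y hy hxy
    have hcont : ContinuousOn (fun r => f (r, t)) (Icc 1 2) := fun r hr =>
      (hd (r, t) ⟨hr, mem_univ _⟩).strip_fst.continuousWithinAt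
    refine (convex_Icc (1 : ℝ) 2).image_sub_le_mul_sub_of_deriv_le hcont ?_ ?_ x hx y hy hxy
    · intro r hr
      exact (((hd (r, t) ⟨interior_subset hr, mem_univ _⟩).strip_fst.hasDerivAt
        (mem_interior_iff_mem_nhds.1 hr)).differentiableAt).differentiableWithinAt
    · intro r hr
      rw [((hd (r, t) ⟨interior_subset hr, mem_univ _⟩).strip_fst.hasDerivAt
        (mem_interior_iff_mem_nhds.1 hr)).deriv]
      exact hkC (r, t) ⟨interior_subset hr, mem_univ _⟩
  have hA : ∀ p ∈ strip 1 2, 1 + (f p - a) / c - p.1 ≤ 0 := fun p hp => by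
    have := hmean p.2 1 (left_mem_Icc.2 one_le_two) p.1 hp.1 hp.1.1
    rw [h1] at this
    have : (f p - a) / c ≤ p.1 - 1 := by
      rw [div_le_iff₀ hc0]; linarith
    linarith
  have hB : ∀ p ∈ strip 1 2, 0 ≤ 2 - (b - f p) / c - p.1 := fun p hp => by
    have := hmean p.2 p.1 hp.1 2 (right_mem_Icc.2 one_le_two) hp.1.2
    rw [h2] at this
    have : (b - f p) / c ≤ 2 - p.1 := by
      rw [div_le_iff₀ hc0]; linarith
    linarith
  set u₁ : ℝ → ℝ := fun r => (r - 1) * (3 / δ) with hu₁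
  set u₂ : ℝ → ℝ := fun r => (2 - r) * (3 / δ) with hu₂
  have h3δ : 0 < 3 / δ := by positivity
  have hδ3 : δ * (3 / δ) = 3 := by field_simp
  -- `q` is the first coordinate in the middle and an affine function of `f` near either line. The
  -- factor `3 / δ` makes each cutoff equal to `1` up to distance `δ / 3` from its line and `0`
  -- beyond `2 * δ / 3`.
  set q : ℝ × ℝ → ℝ := fun p => p.1 + stepDown (u₁ p.1) * (1 + (f p - a) / c - p.1) +
    stepDown (u₂ p.1) * (2 - (b - f p) / c - p.1) with hq
  have hqs : ContDiffOn ℝ (⊤ : ℕ∞) q (strip 1 2) := by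
    have e1 : ContDiffOn ℝ (⊤ : ℕ∞) (fun p : ℝ × ℝ => stepDown (u₁ p.1)) (strip 1 2) :=
      (contDiff_stepDown.comp (f := fun p : ℝ × ℝ => u₁ p.1) (by
        simp only [hu₁]; fun_prop)).contDiffOn
    have e2 : ContDiffOn ℝ (⊤ : ℕ∞) (fun p : ℝ × ℝ => stepDown (u₂ p.1)) (strip 1 2) :=
      (contDiff_stepDown.comp (f := fun p : ℝ × ℝ => u₂ p.1) (by
        simp only [hu₂]; fun_prop)).contDiffOn
    simp only [hq]
    fun_prop
  have hqper : ∀ p ∈ strip 1 2, q (p + (0, 1)) = q p := fun p hp => by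
    simp only [hq, hper p hp]
    simp
  have hz1 : ∀ r, r ≤ 2 - δ → stepDown (u₂ r) = 0 := fun r hr => stepDown_of_ge (by
    simp only [hu₂]; nlinarith)
  have hz2 : ∀ r, 1 + δ ≤ r → stepDown (u₁ r) = 0 := fun r hr => stepDown_of_ge (by
    simp only [hu₁]; nlinarith)
  have hql : ∀ p : ℝ × ℝ, p.1 ≤ 1 + δ / 3 → q p = 1 + (f p - a) / c := fun p hp => by
    have e1 : stepDown (u₁ p.1) = 1 := stepDown_of_le (by simp only [hu₁]; nlinarith)
    have e2 := hz1 p.1 (by linarith)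
    simp only [hq, e1, e2]; ring
  have hqr : ∀ p : ℝ × ℝ, 2 - δ / 3 ≤ p.1 → q p = 2 - (b - f p) / c := fun p hp => by
    have e1 : stepDown (u₂ p.1) = 1 := stepDown_of_le (by simp only [hu₂]; nlinarith)
    have e2 := hz2 p.1 (by linarith)
    simp only [hq, e1, e2]; ring
  have hq1 : ∀ t, q (1, t) = 1 := fun t => by
    rw [hql _ (by simp; linarith), h1]; simp
  have hq2 : ∀ t, q (2, t) = 2 := fun t => by
    rw [hqr _ (by simp; linarith), h2]; simp
  have hqpos : ∀ p ∈ strip 1 2, 0 < fderivWithin ℝ q (strip 1 2) p (1, 0) := by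
    rintro ⟨r, t⟩ hp
    have hqd := ((hqs.differentiableOn (by simp)) (r, t) hp).hasFDerivWithinAt.strip_fst
    have hfd := (hd (r, t) hp).strip_fst
    have hs1 : HasDerivWithinAt (fun r => stepDown (u₁ r)) (deriv stepDown (u₁ r) * (1 * (3 / δ)))
        (Icc 1 2) r :=
      HasDerivAt.comp_hasDerivWithinAt (h₂ := stepDown) r
        (contDiff_stepDown.differentiable (by simp) _).hasDerivAt
        (((hasDerivWithinAt_id _ _).sub_const 1).mul_const (3 / δ))
    have hs2 : HasDerivWithinAt (fun r => stepDown (u₂ r)) (deriv stepDown (u₂ r) * (-1 * (3 / δ)))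
        (Icc 1 2) r :=
      HasDerivAt.comp_hasDerivWithinAt (h₂ := stepDown) r
        (contDiff_stepDown.differentiable (by simp) _).hasDerivAt
        (((hasDerivWithinAt_id _ _).const_sub 2).mul_const (3 / δ))
    have hA' : HasDerivWithinAt (fun r => 1 + (f (r, t) - a) / c - r) (k (r, t) / c - 1)
        (Icc 1 2) r :=
      (((hfd.sub_const a).div_const c).const_add 1).sub (hasDerivWithinAt_id _ _)
    have hB' : HasDerivWithinAt (fun r => 2 - (b - f (r, t)) / c - r) (-(-k (r, t) / c) - 1)
        (Icc 1 2) r :=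
      (((hfd.const_sub b).div_const c).const_sub 2).sub (hasDerivWithinAt_id _ _)
    have hsum := ((hasDerivWithinAt_id r (Icc (1 : ℝ) 2)).add (hs1.mul hA')).add (hs2.mul hB')
    have heq := (uniqueDiffOn_Icc one_lt_two r hp.1).eq_deriv _ hqd hsum
    rw [heq]
    have a1 := hA (r, t) hp
    have a2 := hB (r, t) hp
    simp only at a1 a2
    have d1 := deriv_stepDown_nonpos (u₁ r)
    have d2 := deriv_stepDown_nonpos (u₂ r)
    -- The terms with a differentiated cutoff are nonnegative by the choice of `c`. What remains is
    -- a convex combination of `1` and `k / c`, with weight on `k / c` only in the collars, where `k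
    -- > 0`.
    have t1 : 0 ≤ deriv stepDown (u₁ r) * (1 * (3 / δ)) * (1 + (f (r, t) - a) / c - r) :=
      mul_nonneg_of_nonpos_of_nonpos (by nlinarith) a1
    have t2 : 0 ≤ deriv stepDown (u₂ r) * (-1 * (3 / δ)) * (2 - (b - f (r, t)) / c - r) :=
      mul_nonneg (by nlinarith) a2
    have t3 : 0 < 1 + stepDown (u₁ r) * (k (r, t) / c - 1) +
        stepDown (u₂ r) * (-(-k (r, t) / c) - 1) := by
      have e : -(-k (r, t) / c) = k (r, t) / c := by ring
      rw [e]
      rcases lt_or_ge r (1 + δ) with hr | hr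
      · rw [hz1 r (by linarith)]
        have := div_pos (hkl (r, t) hp hr) hc0
        have b1 := stepDown_nonneg (u₁ r)
        have b2 := stepDown_le_one (u₁ r)
        rcases b1.eq_or_lt with b0 | b0
        · rw [← b0]; norm_num
        · nlinarith
      · rw [hz2 r hr]
        rcases lt_or_ge (2 - δ) r with hr2 | hr2
        · have := div_pos (hkr (r, t) hp hr2) hc0
          have b1 := stepDown_nonneg (u₂ r)
          have b2 := stepDown_le_one (u₂ r)
          rcases b1.eq_or_lt with b0 | b0
          · rw [← b0]; norm_num
          · nlinarith
        · rw [hz1 r hr2]; norm_num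
    linarith
  obtain ⟨⟨Q', hQ⟩, hmono⟩ := exists_isStripDiffeo_of_fst_increasing hqs hqper hq1 hq2 hqpos
  have hfline : ∀ r ∈ Icc (1 : ℝ) 2, Continuous fun t => f (r, t) := fun r hr => by
    rw [← continuousOn_univ]
    exact hf.continuousOn.comp (f := fun t => (r, t)) (by fun_prop) fun t _ => ⟨hr, mem_univ _⟩
  have hfper : ∀ r ∈ Icc (1 : ℝ) 2, ∀ t, f (r, t + 1) = f (r, t) := fun r hr t => by
    simpa using hper (r, t) ⟨hr, mem_univ _⟩
  have hr1 : 1 + δ / 3 ∈ Icc (1 : ℝ) 2 := ⟨by linarith, by linarith⟩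
  have hr2 : 2 - δ / 3 ∈ Icc (1 : ℝ) 2 := ⟨by linarith, by linarith⟩
  obtain ⟨m₁, hm₁, hmf₁⟩ := exists_pos_lower_bound_of_periodic
    (h := fun t => f (1 + δ / 3, t) - a) ((hfline _ hr1).sub continuous_const)
    (fun t => by rw [hfper _ hr1]) (fun t => by
      have := (hin (1 + δ / 3, t) (by simp; linarith) (by simp; linarith)).1
      linarith)
  obtain ⟨m₂, hm₂, hmf₂⟩ := exists_pos_lower_bound_of_periodic
    (h := fun t => b - f (2 - δ / 3, t)) (continuous_const.sub (hfline _ hr2))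
    (fun t => by rw [hfper _ hr2]) (fun t => by
      have := (hin (2 - δ / 3, t) (by simp; linarith) (by simp; linarith)).2
      linarith)
  have hQfst : ∀ p ∈ strip 1 2, q (Q' p) = p.1 ∧ (Q' p).2 = p.2 := fun p hp => by
    have h : (q (Q' p), (Q' p).2) = p := hQ.right_inv p hp
    exact ⟨(Prod.ext_iff.1 h).1, (Prod.ext_iff.1 h).2⟩
  have hQ1 : ∀ p ∈ strip 1 2, ∀ r ∈ Icc (1 : ℝ) 2, p.1 ≤ q (r, p.2) → (Q' p).1 ≤ r := by
    intro p hp r hr h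
    rw [← (hmono p.2).le_iff_le (hQ.mapsTo' hp).1 hr]
    rw [← (hQfst p hp).2, Prod.mk.eta, (hQfst p hp).1, (hQfst p hp).2]
    exact h
  have hQ2 : ∀ p ∈ strip 1 2, ∀ r ∈ Icc (1 : ℝ) 2, q (r, p.2) ≤ p.1 → r ≤ (Q' p).1 := by
    intro p hp r hr h
    rw [← (hmono p.2).le_iff_le hr (hQ.mapsTo' hp).1]
    rw [← (hQfst p hp).2, Prod.mk.eta, (hQfst p hp).1, (hQfst p hp).2]
    exact h
  -- At distance `δ / 3` from its line, `q` has moved by at least `m₁ / c` on the left and `m₂ / c`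
  -- on the right. So points within these distances come from the zone where `q` is affine in `f`;
  -- the bound `1 / 4` keeps the two zones apart.
  refine ⟨_, Q', hQ, ?_, c, hc0, min (min (m₁ / c) (m₂ / c)) (1 / 4), by positivity,
    (min_le_right _ _).trans_lt (by norm_num), ?_, ?_⟩
  · intro p hp hp1 hp2
    have h3 := hQfst p hp
    have h4 := mem_strip.1 (hQ.mapsTo' hp)
    constructor
    · refine lt_of_le_of_ne h4.1 fun e => ?_
      have e' : Q' p = (1, p.2) := Prod.ext e.symm h3.2
      rw [e', hq1] at h3
      linarith [h3.1]
    · refine lt_of_le_of_ne h4.2 fun e => ?_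
      have e' : Q' p = (2, p.2) := Prod.ext e h3.2
      rw [e', hq2] at h3
      linarith [h3.1]
  · intro p hp hpη
    have hle : (Q' p).1 ≤ 1 + δ / 3 := by
      refine hQ1 p hp _ hr1 ?_
      rw [hql _ le_rfl]
      have h3 : m₁ / c ≤ (f (1 + δ / 3, p.2) - a) / c := by
        gcongr
        exact hmf₁ p.2
      have h4 : min (min (m₁ / c) (m₂ / c)) (1 / 4) ≤ m₁ / c :=
        (min_le_left _ _).trans (min_le_left _ _)
      linarith
    have h3 := hql (Q' p) hle
    rw [(hQfst p hp).1] at h3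
    rw [h3]; field_simp; ring
  · intro p hp hpη
    have hle : 2 - δ / 3 ≤ (Q' p).1 := by
      refine hQ2 p hp _ hr2 ?_
      rw [hqr _ le_rfl]
      have h3 : m₂ / c ≤ (b - f (2 - δ / 3, p.2)) / c := by
        gcongr
        exact hmf₂ p.2
      have h4 : min (min (m₁ / c) (m₂ / c)) (1 / 4) ≤ m₂ / c :=
        (min_le_left _ _).trans (min_le_right _ _)
      linarith
    have h3 := hqr (Q' p) hle
    rw [(hQfst p hp).1] at h3
    rw [h3]; field_simp; ring

/-- A function on the strip without critical points, constant on both boundary lines, is conjugate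
to the first coordinate. -/
theorem exists_stripDiffeo_levels {f : ℝ × ℝ → ℝ} (hf : ContDiffOn ℝ (⊤ : ℕ∞) f (strip 1 2))
    (hper : ∀ p ∈ strip 1 2, f (p + (0, 1)) = f p) {a b : ℝ}
    (h1 : ∀ t, f (1, t) = a) (h2 : ∀ t, f (2, t) = b)
    (hin : ∀ p : ℝ × ℝ, 1 < p.1 → p.1 < 2 → a < f p ∧ f p < b)
    (hcrit : ∀ p ∈ strip 1 2, fderivWithin ℝ f (strip 1 2) p ≠ 0) :
    ∃ R R', IsStripDiffeo a b 1 2 R R' ∧ ∀ p ∈ strip a b, f (R p) = p.1 := by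
  classical
  have hu : UniqueDiffOn ℝ (strip 1 2) := uniqueDiffOn_strip one_lt_two
  have hab : a < b := by
    have := hin (3 / 2, 0) (by norm_num) (by norm_num)
    linarith
  obtain ⟨Q, Q', hQ, hQin, c, hc, η, hη, hη2, hl, hr⟩ :=
    exists_straightening hf hper h1 h2 hin hcrit
  -- The straightened function, continued beyond the strip by its own affine boundary behaviour. The
  -- pieces agree on overlaps, so `F` is smooth on the plane and has no critical point.
  set F : ℝ × ℝ → ℝ := fun p => if p.1 < 1 + η then a + c * (p.1 - 1) else
    if 2 - η < p.1 then b + c * (p.1 - 2) else f (Q' p) with hF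
  have hFl : ∀ p : ℝ × ℝ, p.1 < 1 + η → F p = a + c * (p.1 - 1) := fun p hp => by
    simp only [hF, if_pos hp]
  have hFr : ∀ p : ℝ × ℝ, 2 - η < p.1 → F p = b + c * (p.1 - 2) := fun p hp => by
    have : ¬ p.1 < 1 + η := by linarith
    simp only [hF, if_neg this, if_pos hp]
  have hFS : ∀ p ∈ strip 1 2, F p = f (Q' p) := fun p hp => by
    by_cases hp1 : p.1 < 1 + η
    · rw [hFl p hp1, hl p hp hp1.le]
    by_cases hp2 : 2 - η < p.1
    · rw [hFr p hp2, hr p hp hp2.le]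
    · simp only [hF, if_neg hp1, if_neg hp2]
  have hlin : ∀ (e r : ℝ) (q : ℝ × ℝ), HasFDerivAt (fun p : ℝ × ℝ => e + c * (p.1 - r))
      (c • ContinuousLinearMap.fst ℝ ℝ ℝ) q := fun e r q =>
    ((hasFDerivAt_fst.sub_const r).const_mul c).const_add e
  have hFs : ContDiff ℝ (⊤ : ℕ∞) F := by
    rw [contDiff_iff_contDiffAt]
    intro p
    by_cases hp1 : p.1 < 1 + η
    · have h3 : ∀ᶠ q : ℝ × ℝ in 𝓝 p, q.1 < 1 + η :=
        continuousAt_fst.eventually_lt continuousAt_const hp1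
      refine ContDiffAt.congr_of_eventuallyEq (f := fun p : ℝ × ℝ => a + c * (p.1 - 1))
        (by fun_prop) (h3.mono hFl)
    by_cases hp2 : 2 - η < p.1
    · have h3 : ∀ᶠ q : ℝ × ℝ in 𝓝 p, 2 - η < q.1 :=
        continuousAt_const.eventually_lt continuousAt_fst hp2
      refine ContDiffAt.congr_of_eventuallyEq (f := fun p : ℝ × ℝ => b + c * (p.1 - 2))
        (by fun_prop) (h3.mono hFr)
    · have hmem : strip 1 2 ∈ 𝓝 p := by
        refine prod_mem_nhds (Icc_mem_nhds ?_ ?_) univ_mem <;> linarith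
      exact ((hf.comp hQ.smooth' hQ.mapsTo').contDiffAt hmem).congr_of_eventuallyEq
        (mem_of_superset hmem hFS)
  have hFper : ∀ p, F (p + (0, 1)) = F p := fun p => by
    by_cases hp : p ∈ strip 1 2
    · rw [hFS p hp, hFS _ ((add_mem_strip 1).2 hp), hQ.symm.shift p hp, hper _ (hQ.mapsTo' hp)]
    · rw [mem_strip, not_and_or] at hp
      rcases hp with hp | hp
      · rw [hFl p (by linarith), hFl _ (by simp; linarith)]; simp
      · rw [hFr p (by linarith), hFr _ (by simp; linarith)]; simp
  have hfst : c • ContinuousLinearMap.fst ℝ ℝ ℝ ≠ 0 := fun h => by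
    have := congrArg (fun l : ℝ × ℝ →L[ℝ] ℝ => l ((1 : ℝ), (0 : ℝ))) h
    simp at this
    exact hc.ne' this
  have hFcrit : ∀ p, fderiv ℝ F p ≠ 0 := fun p => by
    by_cases hp : p ∈ strip 1 2
    · intro h0
      have h3 : HasFDerivWithinAt Q (fderivWithin ℝ Q (strip 1 2) (Q' p)) (strip 1 2) (Q' p) :=
        (hQ.smooth.differentiableOn (by simp) _ (hQ.mapsTo' hp)).hasFDerivWithinAt
      have h4 : HasFDerivAt F (0 : ℝ × ℝ →L[ℝ] ℝ) (Q (Q' p)) := by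
        rw [hQ.right_inv p hp, ← h0]
        exact (hFs.differentiable (by simp) p).hasFDerivAt
      have h5 := h4.comp_hasFDerivWithinAt (Q' p) h3
      have h6 : HasFDerivWithinAt f ((0 : ℝ × ℝ →L[ℝ] ℝ) ∘L
          fderivWithin ℝ Q (strip 1 2) (Q' p)) (strip 1 2) (Q' p) :=
        h5.congr (fun x hx => by
          simp only [Function.comp, hFS _ (hQ.mapsTo hx), hQ.left_inv x hx])
          (by simp only [Function.comp, hFS _ (hQ.mapsTo (hQ.mapsTo' hp)),
            hQ.left_inv _ (hQ.mapsTo' hp)])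
      refine hcrit (Q' p) (hQ.mapsTo' hp) ?_
      rw [h6.fderivWithin (hu _ (hQ.mapsTo' hp)), ContinuousLinearMap.zero_comp]
    · rw [mem_strip, not_and_or] at hp
      rcases hp with hp | hp
      · have h3 : ∀ᶠ q : ℝ × ℝ in 𝓝 p, q.1 < 1 + η :=
          continuousAt_fst.eventually_lt continuousAt_const (by linarith)
        rwa [((hlin a 1 p).congr_of_eventuallyEq (h3.mono hFl)).fderiv]
      · have h3 : ∀ᶠ q : ℝ × ℝ in 𝓝 p, 2 - η < q.1 :=
          continuousAt_const.eventually_lt continuousAt_fst (by linarith)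
        rwa [((hlin b 2 p).congr_of_eventuallyEq (h3.mono hFr)).fderiv]
  have hFin : ∀ p : ℝ × ℝ, 1 < p.1 → p.1 < 2 → a < F p ∧ F p < b := fun p hp1 hp2 => by
    have hp : p ∈ strip 1 2 := mem_strip.2 ⟨hp1.le, hp2.le⟩
    rw [hFS p hp]
    have := hQin p hp hp1 hp2
    exact hin _ this.1 this.2
  obtain ⟨Ψ, Ψ', hΨ, hΨF⟩ := exists_stripDiffeo_of_standard_near_boundary hFs hFper hab hc
    (half_pos hη) (fun p hp => hFl p (by linarith)) (fun p hp => hFr p (by linarith)) hFcrit hFin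
  refine ⟨_, _, hΨ.trans hQ.symm, fun p hp => ?_⟩
  rw [← hΨF p hp, hFS _ (hΨ.mapsTo hp)]
  rfl

/-! ### Strip covers and polar coordinates -/

/-- `X` exhibits `L` as the quotient of the strip over `[a, b]` by the unit translation, and has
smooth local inverses. -/
structure IsStripCover (a b : ℝ) (X : ℝ × ℝ → Plane) (L : Set Plane) : Prop where
  smooth : ContDiffOn ℝ (⊤ : ℕ∞) X (strip a b)
  image_eq : X '' strip a b = L
  eq_iff : ∀ p ∈ strip a b, ∀ q ∈ strip a b, X p = X q ↔ ∃ n : ℤ, q = p + (0, (n : ℝ))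
  localInv : ∀ p ∈ strip a b, ∃ σ : Plane → ℝ × ℝ, ContDiffWithinAt ℝ (⊤ : ℕ∞) σ L (X p) ∧
    σ (X p) = p ∧ (∀ᶠ x in 𝓝[L] X p, σ x ∈ strip a b ∧ X (σ x) = x) ∧
    ∀ᶠ q in 𝓝[strip a b] p, σ (X q) = q

namespace IsStripCover

variable {a b c d : ℝ} {X : ℝ × ℝ → Plane} {L : Set Plane}

theorem mem (h : IsStripCover a b X L) {p : ℝ × ℝ} (hp : p ∈ strip a b) : X p ∈ L := by
  rw [← h.image_eq]; exact mem_image_of_mem X hp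

theorem shift_int (h : IsStripCover a b X L) {p : ℝ × ℝ} (hp : p ∈ strip a b) (n : ℤ) :
    X (p + (0, (n : ℝ))) = X p :=
  ((h.eq_iff p hp _ ((add_mem_strip _).2 hp)).2 ⟨n, rfl⟩).symm

theorem shift (h : IsStripCover a b X L) {p : ℝ × ℝ} (hp : p ∈ strip a b) :
    X (p + (0, 1)) = X p := by
  simpa using h.shift_int hp 1

theorem comp_stripDiffeo (h : IsStripCover c d X L) {R R' : ℝ × ℝ → ℝ × ℝ}
    (hR : IsStripDiffeo a b c d R R') : IsStripCover a b (X ∘ R) L where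
  smooth := h.smooth.comp hR.smooth hR.mapsTo
  image_eq := by
    rw [image_comp, ← h.image_eq]
    congr 1
    exact Subset.antisymm hR.mapsTo.image_subset fun p hp =>
      ⟨R' p, hR.mapsTo' hp, hR.right_inv p hp⟩
  eq_iff p hp q hq := by
    rw [← hR.shift_iff hp hq]
    exact h.eq_iff _ (hR.mapsTo hp) _ (hR.mapsTo hq)
  localInv p hp := by
    obtain ⟨σ, hσ, hσp, hσX, hXσ⟩ := h.localInv (R p) (hR.mapsTo hp)
    refine ⟨R' ∘ σ, ?_, ?_, ?_, ?_⟩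
    · refine ContDiffWithinAt.comp_of_preimage_mem_nhdsWithin (t := strip c d) (X (R p)) ?_ hσ
        (hσX.mono fun x hx => hx.1)
      rw [hσp]
      exact hR.smooth' _ (hR.mapsTo hp)
    · simp only [Function.comp, hσp, hR.left_inv p hp]
    · filter_upwards [hσX] with x hx
      refine ⟨hR.mapsTo' hx.1, ?_⟩
      simp only [Function.comp, hR.right_inv _ hx.1, hx.2]
    · have h1 : Tendsto R (𝓝[strip a b] p) (𝓝[strip c d] (R p)) :=
        tendsto_nhdsWithin_of_tendsto_nhds_of_eventually_within _ (hR.smooth.continuousOn p hp)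
          (eventually_mem_nhdsWithin.mono fun q hq => hR.mapsTo hq)
      filter_upwards [h1.eventually hXσ, self_mem_nhdsWithin] with q hq hqs
      simp only [Function.comp, hq, hR.left_inv q hqs]

theorem comp_diffeo (h : IsStripCover a b X L) {Φ : Plane → Plane} {M : Set Plane}
    (hΦ : IsDiffeoOn Φ L M) : IsStripCover a b (Φ ∘ X) M := by
  obtain ⟨hs, hm, g, hgs, hgm, hgl, hgr⟩ := hΦ
  have hX : MapsTo X (strip a b) L := fun p hp => h.mem hp
  refine ⟨hs.comp h.smooth hX, ?_, ?_, ?_⟩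
  · rw [image_comp, h.image_eq]
    exact Subset.antisymm hm.image_subset fun y hy => ⟨g y, hgm hy, hgr hy⟩
  · intro p hp q hq
    rw [← h.eq_iff p hp q hq]
    exact hgl.injOn.eq_iff (hX hp) (hX hq)
  · intro p hp
    obtain ⟨σ, hσ, hσp, hσX, hXσ⟩ := h.localInv p hp
    have e : g (Φ (X p)) = X p := hgl (hX hp)
    have ht : Tendsto g (𝓝[M] (Φ (X p))) (𝓝[L] (X p)) := by
      refine tendsto_nhdsWithin_of_tendsto_nhds_of_eventually_within _ ?_
        (eventually_mem_nhdsWithin.mono fun q hq => hgm hq)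
      have := hgs.continuousOn _ (hm (hX hp))
      unfold ContinuousWithinAt at this
      rwa [e] at this
    refine ⟨σ ∘ g, ?_, ?_, ?_, ?_⟩
    · refine ContDiffWithinAt.comp (t := L) (Φ (X p)) ?_ (hgs _ (hm (hX hp))) hgm
      rwa [e]
    · simp only [Function.comp, e, hσp]
    · filter_upwards [ht.eventually hσX, self_mem_nhdsWithin] with x hx hxM
      exact ⟨hx.1, by simp only [Function.comp, hx.2]; exact hgr hxM⟩
    · filter_upwards [hXσ, self_mem_nhdsWithin] with q hq hqs
      simp only [Function.comp, hgl (hX hqs), hq]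

theorem hasFDerivWithinAt (h : IsStripCover a b X L) {p : ℝ × ℝ} (hp : p ∈ strip a b) :
    HasFDerivWithinAt X (fderivWithin ℝ X (strip a b) p) (strip a b) p :=
  (h.smooth.differentiableOn (by simp) p hp).hasFDerivWithinAt

/-- A local inverse composed with `X` is the identity near `p`, so the chain rule makes the
derivative injective; the dimensions agree. -/
theorem isInvertible_fderivWithin (h : IsStripCover a b X L) (hab : a < b) {p : ℝ × ℝ}
    (hp : p ∈ strip a b) : (fderivWithin ℝ X (strip a b) p).IsInvertible := by
  obtain ⟨σ, hσ, hσp, hσX, hXσ⟩ := h.localInv p hp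
  refine isInvertible_of_injective_real_prod (by simp) _ fun v hv => ?_
  have h1 := ((hσ.differentiableWithinAt (by simp)).hasFDerivWithinAt).comp p
    (h.hasFDerivWithinAt hp) (fun q hq => h.mem hq)
  have h2 : HasFDerivWithinAt (σ ∘ X) (ContinuousLinearMap.id ℝ (ℝ × ℝ)) (strip a b) p :=
    (hasFDerivWithinAt_id p _).congr_of_eventuallyEq hXσ hσp
  have h3 := ((uniqueDiffOn_strip hab) p hp).eq h1 h2
  have h4 := congrArg (fun l : ℝ × ℝ →L[ℝ] ℝ × ℝ => l v) h3
  simp only [ContinuousLinearMap.comp_apply, hv, map_zero, ContinuousLinearMap.id_apply] at h4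
  exact h4.symm

/-- A function whose lift to the strip is smooth is smooth. -/
theorem contDiffOn_of_comp (h : IsStripCover a b X L) {V : Type*} [NormedAddCommGroup V]
    [NormedSpace ℝ V] {u : Plane → V} {g : ℝ × ℝ → V}
    (hg : ContDiffOn ℝ (⊤ : ℕ∞) g (strip a b)) (hu : ∀ p ∈ strip a b, u (X p) = g p) :
    ContDiffOn ℝ (⊤ : ℕ∞) u L := by
  intro x hx
  obtain ⟨p, hp, rfl⟩ : x ∈ X '' strip a b := by rwa [h.image_eq]
  obtain ⟨σ, hσ, hσp, hσX, hXσ⟩ := h.localInv p hp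
  have h1 : ContDiffWithinAt ℝ (⊤ : ℕ∞) (g ∘ σ) L (X p) := by
    refine ContDiffWithinAt.comp_of_preimage_mem_nhdsWithin (t := strip a b) (X p) ?_ hσ
      (hσX.mono fun x hx => hx.1)
    rw [hσp]
    exact hg p hp
  refine h1.congr_of_eventuallyEq ?_ ?_
  · filter_upwards [hσX] with x hx
    simp only [Function.comp]
    rw [← hu _ hx.1, hx.2]
  · simp only [Function.comp]
    rw [hσp, hu p hp]

theorem hasFDerivWithinAt_comp (h : IsStripCover a b X L) {V : Type*} [NormedAddCommGroup V]
    [NormedSpace ℝ V] {u : Plane → V} (hu : ContDiffOn ℝ (⊤ : ℕ∞) u L) {p : ℝ × ℝ}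
    (hp : p ∈ strip a b) :
    HasFDerivWithinAt (u ∘ X) ((fderivWithin ℝ u L (X p)) ∘L fderivWithin ℝ X (strip a b) p)
      (strip a b) p :=
  ((hu.differentiableOn (by simp) _ (h.mem hp)).hasFDerivWithinAt).comp p
    (h.hasFDerivWithinAt hp) (fun _ hq => h.mem hq)

end IsStripCover

/-- Polar coordinates with angles measured in turns. -/
def polarMap (p : ℝ × ℝ) : Plane :=
  !₂[p.1 * Real.cos (2 * Real.pi * p.2), p.1 * Real.sin (2 * Real.pi * p.2)]

theorem polarMap_zero (p : ℝ × ℝ) : polarMap p 0 = p.1 * Real.cos (2 * Real.pi * p.2) := rfl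

theorem polarMap_one (p : ℝ × ℝ) : polarMap p 1 = p.1 * Real.sin (2 * Real.pi * p.2) := rfl

theorem contDiff_polarMap : ContDiff ℝ (⊤ : ℕ∞) polarMap := by
  rw [contDiff_euclidean]
  intro i
  fin_cases i
  · change ContDiff ℝ _ fun p : ℝ × ℝ => p.1 * Real.cos (2 * Real.pi * p.2)
    fun_prop
  · change ContDiff ℝ _ fun p : ℝ × ℝ => p.1 * Real.sin (2 * Real.pi * p.2)
    fun_prop

theorem norm_polarMap (p : ℝ × ℝ) : ‖polarMap p‖ = |p.1| := by
  rw [EuclideanSpace.norm_eq, Fin.sum_univ_two, polarMap_zero, polarMap_one, ← Real.sqrt_sq_eq_abs]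
  congr 1
  simp only [Real.norm_eq_abs, sq_abs]
  linear_combination p.1 ^ 2 * Real.sin_sq_add_cos_sq (2 * Real.pi * p.2)

theorem isInvertible_fderiv_polarMap {p : ℝ × ℝ} (hp : p.1 ≠ 0) :
    (fderiv ℝ polarMap p).IsInvertible := by
  refine isInvertible_of_injective_real_prod (by simp) _ fun v hv => ?_
  have hA := (contDiff_polarMap.differentiable (by simp) p).hasFDerivAt
  have h0 : HasFDerivAt (fun p => polarMap p 0)
      ((EuclideanSpace.proj (𝕜 := ℝ) (0 : Fin 2)) ∘L fderiv ℝ polarMap p) p :=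
    (EuclideanSpace.proj (𝕜 := ℝ) (0 : Fin 2)).hasFDerivAt.comp p hA
  have h1 : HasFDerivAt (fun p => polarMap p 1)
      ((EuclideanSpace.proj (𝕜 := ℝ) (1 : Fin 2)) ∘L fderiv ℝ polarMap p) p :=
    (EuclideanSpace.proj (𝕜 := ℝ) (1 : Fin 2)).hasFDerivAt.comp p hA
  simp only [polarMap_zero] at h0
  simp only [polarMap_one] at h1
  have ha : HasFDerivAt (fun p : ℝ × ℝ => 2 * Real.pi * p.2)
      ((2 * Real.pi) • ContinuousLinearMap.snd ℝ ℝ ℝ) p := hasFDerivAt_snd.const_mul _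
  have e0 := h0.unique (hasFDerivAt_fst.mul ha.cos)
  have e1 := h1.unique (hasFDerivAt_fst.mul ha.sin)
  have f0 := congrArg (fun l : ℝ × ℝ →L[ℝ] ℝ => l v) e0
  have f1 := congrArg (fun l : ℝ × ℝ →L[ℝ] ℝ => l v) e1
  simp [hv] at f0 f1
  set C := Real.cos (2 * Real.pi * p.2)
  set S := Real.sin (2 * Real.pi * p.2)
  have hcs : S ^ 2 + C ^ 2 = 1 := Real.sin_sq_add_cos_sq _
  have g1 : v.1 = 0 := by linear_combination C * (-f0) + S * (-f1) - v.1 * hcs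
  have g2 : p.1 * (2 * Real.pi * v.2) = 0 := by
    linear_combination S * f0 - C * f1 - p.1 * (2 * Real.pi * v.2) * hcs
  have g3 : v.2 = 0 := by
    have := Real.pi_ne_zero
    simpa [hp, this] using g2
  exact Prod.ext g1 g3

theorem polarMap_eq_iff {p q : ℝ × ℝ} (hp : 0 < p.1) (hq : 0 < q.1) :
    polarMap p = polarMap q ↔ ∃ n : ℤ, q = p + (0, (n : ℝ)) := by
  constructor
  · intro h
    have h1 : p.1 = q.1 := by
      have := congrArg norm h
      rwa [norm_polarMap, norm_polarMap, abs_of_pos hp, abs_of_pos hq] at this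
    have h2 : p.1 * Real.cos (2 * Real.pi * p.2) = q.1 * Real.cos (2 * Real.pi * q.2) :=
      congrArg (fun x : Plane => x 0) h
    have h3 : p.1 * Real.sin (2 * Real.pi * p.2) = q.1 * Real.sin (2 * Real.pi * q.2) :=
      congrArg (fun x : Plane => x 1) h
    rw [← h1] at h2 h3
    have h4 := mul_left_cancel₀ hp.ne' h2
    have h5 := mul_left_cancel₀ hp.ne' h3
    have h6 : ((2 * Real.pi * q.2 : ℝ) : Real.Angle) = (2 * Real.pi * p.2 : ℝ) :=
      Real.Angle.cos_sin_inj h4.symm h5.symm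
    obtain ⟨n, hn⟩ := Real.Angle.angle_eq_iff_two_pi_dvd_sub.1 h6
    refine ⟨n, Prod.ext (by simpa using h1.symm) ?_⟩
    have h7 : 2 * Real.pi * (q.2 - p.2 - n) = 0 := by linear_combination hn
    have h8 := (mul_eq_zero.1 h7).resolve_left Real.two_pi_pos.ne'
    simp only [Prod.snd_add]
    linarith
  · rintro ⟨n, rfl⟩
    have e : 2 * Real.pi * (p.2 + n) = 2 * Real.pi * p.2 + n * (2 * Real.pi) := by ring
    simp only [polarMap, Prod.fst_add, Prod.snd_add, add_zero, e, Real.cos_add_int_mul_two_pi,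
      Real.sin_add_int_mul_two_pi]

theorem isStripCover_polarMap : IsStripCover 1 2 polarMap closedRoundAnnulus where
  smooth := contDiff_polarMap.contDiffOn
  image_eq := by
    ext x
    constructor
    · rintro ⟨p, hp, rfl⟩
      rw [mem_strip] at hp
      have : (0 : ℝ) ≤ p.1 := by linarith [hp.1]
      simpa [closedRoundAnnulus, norm_polarMap, abs_of_nonneg this] using hp
    · rintro ⟨h1, h2⟩
      set z : ℂ := ⟨x 0, x 1⟩ with hz
      have hn : ‖x‖ = ‖z‖ := by
        rw [EuclideanSpace.norm_eq, Fin.sum_univ_two, Complex.norm_def, Complex.normSq_mk]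
        congr 1
        simp only [Real.norm_eq_abs, sq_abs]; ring
      refine ⟨(‖z‖, z.arg / (2 * Real.pi)), ?_, ?_⟩
      · rw [mem_strip, ← hn]; exact ⟨h1, h2⟩
      · have e : 2 * Real.pi * (z.arg / (2 * Real.pi)) = z.arg := by
          have := Real.pi_ne_zero
          field_simp
        ext i
        fin_cases i
        · change ‖z‖ * Real.cos (2 * Real.pi * (z.arg / (2 * Real.pi))) = z.re
          rw [e, Complex.norm_mul_cos_arg]
        · change ‖z‖ * Real.sin (2 * Real.pi * (z.arg / (2 * Real.pi))) = z.im
          rw [e, Complex.norm_mul_sin_arg]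
  eq_iff p hp q hq := by
    rw [mem_strip] at hp hq
    exact polarMap_eq_iff (by linarith [hp.1]) (by linarith [hq.1])
  localInv p hp := by
    have hp1 := mem_strip.1 hp
    obtain ⟨e, he⟩ := isInvertible_fderiv_polarMap (p := p) (by linarith [hp1.1])
    have hd : HasFDerivAt polarMap (e : ℝ × ℝ →L[ℝ] Plane) p := by
      rw [he]; exact (contDiff_polarMap.differentiable (by simp) p).hasFDerivAt
    have hc : ContDiffAt ℝ (⊤ : ℕ∞) polarMap p := contDiff_polarMap.contDiffAt
    have hn : ((⊤ : ℕ∞) : WithTop ℕ∞) ≠ 0 := by simp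
    have hst := hc.hasStrictFDerivAt' hd hn
    refine ⟨hc.localInverse hd hn, (hc.to_localInverse hd hn).contDiffWithinAt,
      hc.localInverse_apply_image hd hn, ?_,
      nhdsWithin_le_nhds hst.eventually_left_inverse⟩
    -- The norm recovers only the absolute value of the radius. Positivity near the base point
    -- identifies the radius of the local inverse with `‖x‖`, so it lands in the strip.
    have hpos : ∀ᶠ x in 𝓝 (polarMap p), 0 < (hc.localInverse hd hn x).1 := by
      have h1 : ContinuousAt (fun x => (hc.localInverse hd hn x).1) (polarMap p) :=
        continuousAt_fst.comp hst.localInverse_continuousAt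
      refine continuousAt_const.eventually_lt h1 ?_
      rw [hc.localInverse_apply_image hd hn]
      linarith [hp1.1]
    filter_upwards [nhdsWithin_le_nhds hpos, nhdsWithin_le_nhds hst.eventually_right_inverse,
      self_mem_nhdsWithin] with x hx1 hx2 hx3
    have hx2' : polarMap (hc.localInverse hd hn x) = x := hx2
    refine ⟨?_, hx2'⟩
    have h2 := norm_polarMap (hc.localInverse hd hn x)
    rw [hx2', abs_of_pos hx1] at h2
    rw [mem_strip, ← h2]
    exact hx3

/-! ### Covers of the domain adapted to the level sets of `ω` -/

/-- A strip cover of the closure of an annular domain respecting the boundary components. -/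
structure IsAnnulusCover (Ω Γi Γo : Set Plane) (a b : ℝ) (X : ℝ × ℝ → Plane) : Prop extends
    IsStripCover a b X (closure Ω) where
  lt : a < b
  inner : ∀ p ∈ strip a b, X p ∈ Γi ↔ p.1 = a
  outer : ∀ p ∈ strip a b, X p ∈ Γo ↔ p.1 = b
  interior : ∀ p ∈ strip a b, X p ∈ Ω ↔ a < p.1 ∧ p.1 < b

theorem exists_isAnnulusCover {Ω Γi Γo : Set Plane} (hΩ : IsAnnularDomain Ω Γi Γo) :
    ∃ X, IsAnnulusCover Ω Γi Γo 1 2 X := by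
  obtain ⟨⟨Φ, hΦ, rfl, rfl, rfl⟩, -⟩ := hΩ
  have hc := isStripCover_polarMap.comp_diffeo hΦ
  have hinj : InjOn Φ closedRoundAnnulus := by
    obtain ⟨-, -, g, -, -, hg, -⟩ := hΦ
    exact hg.injOn
  have hmem : ∀ (p : ℝ × ℝ), p ∈ strip 1 2 → ∀ A ⊆ closedRoundAnnulus,
      (Φ ∘ polarMap) p ∈ Φ '' A ↔ polarMap p ∈ A := fun p hp A hA =>
    hinj.mem_image_iff hA (isStripCover_polarMap.mem hp)
  have hnorm : ∀ p ∈ strip 1 2, ‖polarMap p‖ = p.1 := fun p hp => by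
    rw [norm_polarMap, abs_of_nonneg]; linarith [(mem_strip.1 hp).1]
  refine ⟨_, ⟨hc, one_lt_two, fun p hp => ?_, fun p hp => ?_, fun p hp => ?_⟩⟩
  · rw [hmem p hp _ fun x hx => ?_, mem_sphere_zero_iff_norm, hnorm p hp]
    rw [mem_sphere_zero_iff_norm] at hx
    simp [closedRoundAnnulus, hx]
  · rw [hmem p hp _ fun x hx => ?_, mem_sphere_zero_iff_norm, hnorm p hp]
    rw [mem_sphere_zero_iff_norm] at hx
    simp [closedRoundAnnulus, hx]
  · rw [hmem p hp _ fun x hx => ⟨hx.1.le, hx.2.le⟩]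
    simp only [roundAnnulus, Set.mem_ofPred_eq, hnorm p hp]

theorem IsAnnulusCover.comp_stripDiffeo {Ω Γi Γo : Set Plane} {a b c d : ℝ} {X : ℝ × ℝ → Plane}
    (h : IsAnnulusCover Ω Γi Γo c d X) (hab : a < b) {R R' : ℝ × ℝ → ℝ × ℝ}
    (hR : IsStripDiffeo a b c d R R') (h1 : ∀ p ∈ strip a b, (R p).1 = c ↔ p.1 = a)
    (h2 : ∀ p ∈ strip a b, (R p).1 = d ↔ p.1 = b) : IsAnnulusCover Ω Γi Γo a b (X ∘ R) := by
  refine ⟨h.toIsStripCover.comp_stripDiffeo hR, hab, fun p hp => ?_, fun p hp => ?_,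
    fun p hp => ?_⟩
  · rw [← h1 p hp]; exact h.inner _ (hR.mapsTo hp)
  · rw [← h2 p hp]; exact h.outer _ (hR.mapsTo hp)
  · have e := h.interior _ (hR.mapsTo hp)
    rw [Function.comp, e]
    have m1 := mem_strip.1 (hR.mapsTo hp)
    have m2 := mem_strip.1 hp
    rw [m1.1.lt_iff_ne, m1.2.lt_iff_ne, m2.1.lt_iff_ne, m2.2.lt_iff_ne, ne_comm, Ne, h1 p hp,
      Ne, h2 p hp, ne_comm (a := a)]

/-- By periodicity the minimum over a fundamental rectangle is global, and without critical points
it cannot lie in the interior. It is therefore a boundary value, at least `m`; an interior value not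
exceeding `m` would be a forbidden interior minimum. -/
theorem lt_of_fderivWithin_ne_zero {f : ℝ × ℝ → ℝ} (hf : ContDiffOn ℝ (⊤ : ℕ∞) f (strip 1 2))
    (hper : ∀ p ∈ strip 1 2, f (p + (0, 1)) = f p) {m : ℝ}
    (hm : ∀ p ∈ strip 1 2, p.1 = 1 ∨ p.1 = 2 → m ≤ f p)
    (hcrit : ∀ p ∈ strip 1 2, fderivWithin ℝ f (strip 1 2) p ≠ 0) {p : ℝ × ℝ} (h1 : 1 < p.1)
    (h2 : p.1 < 2) : m < f p := by
  obtain ⟨p₀, hp₀, hmin⟩ := (isCompact_Icc.prod isCompact_Icc :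
    IsCompact (Icc (1 : ℝ) 2 ×ˢ Icc (0 : ℝ) 1)).exists_isMinOn ⟨(1, 0), by simp⟩
    (hf.continuousOn.mono (prod_mono subset_rfl (subset_univ _)))
  have hmin' : ∀ q ∈ strip 1 2, f p₀ ≤ f q := fun q hq => by
    obtain ⟨u, hu, e⟩ := (show Function.Periodic (fun t => f (q.1, t)) 1 from fun t => by
      simpa using hper (q.1, t) ⟨hq.1, mem_univ _⟩).exists_mem_Ico₀ one_pos q.2
    have h3 : f q = f (q.1, u) := e
    rw [h3]
    exact hmin ⟨hq.1, hu.1, hu.2.le⟩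
  have hno : ∀ q : ℝ × ℝ, 1 < q.1 → q.1 < 2 → ¬ ∀ r ∈ strip 1 2, f q ≤ f r := by
    intro q hq1 hq2 hq
    have hn : strip 1 2 ∈ 𝓝 q := prod_mem_nhds (Icc_mem_nhds hq1 hq2) univ_mem
    have hl : IsLocalMin f q := mem_of_superset hn hq
    have := hl.fderiv_eq_zero
    rw [← fderivWithin_of_mem_nhds hn] at this
    exact hcrit q (mem_of_mem_nhds hn) this
  have hp₀s : p₀ ∈ strip 1 2 := ⟨hp₀.1, mem_univ _⟩
  by_contra! hle
  by_cases hb : p₀.1 = 1 ∨ p₀.1 = 2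
  · exact hno p h1 h2 fun r hr => (hle.trans (hm p₀ hp₀s hb)).trans (hmin' r hr)
  · push Not at hb
    exact hno p₀ (lt_of_le_of_ne hp₀.1.1 hb.1.symm) (lt_of_le_of_ne hp₀.1.2 hb.2) hmin'

theorem fderivWithin_ne_zero_of_gradientWithin {ω : Plane → ℝ} {s : Set Plane} {x : Plane}
    (h : gradientWithin ω s x ≠ 0) : fderivWithin ℝ ω s x ≠ 0 := fun h0 =>
  h (by rw [gradientWithin, h0, map_zero])

/-- Coordinates on the closure of an annular domain whose first component is `ω`. -/
theorem exists_isAnnulusCover_levels {Ω Γi Γo : Set Plane} (hΩ : IsAnnularDomain Ω Γi Γo)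
    {ω : Plane → ℝ} (hω : MemFPlus Ω Γi Γo ω) :
    ∃ a b X, IsAnnulusCover Ω Γi Γo a b X ∧ ∀ p ∈ strip a b, ω (X p) = p.1 := by
  obtain ⟨X, hX⟩ := exists_isAnnulusCover hΩ
  obtain ⟨⟨hωs, hωi, hωo⟩, hωg, hωlt⟩ := hω
  have hm1 : ∀ t, ((1 : ℝ), t) ∈ strip 1 2 := fun t => by simp [mem_strip]
  have hm2 : ∀ t, ((2 : ℝ), t) ∈ strip 1 2 := fun t => by simp [mem_strip]
  have hi : ∀ t, X (1, t) ∈ Γi := fun t => (hX.inner _ (hm1 t)).2 rfl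
  have ho : ∀ t, X (2, t) ∈ Γo := fun t => (hX.outer _ (hm2 t)).2 rfl
  have hf : ContDiffOn ℝ (⊤ : ℕ∞) (ω ∘ X) (strip 1 2) :=
    hωs.comp hX.smooth fun p hp => hX.mem hp
  have hper : ∀ p ∈ strip 1 2, (ω ∘ X) (p + (0, 1)) = (ω ∘ X) p := fun p hp => by
    simp only [Function.comp, hX.shift hp]
  set a := ω (X (1, 0)) with ha
  set b := ω (X (2, 0)) with hb
  have hab : a < b := hωlt _ (hi 0) _ (ho 0)
  have h1 : ∀ t, (ω ∘ X) (1, t) = a := fun t => hωi _ (hi t) _ (hi 0)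
  have h2 : ∀ t, (ω ∘ X) (2, t) = b := fun t => hωo _ (ho t) _ (ho 0)
  have hu := uniqueDiffOn_strip one_lt_two
  have hcrit : ∀ p ∈ strip 1 2, fderivWithin ℝ (ω ∘ X) (strip 1 2) p ≠ 0 := by
    intro p hp h0
    rw [(hX.hasFDerivWithinAt_comp hωs hp).fderivWithin (hu p hp)] at h0
    obtain ⟨e, he⟩ := hX.isInvertible_fderivWithin one_lt_two hp
    refine fderivWithin_ne_zero_of_gradientWithin (hωg _ (hX.mem hp)) ?_
    ext v
    have := congrArg (fun l : ℝ × ℝ →L[ℝ] ℝ => l (e.symm v)) h0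
    rw [← he] at this
    simpa using this
  have hval : ∀ p ∈ strip 1 2, p.1 = 1 ∨ p.1 = 2 → (ω ∘ X) p = a ∨ (ω ∘ X) p = b := by
    rintro ⟨r, t⟩ - (h | h)
    · exact Or.inl (by rw [show r = 1 from h, h1])
    · exact Or.inr (by rw [show r = 2 from h, h2])
  have hin : ∀ p : ℝ × ℝ, 1 < p.1 → p.1 < 2 → a < (ω ∘ X) p ∧ (ω ∘ X) p < b := by
    intro p hp1 hp2
    constructor
    -- The lower bound comes from the lifted function and the upper bound from its negative.
    · refine lt_of_fderivWithin_ne_zero hf hper (fun q hq hqb => ?_) hcrit hp1 hp2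
      rcases hval q hq hqb with h | h <;> linarith
    · have := lt_of_fderivWithin_ne_zero (f := fun p => -(ω ∘ X) p) (m := -b) hf.neg
        (fun q hq => by rw [hper q hq]) (fun q hq hqb => ?_) (fun q hq => ?_) hp1 hp2
      · linarith
      · rcases hval q hq hqb with h | h <;> linarith
      · rw [fderivWithin_fun_neg (hu q hq)]
        exact neg_ne_zero.2 (hcrit q hq)
  obtain ⟨R, R', hR, hRf⟩ := exists_stripDiffeo_levels hf hper h1 h2 hin hcrit
  have hcases : ∀ q ∈ strip 1 2, ((ω ∘ X) q = a ↔ q.1 = 1) ∧ ((ω ∘ X) q = b ↔ q.1 = 2) := by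
    rintro ⟨r, t⟩ hq
    rw [mem_strip] at hq
    rcases hq.1.eq_or_lt with h3 | h3
    · have h3 : (1 : ℝ) = r := h3
      subst h3
      rw [h1]
      simp [hab.ne]
    rcases hq.2.eq_or_lt with h4 | h4
    · have h4 : r = (2 : ℝ) := h4
      subst h4
      rw [h2]
      simp [hab.ne']
    · have := hin (r, t) h3 h4
      exact ⟨⟨fun h => absurd h this.1.ne', fun h => absurd h h3.ne'⟩,
        ⟨fun h => absurd h this.2.ne, fun h => absurd h h4.ne⟩⟩
  refine ⟨a, b, X ∘ R, hX.comp_stripDiffeo hab hR (fun p hp => ?_) (fun p hp => ?_),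
    fun p hp => hRf p hp⟩
  · rw [← (hcases _ (hR.mapsTo hp)).1, hRf p hp]
  · rw [← (hcases _ (hR.mapsTo hp)).2, hRf p hp]

/-! ### Orientation and action-angle coordinates -/

/-- The Jacobian determinant of a linear map into the plane. -/
def jac (A : ℝ × ℝ →L[ℝ] Plane) : ℝ :=
  A (1, 0) 0 * A (0, 1) 1 - A (1, 0) 1 * A (0, 1) 0

theorem map_eq_smul_add {V : Type*} [NormedAddCommGroup V] [NormedSpace ℝ V]
    (A : ℝ × ℝ →L[ℝ] V) (v : ℝ × ℝ) : A v = v.1 • A (1, 0) + v.2 • A (0, 1) := by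
  rw [← map_smul, ← map_smul, ← map_add]
  simp

/-- A vanishing determinant puts both rows of the matrix, rotated by a right angle, into the kernel.
Injectivity makes them zero, so `A (1, 0) = 0`, a contradiction. -/
theorem jac_ne_zero {A : ℝ × ℝ →L[ℝ] Plane} (hA : A.IsInvertible) : jac A ≠ 0 := by
  intro h
  obtain ⟨e, rfl⟩ := hA
  set A : ℝ × ℝ →L[ℝ] Plane := (e : ℝ × ℝ →L[ℝ] Plane)
  have hinj : ∀ v, A v = 0 → v = 0 := fun v hv =>
    e.injective ((show e v = 0 from hv).trans (map_zero e).symm)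
  have h1 : (A (0, 1) 1, -A (1, 0) 1) = (0 : ℝ × ℝ) := by
    apply hinj
    rw [map_eq_smul_add]
    ext i
    fin_cases i
    · simp only [jac] at h
      simp only [Fin.zero_eta, PiLp.add_apply, PiLp.smul_apply, smul_eq_mul, PiLp.zero_apply]
      linarith
    · simp; ring
  have h2 : (A (0, 1) 0, -A (1, 0) 0) = (0 : ℝ × ℝ) := by
    apply hinj
    rw [map_eq_smul_add]
    ext i
    fin_cases i
    · simp; ring
    · simp only [jac] at h
      simp only [Fin.mk_one, PiLp.add_apply, PiLp.smul_apply, smul_eq_mul, PiLp.zero_apply]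
      linarith
  have h3 : A (1, 0) = 0 := by
    ext i
    fin_cases i
    · simpa using congrArg Prod.snd h2
    · simpa using congrArg Prod.snd h1
  have := congrArg Prod.fst (hinj _ h3)
  simp at this

theorem contDiff_jac : ContDiff ℝ (⊤ : ℕ∞) jac := by
  have h : ∀ (v : ℝ × ℝ) (i : Fin 2), ContDiff ℝ (⊤ : ℕ∞) fun A : ℝ × ℝ →L[ℝ] Plane => A v i :=
    fun v i => (EuclideanSpace.proj (𝕜 := ℝ) i).contDiff.comp
      (f := fun A : ℝ × ℝ →L[ℝ] Plane => A v) (by fun_prop)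
  exact ((h _ _).mul (h _ _)).sub ((h _ _).mul (h _ _))

theorem jac_comp (A : ℝ × ℝ →L[ℝ] Plane) (B : ℝ × ℝ →L[ℝ] ℝ × ℝ) :
    jac (A ∘L B) = jac A * ((B (1, 0)).1 * (B (0, 1)).2 - (B (1, 0)).2 * (B (0, 1)).1) := by
  simp only [jac, ContinuousLinearMap.comp_apply]
  rw [map_eq_smul_add A (B (1, 0)), map_eq_smul_add A (B (0, 1))]
  simp only [PiLp.add_apply, PiLp.smul_apply, smul_eq_mul]
  ring

/-- The reflection of the strip. -/
def reflectStrip : ℝ × ℝ →L[ℝ] ℝ × ℝ :=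
  (ContinuousLinearMap.fst ℝ ℝ ℝ).prod (-ContinuousLinearMap.snd ℝ ℝ ℝ)

theorem reflectStrip_apply (p : ℝ × ℝ) : reflectStrip p = (p.1, -p.2) := rfl

theorem reflectStrip_reflectStrip (p : ℝ × ℝ) : reflectStrip (reflectStrip p) = p := by
  simp [reflectStrip_apply]

theorem reflectStrip_mem {a b : ℝ} {p : ℝ × ℝ} : reflectStrip p ∈ strip a b ↔ p ∈ strip a b := by
  simp [reflectStrip_apply, mem_strip]

theorem IsStripCover.reflect {a b : ℝ} {X : ℝ × ℝ → Plane} {L : Set Plane}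
    (h : IsStripCover a b X L) : IsStripCover a b (X ∘ reflectStrip) L where
  smooth := h.smooth.comp reflectStrip.contDiff.contDiffOn fun p hp => reflectStrip_mem.2 hp
  image_eq := by
    rw [image_comp, ← h.image_eq]
    congr 1
    ext p
    exact ⟨fun ⟨q, hq, e⟩ => e ▸ reflectStrip_mem.2 hq, fun hp =>
      ⟨reflectStrip p, reflectStrip_mem.2 hp, reflectStrip_reflectStrip p⟩⟩
  eq_iff p hp q hq := by
    rw [Function.comp, Function.comp,
      h.eq_iff _ (reflectStrip_mem.2 hp) _ (reflectStrip_mem.2 hq)]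
    constructor
    · rintro ⟨n, hn⟩
      refine ⟨-n, ?_⟩
      rw [← reflectStrip_reflectStrip q, hn]
      ext <;> simp [reflectStrip_apply]
      ring
    · rintro ⟨n, rfl⟩
      refine ⟨-n, ?_⟩
      ext <;> simp [reflectStrip_apply]
      ring
  localInv p hp := by
    obtain ⟨σ, hσ, hσp, hσX, hXσ⟩ := h.localInv _ (reflectStrip_mem.2 hp)
    refine ⟨reflectStrip ∘ σ, reflectStrip.contDiff.comp_contDiffWithinAt hσ, ?_, ?_, ?_⟩
    · simp only [Function.comp, hσp, reflectStrip_reflectStrip]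
    · filter_upwards [hσX] with x hx
      exact ⟨reflectStrip_mem.2 hx.1, by
        simp only [Function.comp, reflectStrip_reflectStrip, hx.2]⟩
    · have ht : Tendsto reflectStrip (𝓝[strip a b] p) (𝓝[strip a b] (reflectStrip p)) :=
        tendsto_nhdsWithin_of_tendsto_nhds_of_eventually_within _
          (reflectStrip.continuous.continuousWithinAt)
          (eventually_mem_nhdsWithin.mono fun q hq => reflectStrip_mem.2 hq)
      filter_upwards [ht.eventually hXσ] with q hq
      simp only [Function.comp, hq, reflectStrip_reflectStrip]

/-- The Jacobian has no zero on the connected strip and hence one sign. Reversing the angle, which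
leaves the levels of `ω` alone, turns a negative sign into a positive one. -/
theorem exists_isAnnulusCover_jac_pos {Ω Γi Γo : Set Plane} (hΩ : IsAnnularDomain Ω Γi Γo)
    {ω : Plane → ℝ} (hω : MemFPlus Ω Γi Γo ω) :
    ∃ a b X, IsAnnulusCover Ω Γi Γo a b X ∧ (∀ p ∈ strip a b, ω (X p) = p.1) ∧
      ∀ p ∈ strip a b, 0 < jac (fderivWithin ℝ X (strip a b) p) := by
  obtain ⟨a, b, X, hX, hωX⟩ := exists_isAnnulusCover_levels hΩ hω
  have hu := uniqueDiffOn_strip hX.lt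
  have hne : ∀ p ∈ strip a b, jac (fderivWithin ℝ X (strip a b) p) ≠ 0 := fun p hp =>
    jac_ne_zero (hX.isInvertible_fderivWithin hX.lt hp)
  have hc : ContinuousOn (fun p => jac (fderivWithin ℝ X (strip a b) p)) (strip a b) :=
    contDiff_jac.continuous.comp_continuousOn (hX.smooth.continuousOn_fderivWithin hu (by simp))
  have hpre : IsPreconnected (strip a b) := (convex_strip a b).isPreconnected
  by_cases hpos : ∀ p ∈ strip a b, 0 < jac (fderivWithin ℝ X (strip a b) p)
  · exact ⟨a, b, X, hX, hωX, hpos⟩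
  push Not at hpos
  obtain ⟨p₀, hp₀, hneg⟩ := hpos
  have hneg' : ∀ p ∈ strip a b, jac (fderivWithin ℝ X (strip a b) p) < 0 := fun p hp => by
    by_contra! h
    obtain ⟨q, hq, e⟩ := hpre.intermediate_value hp₀ hp hc ⟨hneg, h⟩
    exact hne q hq e
  refine ⟨a, b, X ∘ reflectStrip, ⟨hX.toIsStripCover.reflect, hX.lt, fun p hp =>
    hX.inner _ (reflectStrip_mem.2 hp), fun p hp => hX.outer _ (reflectStrip_mem.2 hp), fun p hp =>
    hX.interior _ (reflectStrip_mem.2 hp)⟩, fun p hp => hωX _ (reflectStrip_mem.2 hp), ?_⟩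
  intro p hp
  have h1 := (hX.hasFDerivWithinAt (reflectStrip_mem.2 hp)).comp p
    reflectStrip.hasFDerivWithinAt (fun q hq => reflectStrip_mem.2 hq)
  rw [h1.fderivWithin (hu p hp), jac_comp]
  simp only [reflectStrip_apply]
  have := hneg' _ (reflectStrip_mem.2 hp)
  rw [reflectStrip_apply] at this
  simp; exact this

/-- Action-angle coordinates for `ω`: the area element is `T(s) ds dτ`, where `s` is the value of
`ω`, and `τ` is an angle measured in turns. -/
structure IsActionAngle (Ω Γi Γo : Set Plane) (ω : Plane → ℝ) (a b : ℝ) (T : ℝ → ℝ)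
    (Z : ℝ × ℝ → Plane) : Prop extends IsAnnulusCover Ω Γi Γo a b Z where
  level : ∀ p ∈ strip a b, ω (Z p) = p.1
  smoothT : ContDiffOn ℝ (⊤ : ℕ∞) T (Icc a b)
  posT : ∀ s ∈ Icc a b, 0 < T s
  jac_eq : ∀ p ∈ strip a b, jac (fderivWithin ℝ Z (strip a b) p) = T p.1

/-- On each level take as new angle the accumulated Jacobian `A (s, θ)` divided by its total `T s`
over one turn. A full turn adds `T s` to `A`, so the new angle advances by `1`; and since the old
angle `ρ` satisfies `J * ∂ₜρ = T`, the new Jacobian is `T`. -/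
theorem exists_isActionAngle {Ω Γi Γo : Set Plane} (hΩ : IsAnnularDomain Ω Γi Γo)
    {ω : Plane → ℝ} (hω : MemFPlus Ω Γi Γo ω) :
    ∃ a b T Z, IsActionAngle Ω Γi Γo ω a b T Z := by
  obtain ⟨a, b, X, hX, hωX, hpos⟩ := exists_isAnnulusCover_jac_pos hΩ hω
  have hu := uniqueDiffOn_strip hX.lt
  set J : ℝ × ℝ → ℝ := fun p => jac (fderivWithin ℝ X (strip a b) p) with hJ
  have hJs : ContDiffOn ℝ (⊤ : ℕ∞) J (strip a b) :=
    contDiff_jac.comp_contDiffOn ((contDiffOn_infty_iff_fderivWithin hu).1 hX.smooth).2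
  have hJper : ∀ p ∈ strip a b, J (p + (0, 1)) = J p := fun p hp => by
    simp only [hJ]
    rw [fderivWithin_strip_add (fun q hq => hX.shift hq) hp]
  -- The primitive of `J` in the angle, rescaled to the unit interval so that its joint smoothness
  -- follows from `ContDiffOn.integral_unitInterval`.
  set A : ℝ × ℝ → ℝ := fun p => ∫ u in (0 : ℝ)..1, p.2 * J (p.1, p.2 * u) with hA
  have hAs : ContDiffOn ℝ (⊤ : ℕ∞) A (strip a b) := by
    refine ContDiffOn.integral_unitInterval (g := fun p u => p.2 * J (p.1, p.2 * u))
      (convex_strip a b) hu ?_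
    refine ContDiffOn.mul (f := fun q : (ℝ × ℝ) × ℝ => q.1.2) (by fun_prop) ?_
    exact hJs.comp (f := fun q : (ℝ × ℝ) × ℝ => (q.1.1, q.1.2 * q.2)) (by fun_prop)
      fun q hq => ⟨hq.1.1, mem_univ _⟩
  have hAint : ∀ s θ, A (s, θ) = ∫ v in (0 : ℝ)..θ, J (s, v) := fun s θ => by
    simp only [hA]
    rw [intervalIntegral.integral_const_mul,
      intervalIntegral.mul_integral_comp_mul_left (f := fun v => J (s, v))]
    simp
  have hJline : ∀ s ∈ Icc a b, Continuous fun v => J (s, v) := fun s hs => by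
    rw [← continuousOn_univ]
    exact hJs.continuousOn.comp (f := fun v => (s, v)) (by fun_prop) fun v _ => ⟨hs, mem_univ _⟩
  set T : ℝ → ℝ := fun s => A (s, 1) with hT
  have hTs : ContDiffOn ℝ (⊤ : ℕ∞) T (Icc a b) :=
    hAs.comp (f := fun s => (s, (1 : ℝ))) (by fun_prop) fun s hs => ⟨hs, mem_univ _⟩
  have hTpos : ∀ s ∈ Icc a b, 0 < T s := fun s hs => by
    simp only [hT, hAint]
    exact intervalIntegral.intervalIntegral_pos_of_pos
      ((hJline s hs).intervalIntegrable _ _) (fun v => hpos (s, v) ⟨hs, mem_univ _⟩) one_pos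
  have hAshift : ∀ s ∈ Icc a b, ∀ θ, A (s, θ + 1) = A (s, θ) + T s := fun s hs θ => by
    have hP : Function.Periodic (fun v => J (s, v)) 1 := fun v => by
      simpa using hJper (s, v) ⟨hs, mem_univ _⟩
    have h1 := hP.intervalIntegral_add_eq θ 0
    rw [zero_add] at h1
    simp only [hT, hAint]
    rw [← h1, intervalIntegral.integral_add_adjacent_intervals
      ((hJline s hs).intervalIntegrable _ _) ((hJline s hs).intervalIntegrable _ _)]
  have hAd : ∀ s ∈ Icc a b, ∀ θ, HasDerivAt (fun θ => A (s, θ)) (J (s, θ)) θ := fun s hs θ => by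
    simp only [hAint]
    exact intervalIntegral.integral_hasDerivAt_right ((hJline s hs).intervalIntegrable _ _)
      ((hJline s hs).stronglyMeasurableAtFilter _ _) (hJline s hs).continuousAt
  set g : ℝ → ℝ → ℝ := fun s θ => A (s, θ) / T s with hg
  have hgs : ContDiffOn ℝ (⊤ : ℕ∞) (Function.uncurry g) (Icc a b ×ˢ univ) := by
    refine ContDiffOn.div (f := fun p : ℝ × ℝ => A p) (g := fun p : ℝ × ℝ => T p.1) hAs ?_
      fun p hp => (hTpos p.1 hp.1).ne'
    exact hTs.comp (f := fun p : ℝ × ℝ => p.1) (by fun_prop) fun p hp => hp.1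
  have hgd : ∀ s ∈ Icc a b, ∀ θ, HasDerivAt (g s) (J (s, θ) / T s) θ := fun s hs θ =>
    (hAd s hs θ).div_const _
  have hgpos : ∀ s ∈ Icc a b, ∀ θ, 0 < J (s, θ) / T s := fun s hs θ =>
    div_pos (hpos (s, θ) ⟨hs, mem_univ _⟩) (hTpos s hs)
  have hgmono : ∀ s ∈ Icc a b, StrictMono (g s) := fun s hs =>
    strictMono_of_hasDerivAt_pos (hgd s hs) (hgpos s hs)
  have hgshift : ∀ s ∈ Icc a b, ∀ θ, g s (θ + 1) = g s θ + 1 := fun s hs θ => by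
    simp only [hg, hAshift s hs]
    rw [add_div, div_self (hTpos s hs).ne']
  have hg0 : ∀ s, g s 0 = 0 := fun s => by simp [hg, hAint]
  have hgnat : ∀ s ∈ Icc a b, ∀ n : ℕ, g s n = n ∧ g s (-n) = -n := fun s hs n => by
    induction n with
    | zero => simp [hg0]
    | succ n ih =>
      refine ⟨by push_cast; rw [hgshift s hs, ih.1], ?_⟩
      have := hgshift s hs (-(n + 1 : ℕ))
      push_cast at this ⊢
      rw [show -((n : ℝ) + 1) + 1 = -n by ring, ih.2] at this
      linarith
  have hgsurj : ∀ s ∈ Icc a b, ∀ y, ∃ θ, g s θ = y := fun s hs y => by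
    obtain ⟨n, hn⟩ := exists_nat_gt |y|
    have hc : Continuous (g s) := continuous_iff_continuousAt.2 fun θ => (hgd s hs θ).continuousAt
    obtain ⟨h1, h2⟩ := abs_lt.1 hn
    exact mem_range_of_exists_le_of_exists_ge hc ⟨-n, by rw [(hgnat s hs n).2]; exact h1.le⟩
      ⟨n, by rw [(hgnat s hs n).1]; exact h2.le⟩
  have hex : ∀ s y, ∃ θ, s ∈ Icc a b → g s θ = y := fun s y => by
    by_cases hs : s ∈ Icc a b
    · obtain ⟨θ, h⟩ := hgsurj s hs y
      exact ⟨θ, fun _ => h⟩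
    · exact ⟨0, fun h => absurd h hs⟩
  choose ρ hρ using hex
  have hgF : ∀ p ∈ strip a b, HasFDerivWithinAt (Function.uncurry g)
      (fderivWithin ℝ (Function.uncurry g) (strip a b) p) (strip a b) p := fun p hp =>
    (hgs.differentiableOn (by simp) p hp).hasFDerivWithinAt
  have hρs : ContDiffOn ℝ (⊤ : ℕ∞) (Function.uncurry ρ) (Icc a b ×ˢ univ) := by
    refine contDiffOn_fiberwise_inverse convex_univ (uniqueDiffOn_Icc hX.lt) uniqueDiffOn_univ
      uniqueDiffOn_univ hgs ?_ (fun s hs => (hgmono s hs).strictMonoOn _)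
      (fun s hs y _ => mem_univ _) (fun s hs y _ => hρ s y hs)
    intro s hs θ _
    have h1 := (hgF (s, θ) ⟨hs, mem_univ _⟩).strip_snd ⟨hs, mem_univ _⟩
    have h2 := h1.unique (hgd s hs θ)
    exact h2.symm ▸ hgpos s hs θ
  have hR : IsStripDiffeo a b a b (fun p => (p.1, ρ p.1 p.2)) (fun p => (p.1, g p.1 p.2)) := by
    refine ⟨contDiffOn_fst.prodMk hρs, contDiffOn_fst.prodMk hgs, fun p hp => ⟨hp.1, mem_univ _⟩,
      fun p hp => ⟨hp.1, mem_univ _⟩, fun p hp => Prod.ext rfl (hρ _ _ hp.1),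
      fun p hp => Prod.ext rfl ((hgmono p.1 hp.1).injective (hρ _ _ hp.1)), fun p hp => ?_⟩
    refine Prod.ext (by simp) ((hgmono p.1 hp.1).injective ?_)
    simp only [Prod.fst_add, Prod.snd_add, add_zero]
    rw [hρ _ _ hp.1, hgshift _ hp.1, hρ _ _ hp.1]
  refine ⟨a, b, T, _, ⟨hX.comp_stripDiffeo hX.lt hR (fun p hp => Iff.rfl) (fun p hp => Iff.rfl),
    fun p hp => hωX _ (hR.mapsTo hp), hTs, hTpos, fun p hp => ?_⟩⟩
  have hρF : HasFDerivWithinAt (Function.uncurry ρ)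
      (fderivWithin ℝ (Function.uncurry ρ) (strip a b) p) (strip a b) p :=
    (hρs.differentiableOn (by simp) p hp).hasFDerivWithinAt
  have hRF : HasFDerivWithinAt (fun p : ℝ × ℝ => (p.1, ρ p.1 p.2))
      ((ContinuousLinearMap.fst ℝ ℝ ℝ).prod (fderivWithin ℝ (Function.uncurry ρ) (strip a b) p))
      (strip a b) p := hasFDerivWithinAt_fst.prodMk hρF
  have h1 := (hX.hasFDerivWithinAt (hR.mapsTo hp)).comp p hRF hR.mapsTo
  rw [h1.fderivWithin (hu p hp), jac_comp]
  have h2 := (hgd p.1 hp.1 (ρ p.1 p.2)).comp p.2 (hρF.strip_snd hp)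
  have h3 : HasDerivAt (g p.1 ∘ fun t => Function.uncurry ρ (p.1, t)) 1 p.2 := by
    rw [show (g p.1 ∘ fun t => Function.uncurry ρ (p.1, t)) = id from
      funext fun t => hρ p.1 t hp.1]
    exact hasDerivAt_id _
  have h4 := h2.unique h3
  have h5 := (hTpos p.1 hp.1).ne'
  have h6 : J (p.1, ρ p.1 p.2) * fderivWithin ℝ (Function.uncurry ρ) (strip a b) p (0, 1)
      = T p.1 := by
    field_simp at h4
    linarith
  simp only [ContinuousLinearMap.prod_apply, ContinuousLinearMap.coe_fst', mul_zero, sub_zero,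
    one_mul]
  exact h6

/-! ### Arc length and one-dimensional Hausdorff measure -/

/-- Second countability reduces the neighbourhoods to countably many; made disjoint, they cut any
measurable set into pieces on which the comparison is known. -/
theorem measure_le_of_locally_le {X : Type*} [TopologicalSpace X] [SecondCountableTopology X]
    [MeasurableSpace X] [OpensMeasurableSpace X] {μ ν : Measure X}
    (h : ∀ x, ∃ U ∈ 𝓝 x, ∀ A ⊆ U, MeasurableSet A → μ A ≤ ν A) : μ ≤ ν := by
  choose U hU hA using h
  rcases isEmpty_or_nonempty X with hX | hX
  · exact Measure.le_iff.2 fun A _ => by simp [Subsingleton.elim A ∅]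
  obtain ⟨s, hs, hsU⟩ := TopologicalSpace.countable_cover_nhds fun x =>
    interior_mem_nhds.2 (hU x)
  have hne : s.Nonempty := by
    by_contra hne
    rw [Set.not_nonempty_iff_eq_empty] at hne
    subst hne
    exact empty_ne_univ (by simpa using hsU)
  obtain ⟨f, rfl⟩ := hs.exists_eq_range hne
  set D : ℕ → Set X := disjointed fun n => interior (U (f n)) with hD
  have hDm : ∀ n, MeasurableSet (D n) := fun n =>
    MeasurableSet.disjointed (fun n => isOpen_interior.measurableSet) n
  have hDU : ∀ n, D n ⊆ U (f n) := fun n => (disjointed_subset _ n).trans interior_subset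
  have hDun : ⋃ n, D n = univ := by
    rw [hD, iUnion_disjointed, ← hsU, biUnion_range]
  refine Measure.le_iff.2 fun A hAm => ?_
  have hsum : ∀ m : Measure X, m A = ∑' n, m (A ∩ D n) := fun m => by
    rw [← measure_iUnion, ← inter_iUnion, hDun, inter_univ]
    · exact fun i j hij => (disjoint_disjointed _ hij).mono inter_subset_right inter_subset_right
    · exact fun n => hAm.inter (hDm n)
  rw [hsum μ, hsum ν]
  exact ENNReal.tsum_le_tsum fun n =>
    hA _ _ (inter_subset_right.trans (hDU n)) (hAm.inter (hDm n))

section ArcLength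

variable {V : Type*} [NormedAddCommGroup V] [NormedSpace ℝ V] [MeasurableSpace V] [BorelSpace V]

/-- With velocity within `ε * ‖v‖` of `v`, the curve is bi-Lipschitz on `I` with constants `(1 ± ε)
* ‖v‖`. The Hausdorff measure of the image and the integral of the speed then both lie between these
multiples of Lebesgue measure. -/
theorem hausdorffMeasure_image_bounds {γ γ' : ℝ → V} (hγ : ∀ t, HasDerivAt γ (γ' t) t) {I : Set ℝ}
    (hI : Convex ℝ I) {v : V} {ε : ℝ} (hε : 0 < ε) (hε1 : ε < 1) (hv : v ≠ 0)
    (hb : ∀ t ∈ I, ‖γ' t - v‖ ≤ ε * ‖v‖) {A : Set ℝ} (hA : A ⊆ I) (hAm : MeasurableSet A) :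
    Measure.hausdorffMeasure 1 (γ '' A) ≤
        ENNReal.ofReal ((1 + ε) / (1 - ε)) * ∫⁻ t in A, ENNReal.ofReal ‖γ' t‖ ∧
      ∫⁻ t in A, ENNReal.ofReal ‖γ' t‖ ≤
        ENNReal.ofReal ((1 + ε) / (1 - ε)) * Measure.hausdorffMeasure 1 (γ '' A) := by
  have hc : 0 < ‖v‖ := norm_pos_iff.2 hv
  have h1 : 0 < 1 - ε := by linarith
  set L : ℝ := (1 + ε) * ‖v‖ with hL
  set l : ℝ := (1 - ε) * ‖v‖ with hl
  have hL0 : 0 ≤ L := by positivity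
  have hl0 : 0 < l := by positivity
  have hratio : (1 + ε) / (1 - ε) = L / l := by
    rw [hL, hl]; field_simp
  have hup : ∀ t ∈ I, ‖γ' t‖ ≤ L := fun t ht => by
    have := norm_add_le (γ' t - v) v
    rw [sub_add_cancel] at this
    linarith [hb t ht]
  have hlo : ∀ t ∈ I, l ≤ ‖γ' t‖ := fun t ht => by
    have := norm_sub_norm_le v (γ' t)
    rw [norm_sub_rev] at this
    linarith [hb t ht]
  have hlip : ∀ s ∈ I, ∀ t ∈ I, ‖γ t - γ s‖ ≤ L * ‖t - s‖ := fun s hs t ht =>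
    hI.norm_image_sub_le_of_norm_hasDerivWithin_le (fun x _ => (hγ x).hasDerivWithinAt) hup hs ht
  -- Subtracting the uniform motion `t • v` leaves a map with Lipschitz constant `ε * ‖v‖`; the
  -- triangle inequality gives the lower bound.
  have hanti : ∀ s ∈ I, ∀ t ∈ I, l * ‖t - s‖ ≤ ‖γ t - γ s‖ := fun s hs t ht => by
    have h2 := hI.norm_image_sub_le_of_norm_hasDerivWithin_le (f := fun t => γ t - t • v)
      (f' := fun t => γ' t - v)
      (fun x _ => by
        have := (hγ x).fun_sub ((hasDerivAt_id x).smul_const v)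
        rw [one_smul] at this
        exact this.hasDerivWithinAt)
      hb hs ht
    have h3 : (t - s) • v = (γ t - γ s) - ((γ t - t • v) - (γ s - s • v)) := by
      rw [sub_smul]; abel
    have h4 := norm_sub_le (γ t - γ s) ((γ t - t • v) - (γ s - s • v))
    rw [← h3, norm_smul] at h4
    nlinarith
  have e1 : Measure.hausdorffMeasure 1 (γ '' A) ≤ ENNReal.ofReal L * volume A := by
    have h2 : LipschitzOnWith L.toNNReal γ A := LipschitzOnWith.of_dist_le_mul fun s hs t ht => by
      rw [dist_eq_norm, dist_eq_norm, Real.coe_toNNReal _ hL0]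
      exact hlip t (hA ht) s (hA hs)
    have := h2.hausdorffMeasure_image_le zero_le_one
    rwa [ENNReal.rpow_one, hausdorffMeasure_real] at this
  have e2 : volume A ≤ ENNReal.ofReal l⁻¹ * Measure.hausdorffMeasure 1 (γ '' A) := by
    have hinj : InjOn γ A := fun s hs t ht hst => by
      have := hanti s (hA hs) t (hA ht)
      rw [hst, sub_self, norm_zero] at this
      have h5 : ‖t - s‖ ≤ 0 := by
        by_contra! h6
        nlinarith
      exact (sub_eq_zero.1 (norm_le_zero_iff.1 h5)).symm
    have h2 : LipschitzOnWith (l⁻¹).toNNReal (Function.invFunOn γ A) (γ '' A) := by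
      refine LipschitzOnWith.of_dist_le_mul ?_
      rintro _ ⟨s, hs, rfl⟩ _ ⟨t, ht, rfl⟩
      rw [hinj.leftInvOn_invFunOn hs, hinj.leftInvOn_invFunOn ht, dist_eq_norm, dist_eq_norm,
        Real.coe_toNNReal _ (inv_nonneg.2 hl0.le), inv_mul_eq_div, le_div_iff₀ hl0, mul_comm]
      exact hanti t (hA ht) s (hA hs)
    have := h2.hausdorffMeasure_image_le zero_le_one
    rwa [ENNReal.rpow_one, hausdorffMeasure_real, hinj.leftInvOn_invFunOn.image_image] at this
  have e3 : ∫⁻ t in A, ENNReal.ofReal ‖γ' t‖ ≤ ENNReal.ofReal L * volume A := by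
    rw [← setLIntegral_const]
    exact setLIntegral_mono' hAm fun t ht => ENNReal.ofReal_le_ofReal (hup t (hA ht))
  have e4 : ENNReal.ofReal l * volume A ≤ ∫⁻ t in A, ENNReal.ofReal ‖γ' t‖ := by
    rw [← setLIntegral_const]
    exact setLIntegral_mono' hAm fun t ht => ENNReal.ofReal_le_ofReal (hlo t (hA ht))
  rw [hratio]
  refine ⟨e1.trans ?_, e3.trans ?_⟩
  · calc ENNReal.ofReal L * volume A
        = ENNReal.ofReal (L / l) * (ENNReal.ofReal l * volume A) := by
          rw [← mul_assoc, ← ENNReal.ofReal_mul (by positivity), div_mul_cancel₀ _ hl0.ne']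
      _ ≤ _ := by gcongr
  · calc ENNReal.ofReal L * volume A
        ≤ ENNReal.ofReal L * (ENNReal.ofReal l⁻¹ * Measure.hausdorffMeasure 1 (γ '' A)) := by
          gcongr
      _ = _ := by rw [← mul_assoc, ← ENNReal.ofReal_mul hL0, div_eq_mul_inv]

theorem le_of_forall_le_ofReal_mul {x y : ENNReal}
    (h : ∀ ε : ℝ, 0 < ε → ε < 1 → x ≤ ENNReal.ofReal ((1 + ε) / (1 - ε)) * y) : x ≤ y := by
  have h1 : Tendsto (fun ε : ℝ => (1 + ε) / (1 - ε)) (𝓝 0) (𝓝 ((1 + 0) / (1 - 0))) :=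
    ((continuous_const.add continuous_id).tendsto 0).div
      ((continuous_const.sub continuous_id).tendsto 0) (by norm_num)
  have h2 : Tendsto (fun ε : ℝ => ENNReal.ofReal ((1 + ε) / (1 - ε)) * y) (𝓝[>] 0) (𝓝 y) := by
    have h3 := ENNReal.Tendsto.mul_const (b := y)
      ((ENNReal.tendsto_ofReal h1).mono_left (nhdsWithin_le_nhds (s := Ioi 0)))
      (Or.inl (by norm_num))
    simpa using h3
  refine ge_of_tendsto h2 ?_
  filter_upwards [Ioo_mem_nhdsGT (zero_lt_one' ℝ)] with ε hε
  exact h ε hε.1 hε.2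

/-- The area formula for regular simple curves. -/
theorem integral_image_hausdorffMeasure_one {γ γ' : ℝ → V} (hγ : ∀ t, HasDerivAt γ (γ' t) t)
    (hγ' : Continuous γ') (hne : ∀ t, γ' t ≠ 0) {S : Set ℝ} (hS : MeasurableSet S)
    (hinj : InjOn γ S) (u : V → ℝ) :
    ∫ x in γ '' S, u x ∂(Measure.hausdorffMeasure 1 : Measure V) =
      ∫ t in S, ‖γ' t‖ * u (γ t) := by
  have hc : Continuous γ := continuous_iff_continuousAt.2 fun t => (hγ t).continuousAt
  have hemb : MeasurableEmbedding (S.domRestrict γ) := hc.continuousOn.measurableEmbedding hS hinj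
  have hcoe := MeasurableEmbedding.subtype_coe hS
  have himg : ∀ A : Set S, S.domRestrict γ '' A = γ '' ((↑) '' A) := fun A => by
    rw [image_image]; rfl
  -- Both measures are pulled back to `S`. By continuity of `γ'` they are locally comparable with
  -- ratio `(1 + ε) / (1 - ε)` for every `ε` in `(0, 1)`, and letting `ε` tend to `0` makes them
  -- equal.
  have key : Measure.comap (S.domRestrict γ) (Measure.hausdorffMeasure 1) =
      Measure.comap ((↑) : S → ℝ) (volume.withDensity fun t => ENNReal.ofReal ‖γ' t‖) := by
    have hloc : ∀ ε : ℝ, 0 < ε → ε < 1 → ∀ x : S, ∃ U ∈ 𝓝 x, ∀ A ⊆ U, MeasurableSet A →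
        Measure.comap (S.domRestrict γ) (Measure.hausdorffMeasure 1) A ≤
          ENNReal.ofReal ((1 + ε) / (1 - ε)) *
            Measure.comap ((↑) : S → ℝ) (volume.withDensity fun t => ENNReal.ofReal ‖γ' t‖) A ∧
        Measure.comap ((↑) : S → ℝ) (volume.withDensity fun t => ENNReal.ofReal ‖γ' t‖) A ≤
          ENNReal.ofReal ((1 + ε) / (1 - ε)) *
            Measure.comap (S.domRestrict γ) (Measure.hausdorffMeasure 1) A := by
      intro ε hε hε1 x
      have h1 : ∀ᶠ t in 𝓝 (x : ℝ), ‖γ' t - γ' x‖ < ε * ‖γ' x‖ := by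
        have : Tendsto (fun t => ‖γ' t - γ' x‖) (𝓝 (x : ℝ)) (𝓝 0) := by
          have := ((hγ'.sub continuous_const).norm.tendsto (x : ℝ) :
            Tendsto (fun t => ‖γ' t - γ' x‖) _ _)
          simpa using this
        exact this.eventually (gt_mem_nhds (mul_pos hε (norm_pos_iff.2 (hne x))))
      obtain ⟨δ, hδ, hball⟩ := Metric.eventually_nhds_iff_ball.1 h1
      refine ⟨(↑) ⁻¹' Metric.ball (x : ℝ) δ,
        continuous_subtype_val.continuousAt.preimage_mem_nhds (Metric.ball_mem_nhds _ hδ),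
        fun A hA hAm => ?_⟩
      rw [hemb.comap_apply, hcoe.comap_apply, himg,
        withDensity_apply _ (hcoe.measurableSet_image' hAm)]
      exact hausdorffMeasure_image_bounds hγ (convex_ball _ _) hε hε1 (hne x)
        (fun t ht => (hball t ht).le) (image_subset_iff.2 hA) (hcoe.measurableSet_image' hAm)
    refine le_antisymm ?_ ?_
    · refine Measure.le_iff.2 fun A _ => le_of_forall_le_ofReal_mul fun ε hε hε1 => ?_
      have := measure_le_of_locally_le (ν := ENNReal.ofReal ((1 + ε) / (1 - ε)) • Measure.comap
        ((↑) : S → ℝ) (volume.withDensity fun t => ENNReal.ofReal ‖γ' t‖)) fun x => by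
          obtain ⟨U, hU, h⟩ := hloc ε hε hε1 x
          exact ⟨U, hU, fun A hA hAm => (h A hA hAm).1⟩
      exact this A
    · refine Measure.le_iff.2 fun A _ => le_of_forall_le_ofReal_mul fun ε hε hε1 => ?_
      have := measure_le_of_locally_le (ν := ENNReal.ofReal ((1 + ε) / (1 - ε)) •
        Measure.comap (S.domRestrict γ) (Measure.hausdorffMeasure 1)) fun x => by
          obtain ⟨U, hU, h⟩ := hloc ε hε hε1 x
          exact ⟨U, hU, fun A hA hAm => (h A hA hAm).2⟩
      exact this A
  have hrange : range (S.domRestrict γ) = γ '' S := range_domRestrict γ S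
  rw [← hrange, ← hemb.map_comap, hemb.integral_map, key]
  have h2 : ∀ x : S, u (S.domRestrict γ x) = (u ∘ γ) x := fun x => rfl
  simp only [h2]
  rw [← hcoe.integral_map, hcoe.map_comap, Subtype.range_coe]
  simp only [ENNReal.ofReal]
  rw [setIntegral_withDensity_eq_setIntegral_smul₀ (f := fun t => (‖γ' t‖).toNNReal)
      hγ'.norm.measurable.real_toNNReal.aemeasurable.restrict _ hS]
  refine setIntegral_congr_fun hS fun t _ => ?_
  simp only [NNReal.smul_def, Real.coe_toNNReal _ (norm_nonneg _), smul_eq_mul, Function.comp]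

end ArcLength

/-! ### Brackets and level integrals in action-angle coordinates -/

theorem clm_plane_apply {V : Type*} [NormedAddCommGroup V] [NormedSpace ℝ V] (D : Plane →L[ℝ] V)
    (v : Plane) :
    D v = v 0 • D (EuclideanSpace.single 0 1) + v 1 • D (EuclideanSpace.single 1 1) := by
  conv_lhs => rw [show v = v 0 • EuclideanSpace.single 0 (1 : ℝ) +
    v 1 • EuclideanSpace.single 1 (1 : ℝ) by ext i; fin_cases i <;> simp]
  rw [map_add, map_smul, map_smul]

theorem jac_comp_left (D : Plane →L[ℝ] Plane) (A : ℝ × ℝ →L[ℝ] Plane) :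
    jac (D ∘L A) = D.det * jac A := by
  have h : D.det = D (EuclideanSpace.single 0 1) 0 * D (EuclideanSpace.single 1 1) 1 -
      D (EuclideanSpace.single 1 1) 0 * D (EuclideanSpace.single 0 1) 1 := by
    rw [ContinuousLinearMap.det,
      ← LinearMap.det_toMatrix (EuclideanSpace.basisFun (Fin 2) ℝ).toBasis,
      Matrix.det_fin_two]
    simp [LinearMap.toMatrix_apply]
  simp only [jac, h, ContinuousLinearMap.comp_apply]
  rw [clm_plane_apply D (A (1, 0)), clm_plane_apply D (A (0, 1))]
  simp only [PiLp.add_apply, PiLp.smul_apply, smul_eq_mul]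
  ring

theorem det_eq_jac (e : Plane ≃L[ℝ] ℝ × ℝ) (he : ∀ x, e x = (x 0, x 1)) (A : ℝ × ℝ →L[ℝ] Plane) :
    ((e : Plane →L[ℝ] ℝ × ℝ) ∘L A).det = jac A := by
  rw [ContinuousLinearMap.det, ← LinearMap.det_toMatrix (Module.Basis.finTwoProd ℝ),
    Matrix.det_fin_two]
  simp [LinearMap.toMatrix_apply, he, jac]
  ring

namespace IsActionAngle

variable {Ω Γi Γo : Set Plane} {ω : Plane → ℝ} {a b : ℝ} {T : ℝ → ℝ} {Z : ℝ × ℝ → Plane}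

theorem exists_mem_Ico (h : IsActionAngle Ω Γi Γo ω a b T Z) {x : Plane} (hx : x ∈ closure Ω) :
    ∃ p ∈ strip a b, p.2 ∈ Ico (0 : ℝ) 1 ∧ Z p = x := by
  rw [← h.image_eq] at hx
  obtain ⟨p, hp, rfl⟩ := hx
  refine ⟨(p.1, Int.fract p.2), ⟨hp.1, mem_univ _⟩, ⟨Int.fract_nonneg _, Int.fract_lt_one _⟩, ?_⟩
  rw [h.eq_iff (p.1, Int.fract p.2) ⟨hp.1, mem_univ _⟩ p hp]
  exact ⟨⌊p.2⌋, Prod.ext (by simp) (Int.fract_add_floor p.2).symm⟩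

theorem injOn (h : IsActionAngle Ω Γi Γo ω a b T Z) : InjOn Z (Icc a b ×ˢ Ico 0 1) := by
  rintro p ⟨hp1, hp2⟩ q ⟨hq1, hq2⟩ hpq
  obtain ⟨n, hn⟩ := (h.eq_iff p ⟨hp1, mem_univ _⟩ q ⟨hq1, mem_univ _⟩).1 hpq
  have h2 : q.2 = p.2 + n := by rw [hn]; rfl
  have h3 : n = 0 := by
    have h4 : (-1 : ℝ) < n := by linarith [hp2.2, hq2.1]
    have h5 : (n : ℝ) < 1 := by linarith [hp2.1, hq2.2]
    have h6 : -1 < n := by exact_mod_cast h4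
    have h7 : n < 1 := by exact_mod_cast h5
    omega
  rw [hn, h3]
  simp

theorem image_level (h : IsActionAngle Ω Γi Γo ω a b T Z) : ω '' closure Ω = Icc a b := by
  rw [← h.image_eq, image_image]
  ext l
  constructor
  · rintro ⟨p, hp, rfl⟩
    simp only [h.level p hp]
    exact hp.1
  · intro hl
    exact ⟨(l, 0), ⟨hl, mem_univ _⟩, h.level (l, 0) ⟨hl, mem_univ _⟩⟩

theorem level_set_eq (h : IsActionAngle Ω Γi Γo ω a b T Z) {l : ℝ} (hl : l ∈ Icc a b) :
    {x | x ∈ closure Ω ∧ ω x = l} = (fun t => Z (l, t)) '' Ico 0 1 := by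
  ext x
  constructor
  · rintro ⟨hx, hxl⟩
    obtain ⟨p, hp, hp2, rfl⟩ := h.exists_mem_Ico hx
    rw [h.level p hp] at hxl
    subst hxl
    exact ⟨p.2, hp2, rfl⟩
  · rintro ⟨t, _, rfl⟩
    exact ⟨h.mem ⟨hl, mem_univ _⟩, h.level (l, t) ⟨hl, mem_univ _⟩⟩

theorem hasDerivAt_angle (h : IsActionAngle Ω Γi Γo ω a b T Z) {p : ℝ × ℝ} (hp : p ∈ strip a b)
    {α : Plane → ℝ} (hα : ContDiffOn ℝ (⊤ : ℕ∞) α (closure Ω)) :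
    HasDerivAt (fun t => α (Z (p.1, t))) (fderivWithin ℝ α (closure Ω) (Z p)
      (fderivWithin ℝ Z (strip a b) p (0, 1))) p.2 :=
  (h.hasFDerivWithinAt_comp hα hp).strip_snd hp

/-- Cramer's rule: differentiating `ω (Z (s, t)) = s` gives two linear equations for the gradient of
`ω`, with determinant `T`. So `T ∇ω` is `∂ₜZ` turned by a right angle. -/
theorem partialOn_level (h : IsActionAngle Ω Γi Γo ω a b T Z) (hω : MemFPlus Ω Γi Γo ω)
    {p : ℝ × ℝ} (hp : p ∈ strip a b) :
    partialOn Ω 0 ω (Z p) * T p.1 = fderivWithin ℝ Z (strip a b) p (0, 1) 1 ∧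
      partialOn Ω 1 ω (Z p) * T p.1 = -fderivWithin ℝ Z (strip a b) p (0, 1) 0 := by
  have h1 := h.hasFDerivWithinAt_comp hω.1.1 hp
  have h2 : HasFDerivWithinAt (ω ∘ Z) (ContinuousLinearMap.fst ℝ ℝ ℝ) (strip a b) p :=
    hasFDerivWithinAt_fst.congr (fun q hq => h.level q hq) (h.level p hp)
  have h3 := (uniqueDiffOn_strip h.lt p hp).eq h1 h2
  have e1 := DFunLike.congr_fun h3 (1, 0)
  have e2 := DFunLike.congr_fun h3 (0, 1)
  have e3 := h.jac_eq p hp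
  simp only [ContinuousLinearMap.comp_apply, ContinuousLinearMap.coe_fst'] at e1 e2
  rw [clm_plane_apply] at e1 e2
  simp only [smul_eq_mul] at e1 e2
  simp only [jac] at e3
  simp only [partialOn]
  rw [← e3]
  constructor
  · linear_combination (fderivWithin ℝ Z (strip a b) p (0, 1) 1) * e1 -
      (fderivWithin ℝ Z (strip a b) p (1, 0) 1) * e2
  · linear_combination (-fderivWithin ℝ Z (strip a b) p (0, 1) 0) * e1 +
      (fderivWithin ℝ Z (strip a b) p (1, 0) 0) * e2

/-- The bracket with `ω` is thus differentiation along the level curves, up to the factor `T`; this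
turns `ν = {ω, α}` into an ordinary differential equation on each circle. -/
theorem poissonBracket_mul (h : IsActionAngle Ω Γi Γo ω a b T Z) (hω : MemFPlus Ω Γi Γo ω)
    {p : ℝ × ℝ} (hp : p ∈ strip a b) (α : Plane → ℝ) :
    poissonBracket Ω ω α (Z p) * T p.1 = fderivWithin ℝ α (closure Ω) (Z p)
      (fderivWithin ℝ Z (strip a b) p (0, 1)) := by
  obtain ⟨e1, e2⟩ := h.partialOn_level hω hp
  rw [clm_plane_apply]
  simp only [poissonBracket, smul_eq_mul]
  change _ = _ * partialOn Ω 0 α (Z p) + _ * partialOn Ω 1 α (Z p)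
  linear_combination partialOn Ω 1 α (Z p) * e1 - partialOn Ω 0 α (Z p) * e2

theorem norm_angle_derivative (h : IsActionAngle Ω Γi Γo ω a b T Z) (hω : MemFPlus Ω Γi Γo ω)
    {p : ℝ × ℝ} (hp : p ∈ strip a b) :
    ‖fderivWithin ℝ Z (strip a b) p (0, 1)‖ = T p.1 * ‖gradientWithin ω (closure Ω) (Z p)‖ := by
  obtain ⟨e1, e2⟩ := h.partialOn_level hω hp
  have hg : ∀ i, gradientWithin ω (closure Ω) (Z p) i = partialOn Ω i ω (Z p) := fun i => by
    have := InnerProductSpace.toDual_symm_apply (𝕜 := ℝ) (x := EuclideanSpace.single i (1 : ℝ))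
      (y := fderivWithin ℝ ω (closure Ω) (Z p))
    rw [EuclideanSpace.inner_single_right] at this
    simpa [gradientWithin, partialOn] using this
  rw [EuclideanSpace.norm_eq, EuclideanSpace.norm_eq, ← abs_of_pos (h.posT _ hp.1),
    ← Real.sqrt_sq_eq_abs, ← Real.sqrt_mul (sq_nonneg _)]
  congr 1
  simp only [Fin.sum_univ_two, hg, Real.norm_eq_abs, sq_abs]
  linear_combination -(fderivWithin ℝ Z (strip a b) p (0, 1) 1 + partialOn Ω 0 ω (Z p) * T p.1) * e1
    + (fderivWithin ℝ Z (strip a b) p (0, 1) 0 - partialOn Ω 1 ω (Z p) * T p.1) * e2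

/-- One turn of the angle parametrizes the level set with speed `T * ‖∇ω‖`, and the weight `1 /
‖∇ω‖` cancels the gradient. -/
theorem levelIntegral_eq (h : IsActionAngle Ω Γi Γo ω a b T Z) (hω : MemFPlus Ω Γi Γo ω)
    (ν : Plane → ℝ) {l : ℝ} (hl : l ∈ Icc a b) :
    levelIntegral Ω ω (fun x => ν x / ‖gradientWithin ω (closure Ω) x‖) l =
      T l * ∫ t in (0 : ℝ)..1, ν (Z (l, t)) := by
  have hp : ∀ t, (l, t) ∈ strip a b := fun t => ⟨hl, mem_univ _⟩
  have hgr : ∀ t, 0 < ‖gradientWithin ω (closure Ω) (Z (l, t))‖ := fun t =>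
    norm_pos_iff.2 (hω.2.1 _ (h.mem (hp t)))
  rw [levelIntegral, h.level_set_eq hl,
    integral_image_hausdorffMeasure_one (γ' := fun t => fderivWithin ℝ Z (strip a b) (l, t) (0, 1))
      (fun t => (h.hasFDerivWithinAt (hp t)).strip_snd (hp t)) ?_ ?_ measurableSet_Ico
      (fun s hs t ht hst => congrArg Prod.snd
        (h.injOn (x₁ := (l, s)) (x₂ := (l, t)) ⟨hl, hs⟩ ⟨hl, ht⟩ hst))]
  · rw [integral_Ico_eq_integral_Ioc, ← intervalIntegral.integral_of_le zero_le_one,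
      ← intervalIntegral.integral_const_mul]
    refine intervalIntegral.integral_congr fun t _ => ?_
    simp only [h.norm_angle_derivative hω (hp t)]
    have := (hgr t).ne'
    field_simp
  · have h1 := ((contDiffOn_infty_iff_fderivWithin (uniqueDiffOn_strip h.lt)).1 h.smooth).2
    rw [← continuousOn_univ]
    exact (h1.continuousOn.comp (f := fun t => (l, t)) (by fun_prop) fun t _ => hp t).clm_apply
      continuousOn_const
  · intro t
    rw [← norm_pos_iff, h.norm_angle_derivative hω (hp t)]
    exact mul_pos (h.posT l hl) (hgr t)

end IsActionAngle

/-! ### Area-preserving maps and stream functions -/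

theorem IsStripCover.exists_descent {a b : ℝ} {X : ℝ × ℝ → Plane} {L : Set Plane}
    (h : IsStripCover a b X L) {V : Type*} {g : ℝ × ℝ → V}
    (hg : ∀ p ∈ strip a b, g (p + (0, 1)) = g p) :
    ∃ u : Plane → V, ∀ p ∈ strip a b, u (X p) = g p := by
  refine ⟨g ∘ Function.invFunOn X (strip a b), fun p hp => ?_⟩
  have hm : Function.invFunOn X (strip a b) (X p) ∈ strip a b := Function.invFunOn_mem ⟨p, hp, rfl⟩
  have he : X (Function.invFunOn X (strip a b) (X p)) = X p := Function.invFunOn_eq ⟨p, hp, rfl⟩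
  obtain ⟨n, hn⟩ := (h.eq_iff _ hm p hp).1 he
  have hper : Function.Periodic
      (fun t => g ((Function.invFunOn X (strip a b) (X p)).1, t)) 1 := fun t => by
    have := hg ((Function.invFunOn X (strip a b) (X p)).1, t) ⟨hm.1, mem_univ _⟩
    simpa using this
  have h2 := hper.int_mul n (Function.invFunOn X (strip a b) (X p)).2
  conv_rhs => rw [hn]
  rw [mul_one] at h2
  exact (h2.symm.trans (congrArg g (Prod.ext (add_zero _).symm rfl)))

/-- Two strip covers with the same parameters differ by a diffeomorphism of their images. -/
theorem IsStripCover.exists_diffeo {a b : ℝ} {X Y : ℝ × ℝ → Plane} {L M : Set Plane}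
    (hX : IsStripCover a b X L) (hY : IsStripCover a b Y M) :
    ∃ η, IsDiffeoOn η L M ∧ ∀ p ∈ strip a b, η (X p) = Y p := by
  obtain ⟨η, hη⟩ := hX.exists_descent (g := Y) fun p hp => hY.shift hp
  obtain ⟨g, hg⟩ := hY.exists_descent (g := X) fun p hp => hX.shift hp
  have hXs : ∀ x ∈ L, ∃ p ∈ strip a b, X p = x := fun x hx => by rwa [← hX.image_eq] at hx
  have hYs : ∀ x ∈ M, ∃ p ∈ strip a b, Y p = x := fun x hx => by rwa [← hY.image_eq] at hx
  refine ⟨η, ⟨hX.contDiffOn_of_comp hY.smooth hη, fun x hx => ?_, g,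
    hY.contDiffOn_of_comp hX.smooth hg, fun x hx => ?_, fun x hx => ?_, fun x hx => ?_⟩, hη⟩
  · obtain ⟨p, hp, rfl⟩ := hXs x hx
    rw [hη p hp]; exact hY.mem hp
  · obtain ⟨p, hp, rfl⟩ := hYs x hx
    rw [hg p hp]; exact hX.mem hp
  · obtain ⟨p, hp, rfl⟩ := hXs x hx
    rw [hη p hp, hg p hp]
  · obtain ⟨p, hp, rfl⟩ := hYs x hx
    rw [hg p hp, hη p hp]

/-- The map is `Z₁ ∘ Z⁻¹`. Both charts have the level as first coordinate, and taking Jacobians in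
`η ∘ Z = Z₁` gives `det Dη * T = T₁`. -/
theorem IsActionAngle.exists_volDiffeo {Ω Γi Γo : Set Plane} {ω ω₁ : Plane → ℝ} {a b : ℝ}
    {T T₁ : ℝ → ℝ} {Z Z₁ : ℝ × ℝ → Plane} (h : IsActionAngle Ω Γi Γo ω a b T Z)
    (h₁ : IsActionAngle Ω Γi Γo ω₁ a b T₁ Z₁) (hT : ∀ s ∈ Icc a b, T₁ s = T s) :
    ∃ η : Plane → Plane, IsVolDiffeo Ω η ∧ ∀ x ∈ closure Ω, ω x = ω₁ (η x) := by
  obtain ⟨η, hη, hηZ⟩ := h.toIsStripCover.exists_diffeo h₁.toIsStripCover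
  refine ⟨η, ⟨hη, fun x hx => ?_⟩, fun x hx => ?_⟩
  · obtain ⟨p, hp, -, rfl⟩ := h.exists_mem_Ico hx
    have h1 := h.hasFDerivWithinAt_comp hη.1 hp
    have h2 := (h₁.hasFDerivWithinAt hp).congr hηZ (hηZ p hp)
    have h3 := congrArg jac ((uniqueDiffOn_strip h.lt p hp).eq h1 h2)
    rw [jac_comp_left, h.jac_eq p hp, h₁.jac_eq p hp, hT _ hp.1] at h3
    exact mul_right_cancel₀ (h.posT _ hp.1).ne' (h3.trans (one_mul _).symm)
  · obtain ⟨p, hp, -, rfl⟩ := h.exists_mem_Ico hx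
    rw [hηZ p hp, h.level p hp, h₁.level p hp]

theorem IsAnnularDomain.inner_subset_closure {Ω Γi Γo : Set Plane} (hΩ : IsAnnularDomain Ω Γi Γo) :
    Γi ⊆ closure Ω := by
  obtain ⟨⟨Φ, hΦ, -, rfl, -⟩, -⟩ := hΩ
  refine (image_mono fun x hx => ?_).trans hΦ.2.1.image_subset
  rw [mem_sphere_zero_iff_norm] at hx
  simp [closedRoundAnnulus, hx]

theorem IsAnnularDomain.outer_subset_closure {Ω Γi Γo : Set Plane} (hΩ : IsAnnularDomain Ω Γi Γo) :
    Γo ⊆ closure Ω := by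
  obtain ⟨⟨Φ, hΦ, -, -, rfl⟩, -⟩ := hΩ
  refine (image_mono fun x hx => ?_).trans hΦ.2.1.image_subset
  rw [mem_sphere_zero_iff_norm] at hx
  simp [closedRoundAnnulus, hx]

namespace IsActionAngle

variable {Ω Γi Γo : Set Plane} {ω : Plane → ℝ} {a b : ℝ} {T : ℝ → ℝ} {Z : ℝ × ℝ → Plane}

theorem mem_frontier (h : IsActionAngle Ω Γi Γo ω a b T Z) {p : ℝ × ℝ} (hp : p ∈ strip a b)
    (hp1 : p.1 = a ∨ p.1 = b) : Z p ∈ frontier Ω := by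
  refine ⟨h.mem hp, fun hi => ?_⟩
  have := (h.interior p hp).1 (interior_subset hi)
  rcases hp1 with e | e
  · exact this.1.ne' e
  · exact this.2.ne e

theorem continuous_comp_angle (h : IsActionAngle Ω Γi Γo ω a b T Z) {ν : Plane → ℝ}
    (hν : ContDiffOn ℝ (⊤ : ℕ∞) ν (closure Ω)) {s : ℝ} (hs : s ∈ Icc a b) :
    Continuous fun t => ν (Z (s, t)) := by
  rw [← continuousOn_univ]
  exact (hν.comp h.smooth fun p hp => h.mem hp).continuousOn.comp (f := fun t => (s, t))
    (by fun_prop) fun t _ => ⟨hs, mem_univ _⟩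

theorem hasDerivAt_stream (h : IsActionAngle Ω Γi Γo ω a b T Z) (hω : MemFPlus Ω Γi Γo ω)
    {α ν : Plane → ℝ} (hα : ContDiffOn ℝ (⊤ : ℕ∞) α (closure Ω))
    (hbr : ∀ x ∈ closure Ω, ν x = poissonBracket Ω ω α x) {s : ℝ} (hs : s ∈ Icc a b) (t : ℝ) :
    HasDerivAt (fun t => α (Z (s, t))) (ν (Z (s, t)) * T s) t := by
  have hp : (s, t) ∈ strip a b := ⟨hs, mem_univ _⟩
  rw [hbr _ (h.mem hp), h.poissonBracket_mul hω hp]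
  exact h.hasDerivAt_angle hp hα

/-- The integrand, multiplied by `T s`, is the angular derivative of a periodic function. -/
theorem integral_eq_zero_of_bracket (h : IsActionAngle Ω Γi Γo ω a b T Z)
    (hω : MemFPlus Ω Γi Γo ω) {α ν : Plane → ℝ} (hν : ContDiffOn ℝ (⊤ : ℕ∞) ν (closure Ω))
    (hα : ContDiffOn ℝ (⊤ : ℕ∞) α (closure Ω))
    (hbr : ∀ x ∈ closure Ω, ν x = poissonBracket Ω ω α x) {s : ℝ} (hs : s ∈ Icc a b) :
    ∫ t in (0 : ℝ)..1, ν (Z (s, t)) = 0 := by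
  have h1 := intervalIntegral.integral_eq_sub_of_hasDerivAt
    (fun t _ => h.hasDerivAt_stream hω hα hbr hs t)
    (((h.continuous_comp_angle hν hs).mul continuous_const).intervalIntegrable 0 1)
  have h2 : Z (s, 1) = Z (s, 0) := by
    simpa using h.shift (p := (s, 0)) ⟨hs, mem_univ _⟩
  rw [h2, sub_self, intervalIntegral.integral_mul_const] at h1
  exact (mul_eq_zero.1 h1).resolve_right (h.posT s hs).ne'

/-- On a boundary component `α` is constant, so its derivative along that curve is zero. -/
theorem eq_zero_of_bracket (h : IsActionAngle Ω Γi Γo ω a b T Z) (hω : MemFPlus Ω Γi Γo ω)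
    {α ν : Plane → ℝ} (hα : MemF Ω Γi Γo α)
    (hbr : ∀ x ∈ closure Ω, ν x = poissonBracket Ω ω α x) {s : ℝ} (hs : s = a ∨ s = b) (t : ℝ) :
    ν (Z (s, t)) = 0 := by
  have hs' : s ∈ Icc a b := by
    rcases hs with rfl | rfl
    · exact left_mem_Icc.2 h.lt.le
    · exact right_mem_Icc.2 h.lt.le
  have hp : ∀ t, (s, t) ∈ strip a b := fun t => ⟨hs', mem_univ _⟩
  have hc : (fun t => α (Z (s, t))) = fun _ => α (Z (s, 0)) := by
    funext t
    rcases hs with e | e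
    · exact hα.2.1 _ ((h.inner _ (hp t)).2 e) _ ((h.inner _ (hp 0)).2 e)
    · exact hα.2.2 _ ((h.outer _ (hp t)).2 e) _ ((h.outer _ (hp 0)).2 e)
  have h1 := h.hasDerivAt_stream hω hα.1 hbr hs' t
  rw [hc] at h1
  exact (mul_eq_zero.1 (h1.unique (hasDerivAt_const t _))).resolve_right (h.posT s hs').ne'

/-- Take `α (Z (s, t)) = T s * ∫₀ᵗ ν (Z (s, v)) dv`. Mean zero makes it periodic, so it descends to
the domain, and the vanishing of `ν` on both boundary levels makes `α` vanish there, not merely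
constant. -/
theorem exists_stream (h : IsActionAngle Ω Γi Γo ω a b T Z) (hΩ : IsAnnularDomain Ω Γi Γo)
    (hω : MemFPlus Ω Γi Γo ω) {ν : Plane → ℝ} (hν : ContDiffOn ℝ (⊤ : ℕ∞) ν (closure Ω))
    (hbd : ∀ s, s = a ∨ s = b → ∀ t, ν (Z (s, t)) = 0)
    (hint : ∀ s ∈ Icc a b, ∫ t in (0 : ℝ)..1, ν (Z (s, t)) = 0) :
    IsTangentToOrbit Ω Γi Γo ω ν := by
  have hνZ : ContDiffOn ℝ (⊤ : ℕ∞) (fun p => ν (Z p)) (strip a b) :=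
    hν.comp h.smooth fun p hp => h.mem hp
  set g : ℝ × ℝ → ℝ := fun p => T p.1 * ∫ u in (0 : ℝ)..1, p.2 * ν (Z (p.1, p.2 * u)) with hg
  have hgint : ∀ s t, g (s, t) = T s * ∫ v in (0 : ℝ)..t, ν (Z (s, v)) := fun s t => by
    simp only [hg]
    rw [intervalIntegral.integral_const_mul,
      intervalIntegral.mul_integral_comp_mul_left (f := fun v => ν (Z (s, v)))]
    simp
  have hgs : ContDiffOn ℝ (⊤ : ℕ∞) g (strip a b) := by
    refine ContDiffOn.mul (f := fun p : ℝ × ℝ => T p.1)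
      (h.smoothT.comp (f := fun p : ℝ × ℝ => p.1) (by fun_prop) fun p hp => hp.1) ?_
    refine ContDiffOn.integral_unitInterval (g := fun p u => p.2 * ν (Z (p.1, p.2 * u)))
      (convex_strip a b) (uniqueDiffOn_strip h.lt) ?_
    refine ContDiffOn.mul (f := fun q : (ℝ × ℝ) × ℝ => q.1.2) (by fun_prop) ?_
    exact hνZ.comp (f := fun q : (ℝ × ℝ) × ℝ => (q.1.1, q.1.2 * q.2)) (by fun_prop)
      fun q hq => ⟨hq.1.1, mem_univ _⟩
  have hgper : ∀ p ∈ strip a b, g (p + (0, 1)) = g p := by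
    rintro ⟨s, t⟩ ⟨hs, -⟩
    have hc := h.continuous_comp_angle hν hs
    have hP : Function.Periodic (fun v => ν (Z (s, v))) 1 := fun v => by
      have := h.shift (p := (s, v)) ⟨hs, mem_univ _⟩
      simp only [Prod.mk_add_mk, add_zero] at this
      simp only [this]
    have h1 := hP.intervalIntegral_add_eq t 0
    rw [zero_add, hint s hs] at h1
    rw [Prod.mk_add_mk, add_zero, hgint, hgint, ← intervalIntegral.integral_add_adjacent_intervals
      (hc.intervalIntegrable 0 t) (hc.intervalIntegrable t (t + 1)), h1, add_zero]
  obtain ⟨α, hα⟩ := h.exists_descent hgper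
  have hαs := h.contDiffOn_of_comp hgs hα
  have hg0 : ∀ s, s = a ∨ s = b → ∀ t, g (s, t) = 0 := fun s hs t => by
    rw [hgint]
    simp only [hbd s hs, intervalIntegral.integral_zero, mul_zero]
  have hαi : ∀ x ∈ Γi, α x = 0 := fun x hx => by
    obtain ⟨p, hp, -, rfl⟩ := h.exists_mem_Ico (hΩ.inner_subset_closure hx)
    rw [hα p hp]
    exact hg0 p.1 (Or.inl ((h.inner p hp).1 hx)) p.2
  have hαo : ∀ x ∈ Γo, α x = 0 := fun x hx => by
    obtain ⟨p, hp, -, rfl⟩ := h.exists_mem_Ico (hΩ.outer_subset_closure hx)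
    rw [hα p hp]
    exact hg0 p.1 (Or.inr ((h.outer p hp).1 hx)) p.2
  refine ⟨α, ⟨⟨hαs, fun x hx y hy => (hαi x hx).trans (hαi y hy).symm,
    fun x hx y hy => (hαo x hx).trans (hαo y hy).symm⟩, hαo⟩, fun x hx => ?_⟩
  obtain ⟨p, hp, -, rfl⟩ := h.exists_mem_Ico hx
  have h1 := h.hasDerivAt_angle hp hαs
  rw [← h.poissonBracket_mul hω hp] at h1
  have hc := h.continuous_comp_angle hν hp.1
  have h2 : HasDerivAt (fun t => α (Z (p.1, t))) (T p.1 * ν (Z p)) p.2 := by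
    have e : (fun t => α (Z (p.1, t))) = fun t => T p.1 * ∫ v in (0 : ℝ)..t, ν (Z (p.1, v)) := by
      funext t
      rw [hα (p.1, t) ⟨hp.1, mem_univ _⟩, hgint]
    rw [e]
    exact (intervalIntegral.integral_hasDerivAt_right (hc.intervalIntegrable _ _)
      (hc.stronglyMeasurableAtFilter _ _) hc.continuousAt).const_mul _
  have h3 := h1.unique h2
  rw [mul_comm] at h3
  exact (mul_left_cancel₀ (h.posT _ hp.1).ne' h3).symm

/-- The range of the Poisson bracket with `ω`, in terms of line integrals over level sets. -/
theorem isTangentToOrbit_iff_levelIntegral (h : IsActionAngle Ω Γi Γo ω a b T Z)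
    (hΩ : IsAnnularDomain Ω Γi Γo) (hω : MemFPlus Ω Γi Γo ω) {ν : Plane → ℝ}
    (hν : ContDiffOn ℝ (⊤ : ℕ∞) ν (closure Ω)) (hbd : ∀ x ∈ frontier Ω, ν x = 0) :
    IsTangentToOrbit Ω Γi Γo ω ν ↔ ∀ l ∈ ω '' closure Ω,
      levelIntegral Ω ω (fun x => ν x / ‖gradientWithin ω (closure Ω) x‖) l = 0 := by
  rw [h.image_level]
  constructor
  · rintro ⟨α, hα, hbr⟩ l hl
    rw [h.levelIntegral_eq hω ν hl, h.integral_eq_zero_of_bracket hω hν hα.1.1 hbr hl, mul_zero]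
  · intro hl
    refine h.exists_stream hΩ hω hν (fun s hs t => hbd _ (h.mem_frontier ⟨?_, mem_univ _⟩ hs))
      fun s hs => ?_
    · rcases hs with rfl | rfl
      · exact left_mem_Icc.2 h.lt.le
      · exact right_mem_Icc.2 h.lt.le
    · have := hl s hs
      rw [h.levelIntegral_eq hω ν hs] at this
      exact (mul_eq_zero.1 this).resolve_left (h.posT s hs).ne'

end IsActionAngle

/-! ### The area function and the distribution function -/

/-- The area below level `x` in action-angle coordinates with period function `T`. -/
def areaBelow (a b : ℝ) (T : ℝ → ℝ) (x : ℝ) : ℝ :=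
  ∫ s in a..max a (min x b), T s

section AreaBelow

variable {a b : ℝ} {T : ℝ → ℝ}

theorem clamp_mem_Icc (hab : a ≤ b) (x : ℝ) : max a (min x b) ∈ Icc a b :=
  ⟨le_max_left _ _, max_le hab (min_le_right _ _)⟩

theorem clamp_of_mem {x : ℝ} (hx : x ∈ Icc a b) : max a (min x b) = x := by
  rw [min_eq_left hx.2, max_eq_right hx.1]

theorem continuous_comp_clamp (hab : a ≤ b) (hT : ContinuousOn T (Icc a b)) :
    Continuous fun s => T (max a (min s b)) :=
  hT.comp_continuous (by fun_prop) (clamp_mem_Icc hab)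

/-- The clamped integrand is continuous on the whole line, so integrability and the fundamental
theorem of calculus apply without care for the endpoints. -/
theorem areaBelow_eq_clamp (hab : a ≤ b) (T : ℝ → ℝ) (x : ℝ) :
    areaBelow a b T x = ∫ s in a..max a (min x b), T (max a (min s b)) := by
  refine intervalIntegral.integral_congr fun s hs => ?_
  rw [uIcc_of_le (le_max_left _ _)] at hs
  simp only [clamp_of_mem (a := a) (b := b) ⟨hs.1, hs.2.trans (clamp_mem_Icc hab x).2⟩]

theorem areaBelow_of_le {x : ℝ} (hx : x ≤ a) : areaBelow a b T x = 0 := by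
  rw [areaBelow, max_eq_left ((min_le_left _ _).trans hx), intervalIntegral.integral_same]

theorem areaBelow_of_ge {x : ℝ} (hx : b ≤ x) : areaBelow a b T x = areaBelow a b T b := by
  rw [areaBelow, areaBelow, min_eq_right hx, min_self]

theorem hasDerivAt_integral_clamp (hab : a ≤ b) (hT : ContinuousOn T (Icc a b)) (x : ℝ) :
    HasDerivAt (fun x => ∫ s in a..x, T (max a (min s b))) (T (max a (min x b))) x :=
  have hc := continuous_comp_clamp hab hT
  intervalIntegral.integral_hasDerivAt_right (hc.intervalIntegrable _ _)
    (hc.stronglyMeasurableAtFilter _ _) hc.continuousAt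

theorem hasDerivWithinAt_areaBelow (hab : a ≤ b) (hT : ContinuousOn T (Icc a b)) {x : ℝ}
    (hx : x ∈ Icc a b) : HasDerivWithinAt (areaBelow a b T) (T x) (Icc a b) x := by
  have h1 := (hasDerivAt_integral_clamp hab hT x).hasDerivWithinAt (s := Icc a b)
  rw [clamp_of_mem hx] at h1
  have h2 : ∀ y ∈ Icc a b, areaBelow a b T y = ∫ s in a..y, T (max a (min s b)) := fun y hy => by
    rw [areaBelow_eq_clamp hab, clamp_of_mem hy]
  exact h1.congr h2 (h2 x hx)

theorem exists_lipschitz_areaBelow (hab : a ≤ b) (hT : ContinuousOn T (Icc a b)) :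
    ∃ M, 0 ≤ M ∧ ∀ x y, |areaBelow a b T y - areaBelow a b T x| ≤ M * |y - x| := by
  obtain ⟨M, hM⟩ := isCompact_Icc.exists_bound_of_continuousOn hT
  have hM0 : 0 ≤ M := (norm_nonneg _).trans (hM a (left_mem_Icc.2 hab))
  refine ⟨M, hM0, fun x y => ?_⟩
  rw [areaBelow_eq_clamp hab, areaBelow_eq_clamp hab]
  refine (convex_univ.norm_image_sub_le_of_norm_hasDerivWithin_le (𝕜 := ℝ)
    (fun x _ => (hasDerivAt_integral_clamp hab hT x).hasDerivWithinAt)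
    (fun x _ => hM _ (clamp_mem_Icc hab x)) (mem_univ _) (mem_univ _)).trans ?_
  refine mul_le_mul_of_nonneg_left ?_ hM0
  rw [Real.norm_eq_abs]
  rw [max_comm a, max_comm a]
  refine (abs_max_sub_max_le_abs _ _ _).trans ?_
  simpa using abs_min_sub_min_le_max y b x b

theorem continuous_areaBelow (hab : a ≤ b) (hT : ContinuousOn T (Icc a b)) :
    Continuous (areaBelow a b T) := by
  obtain ⟨M, hM0, hM⟩ := exists_lipschitz_areaBelow hab hT
  exact (LipschitzWith.of_dist_le_mul (K := M.toNNReal) fun x y => by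
    rw [Real.dist_eq, Real.dist_eq, Real.coe_toNNReal _ hM0]; exact hM y x).continuous

theorem areaBelow_lt (hab : a ≤ b) (hT : ContinuousOn T (Icc a b)) (hpos : ∀ s ∈ Icc a b, 0 < T s)
    {x y : ℝ} (hx : x ∈ Icc a b) (hy : y ∈ Icc a b) (hxy : x < y) :
    areaBelow a b T x < areaBelow a b T y := by
  have hc := continuous_comp_clamp hab hT
  rw [areaBelow_eq_clamp hab, areaBelow_eq_clamp hab, clamp_of_mem hx, clamp_of_mem hy, ← sub_pos,
    intervalIntegral.integral_interval_sub_left (hc.intervalIntegrable _ _)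
      (hc.intervalIntegrable _ _)]
  exact intervalIntegral.intervalIntegral_pos_of_pos (hc.intervalIntegrable _ _)
    (fun s => hpos _ (clamp_mem_Icc hab s)) hxy

theorem setIntegral_eq_areaBelow (hab : a ≤ b) (x : ℝ) :
    ∫ s in Ioo a b ∩ Iio x, T (max a (min s b)) = areaBelow a b T x := by
  rw [areaBelow_eq_clamp hab, intervalIntegral.integral_of_le (le_max_left _ _),
    integral_Ioc_eq_integral_Ioo]
  congr 2
  ext s
  simp only [mem_inter_iff, mem_Ioo, mem_Iio, lt_max_iff, lt_min_iff]
  constructor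
  · rintro ⟨⟨h1, h2⟩, h3⟩
    exact ⟨h1, Or.inr ⟨h3, h2⟩⟩
  · rintro ⟨h1, h2 | ⟨h3, h4⟩⟩
    · exact absurd h1 h2.le.not_gt
    · exact ⟨⟨h1, h4⟩, h3⟩

/-- Fubini, integrating in the level first. The graph may leave `[a, b]`; `areaBelow` truncates it
correctly. -/
theorem integral_below_graph (hab : a ≤ b) (hT : ContinuousOn T (Icc a b)) {y : ℝ → ℝ}
    (hy : Continuous y) :
    ∫ p in (Ioo a b ×ˢ Ico 0 1) ∩ {p : ℝ × ℝ | p.1 < y p.2}, T (max a (min p.1 b)) =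
      ∫ t in (0 : ℝ)..1, areaBelow a b T (y t) := by
  have hc := continuous_comp_clamp hab hT
  have hm : MeasurableSet {p : ℝ × ℝ | p.1 < y p.2} :=
    (isOpen_lt continuous_fst (hy.comp continuous_snd)).measurableSet
  have hint : IntegrableOn (fun p : ℝ × ℝ => T (max a (min p.1 b))) (Ioo a b ×ˢ Ico 0 1) :=
    ((hc.comp continuous_fst).continuousOn.integrableOn_compact
      (isCompact_Icc.prod isCompact_Icc : IsCompact (Icc a b ×ˢ Icc (0 : ℝ) 1))).mono_set
      (prod_mono Ioo_subset_Icc_self Ico_subset_Icc_self)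
  rw [← setIntegral_indicator hm, Measure.volume_eq_prod, ← Measure.prod_restrict,
    integral_prod_symm, integral_Ico_eq_integral_Ioc, ← intervalIntegral.integral_of_le zero_le_one]
  · refine intervalIntegral.integral_congr fun t _ => ?_
    rw [← setIntegral_eq_areaBelow hab, ← setIntegral_indicator measurableSet_Iio]
    rfl
  · rw [Measure.prod_restrict, ← Measure.volume_eq_prod]
    exact hint.indicator hm

end AreaBelow

namespace IsActionAngle

variable {Ω Γi Γo : Set Plane} {ω : Plane → ℝ} {a b : ℝ} {T : ℝ → ℝ} {Z : ℝ × ℝ → Plane}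

/-- Change of variables on one fundamental domain, where `Z` is injective. The identification of
`Plane` with `ℝ × ℝ` preserves volume. -/
theorem volume_image (h : IsActionAngle Ω Γi Γo ω a b T Z) {B : Set (ℝ × ℝ)} (hB : MeasurableSet B)
    (hBs : B ⊆ Ioo a b ×ˢ Ico 0 1) :
    volume (Z '' B) = ∫⁻ p in B, ENNReal.ofReal (T (max a (min p.1 b))) := by
  set e : Plane ≃L[ℝ] ℝ × ℝ :=
    (EuclideanSpace.equiv (Fin 2) ℝ).trans (ContinuousLinearEquiv.finTwoArrow ℝ ℝ) with he
  have hmp : MeasurePreserving e volume volume :=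
    (volume_preserving_finTwoArrow ℝ).comp (PiLp.volume_preserving_ofLp (Fin 2))
  have hBst : B ⊆ strip a b := fun p hp =>
    ⟨Ioo_subset_Icc_self (hBs hp).1, mem_univ _⟩
  have h1 := hmp.measure_preimage_emb e.toHomeomorph.measurableEmbedding ((e ∘ Z) '' B)
  rw [image_comp, preimage_image_eq _ e.injective, ← image_comp] at h1
  rw [h1, ← lintegral_abs_det_fderiv_eq_addHaar_image volume hB
    (f' := fun p => (e : Plane →L[ℝ] ℝ × ℝ) ∘L fderivWithin ℝ Z (strip a b) p) ?_ ?_]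
  · refine setLIntegral_congr_fun hB fun p hp => ?_
    have hp' := (hBst hp).1
    simp only [det_eq_jac e (fun x => rfl), h.jac_eq p (hBst hp), clamp_of_mem hp',
      abs_of_pos (h.posT _ hp')]
  · intro p hp
    exact e.hasFDerivAt.comp_hasFDerivWithinAt p ((h.hasFDerivWithinAt (hBst hp)).mono hBst)
  · exact e.injective.comp_injOn (h.injOn.mono (hBs.trans
      (prod_mono Ioo_subset_Icc_self subset_rfl)))

theorem continuousOn_T (h : IsActionAngle Ω Γi Γo ω a b T Z) : ContinuousOn T (Icc a b) :=
  h.smoothT.continuousOn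

theorem volume_image_below_graph (h : IsActionAngle Ω Γi Γo ω a b T Z) {y : ℝ → ℝ}
    (hy : Continuous y) :
    volume (Z '' ((Ioo a b ×ˢ Ico 0 1) ∩ {p : ℝ × ℝ | p.1 < y p.2})) =
      ENNReal.ofReal (∫ t in (0 : ℝ)..1, areaBelow a b T (y t)) := by
  have hc := continuous_comp_clamp h.lt.le h.continuousOn_T
  have hm : MeasurableSet {p : ℝ × ℝ | p.1 < y p.2} :=
    (isOpen_lt continuous_fst (hy.comp continuous_snd)).measurableSet
  rw [h.volume_image ((measurableSet_Ioo.prod measurableSet_Ico).inter hm) inter_subset_left,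
    ← integral_below_graph h.lt.le h.continuousOn_T hy, ofReal_integral_eq_lintegral_ofReal]
  · exact ((hc.comp continuous_fst).continuousOn.integrableOn_compact
      (isCompact_Icc.prod isCompact_Icc : IsCompact (Icc a b ×ˢ Icc (0 : ℝ) 1))).mono_set
      (inter_subset_left.trans (prod_mono Ioo_subset_Icc_self Ico_subset_Icc_self))
  · exact Eventually.of_forall fun p => (h.posT _ (clamp_mem_Icc h.lt.le _)).le

theorem areaBelow_nonneg (h : IsActionAngle Ω Γi Γo ω a b T Z) (x : ℝ) :
    0 ≤ areaBelow a b T x := by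
  rw [areaBelow_eq_clamp h.lt.le]
  exact intervalIntegral.integral_nonneg (le_max_left _ _) fun s _ =>
    (h.posT _ (clamp_mem_Icc h.lt.le _)).le

theorem image_interior (h : IsActionAngle Ω Γi Γo ω a b T Z) : Z '' (Ioo a b ×ˢ Ico 0 1) = Ω := by
  ext x
  constructor
  · rintro ⟨p, hp, rfl⟩
    exact (h.interior p ⟨Ioo_subset_Icc_self hp.1, mem_univ _⟩).2 hp.1
  · intro hx
    obtain ⟨p, hp, hp2, rfl⟩ := h.exists_mem_Ico (subset_closure hx)
    exact ⟨p, ⟨(h.interior p hp).1 hx, hp2⟩, rfl⟩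

theorem volume_ne_top (h : IsActionAngle Ω Γi Γo ω a b T Z) : volume Ω ≠ ⊤ := by
  have h1 := h.volume_image_below_graph (y := fun _ => b) continuous_const
  have h2 : (Ioo a b ×ˢ Ico 0 1) ∩ {p : ℝ × ℝ | p.1 < b} = Ioo a b ×ˢ Ico 0 1 :=
    inter_eq_left.2 fun p hp => hp.1.2
  rw [h2, h.image_interior] at h1
  rw [h1]
  exact ENNReal.ofReal_ne_top

/-- This and its companion `distributionFn_le` compare a sublevel set with the region below a graph,
one inclusion each. Constant graphs compute the distribution function of `ω`; perturbed ones control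
its first variation. -/
theorem integral_areaBelow_le (h : IsActionAngle Ω Γi Γo ω a b T Z) {y : ℝ → ℝ} (hy : Continuous y)
    {w : Plane → ℝ} {l : ℝ} (H : ∀ p ∈ Icc a b ×ˢ Ico 0 1, p.1 < y p.2 → w (Z p) < l) :
    ∫ t in (0 : ℝ)..1, areaBelow a b T (y t) ≤ distributionFn Ω w l := by
  have h1 := congrArg ENNReal.toReal (h.volume_image_below_graph hy)
  rw [ENNReal.toReal_ofReal (intervalIntegral.integral_nonneg zero_le_one fun t _ =>
    h.areaBelow_nonneg _)] at h1
  rw [← h1]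
  refine measureReal_mono (fun x hx => ?_) (measure_ne_top_of_subset (fun x hx => hx.1)
    h.volume_ne_top)
  obtain ⟨p, ⟨hp, hpy⟩, rfl⟩ := hx
  exact ⟨h.image_interior ▸ mem_image_of_mem Z hp,
    H p ⟨Ioo_subset_Icc_self hp.1, hp.2⟩ hpy⟩

theorem distributionFn_le (h : IsActionAngle Ω Γi Γo ω a b T Z) {y : ℝ → ℝ} (hy : Continuous y)
    {w : Plane → ℝ} {l : ℝ} (H : ∀ p ∈ Icc a b ×ˢ Ico 0 1, w (Z p) < l → p.1 < y p.2) :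
    distributionFn Ω w l ≤ ∫ t in (0 : ℝ)..1, areaBelow a b T (y t) := by
  have h1 := congrArg ENNReal.toReal (h.volume_image_below_graph hy)
  rw [ENNReal.toReal_ofReal (intervalIntegral.integral_nonneg zero_le_one fun t _ =>
    h.areaBelow_nonneg _)] at h1
  rw [← h1]
  refine measureReal_mono (fun x hx => ?_) ?_
  · have hxΩ := hx.1
    rw [← h.image_interior] at hxΩ
    obtain ⟨p, hp, rfl⟩ := hxΩ
    exact ⟨p, ⟨hp, H p ⟨Ioo_subset_Icc_self hp.1, hp.2⟩ hx.2⟩, rfl⟩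
  · rw [h.volume_image_below_graph hy]
    exact ENNReal.ofReal_ne_top

theorem distributionFn_eq (h : IsActionAngle Ω Γi Γo ω a b T Z) (l : ℝ) :
    distributionFn Ω ω l = areaBelow a b T l := by
  have h1 := h.integral_areaBelow_le (y := fun _ => l) continuous_const (w := ω) (l := l)
    fun p hp hpl => by rwa [h.level p ⟨hp.1, mem_univ _⟩]
  have h2 := h.distributionFn_le (y := fun _ => l) continuous_const (w := ω) (l := l)
    fun p hp hpl => by rwa [h.level p ⟨hp.1, mem_univ _⟩] at hpl
  simp only [intervalIntegral.integral_const, sub_zero, one_smul] at h1 h2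
  exact le_antisymm h2 h1

end IsActionAngle

/-- The area function determines the parameters of the action-angle chart. -/
theorem eq_of_areaBelow_eq {a b a₁ b₁ : ℝ} {T T₁ : ℝ → ℝ} (hab : a < b) (hab₁ : a₁ < b₁)
    (hT : ContinuousOn T (Icc a b)) (hT₁ : ContinuousOn T₁ (Icc a₁ b₁))
    (hpos : ∀ s ∈ Icc a b, 0 < T s) (hpos₁ : ∀ s ∈ Icc a₁ b₁, 0 < T₁ s)
    (h : ∀ x, areaBelow a₁ b₁ T₁ x = areaBelow a b T x) :
    a₁ = a ∧ b₁ = b ∧ ∀ s ∈ Icc a b, T₁ s = T s := by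
  -- The left endpoint is where `areaBelow` stops being zero, and the right endpoint, treated in
  -- `key2`, is where it stops growing; strict monotonicity in between locates both.
  have key : ∀ {a b a₁ b₁ : ℝ} {T T₁ : ℝ → ℝ}, a < b → a₁ < b₁ → ContinuousOn T (Icc a b) →
      (∀ s ∈ Icc a b, 0 < T s) → (∀ x, areaBelow a₁ b₁ T₁ x = areaBelow a b T x) → a₁ ≤ a := by
    intro a b a₁ b₁ T T₁ hab hab₁ hT hpos h
    by_contra! hlt
    have h1 := areaBelow_lt hab.le hT hpos (left_mem_Icc.2 hab.le)
      (clamp_mem_Icc hab.le a₁) (lt_max_of_lt_right (lt_min hlt hab))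
    have h2 : areaBelow a b T (max a (min a₁ b)) = 0 := by
      rw [← h]
      exact areaBelow_of_le (max_le hlt.le (min_le_left _ _))
    rw [h2, areaBelow_of_le le_rfl] at h1
    exact lt_irrefl _ h1
  have key2 : ∀ {a b b₁ : ℝ} {T T₁ : ℝ → ℝ}, a < b → a < b₁ → ContinuousOn T (Icc a b) →
      (∀ s ∈ Icc a b, 0 < T s) → (∀ x, areaBelow a b₁ T₁ x = areaBelow a b T x) → b ≤ b₁ := by
    intro a b b₁ T T₁ hab hab₁ hT hpos h
    by_contra! hlt
    have h1 := areaBelow_lt hab.le hT hpos ⟨hab₁.le, hlt.le⟩ (right_mem_Icc.2 hab.le) hlt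
    rw [← h, ← h, areaBelow_of_ge hlt.le] at h1
    exact lt_irrefl _ h1
  obtain rfl : a₁ = a := le_antisymm (key hab hab₁ hT hpos h)
    (key hab₁ hab hT₁ hpos₁ fun x => (h x).symm)
  obtain rfl : b₁ = b := le_antisymm (key2 hab₁ hab hT₁ hpos₁ fun x => (h x).symm)
    (key2 hab hab₁ hT hpos h)
  refine ⟨rfl, rfl, fun s hs => ?_⟩
  have h1 := hasDerivWithinAt_areaBelow hab.le hT hs
  have h2 := hasDerivWithinAt_areaBelow hab.le hT₁ hs
  rw [show areaBelow a₁ b₁ T₁ = areaBelow a₁ b₁ T from funext h] at h2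
  exact (uniqueDiffOn_Icc hab s hs).eq_deriv _ h2 h1

/-! ### First variation of the distribution functions -/

/-- The case `k = 0` of the convergence: a first-order expansion uniform in `x`. -/
theorem HasSmoothDerivAtZero.eventually_abs_le {Ω : Set Plane} {w : ℝ → Plane → ℝ} {ν : Plane → ℝ}
    (hν : HasSmoothDerivAtZero Ω w ν) {δ : ℝ} (hδ : 0 < δ) :
    ∀ᶠ ε in 𝓝[≠] (0 : ℝ), ∀ x ∈ closure Ω, |w ε x - w 0 x - ε * ν x| ≤ δ * |ε| := by
  filter_upwards [Metric.tendstoUniformlyOn_iff.1 (hν.2 0) δ hδ, self_mem_nhdsWithin]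
    with ε hε hne x hx
  have h1 := hε x hx
  rw [dist_zero_left, norm_iteratedFDerivWithin_zero, Real.norm_eq_abs] at h1
  have h2 : w ε x - w 0 x - ε * ν x = ((w ε x - w 0 x) / ε - ν x) * ε := by
    have : ε ≠ 0 := hne
    field_simp
  rw [h2, abs_mul]
  gcongr

theorem HasSmoothDerivAtZero.eq_of_eventually_eq {Ω : Set Plane} {w : ℝ → Plane → ℝ}
    {ν : Plane → ℝ} (hν : HasSmoothDerivAtZero Ω w ν) {x y : Plane} (hx : x ∈ closure Ω)
    (hy : y ∈ closure Ω) (h : ∀ᶠ ε in 𝓝 (0 : ℝ), w ε x = w ε y) : ν x = ν y := by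
  refine eq_of_forall_dist_le fun δ hδ => ?_
  rw [Real.dist_eq]
  obtain ⟨ε, ⟨h1, h2⟩, h3⟩ := (((hν.eventually_abs_le (half_pos hδ)).and
    (h.filter_mono nhdsWithin_le_nhds)).and self_mem_nhdsWithin).exists
  have hpos : 0 < |ε| := abs_pos.2 h3
  have hx1 := h1 x hx
  have hy1 := h1 y hy
  rw [h2, h.self_of_nhds] at hx1
  refine le_of_mul_le_mul_left ?_ hpos
  rw [← abs_mul]
  have h4 := abs_sub (w ε y - w 0 y - ε * ν y) (w ε y - w 0 y - ε * ν x)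
  rw [show w ε y - w 0 y - ε * ν y - (w ε y - w 0 y - ε * ν x) = ε * (ν x - ν y) by ring] at h4
  linarith

theorem le_or_ge_of_le_abs_sub_clamp {a b l s ρ : ℝ} (hs : s ∈ Icc a b)
    (h : ρ ≤ |s - max a (min l b)|) : s ≤ l - ρ ∨ l + ρ ≤ s := by
  obtain ⟨h1, h2⟩ := hs
  rcases le_abs.1 h with h | h <;> rcases le_total l b with hb | hb <;>
    rcases le_total a (min l b) with ha | ha <;>
    simp only [min_eq_left hb, min_eq_right hb] at ha h <;>
    first
      | (rw [max_eq_right ha] at h; first | (left; linarith) | (right; linarith))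
      | (rw [max_eq_left ha] at h; first | (left; linarith) | (right; linarith))

namespace IsActionAngle

variable {Ω Γi Γo : Set Plane} {a b : ℝ} {T : ℝ → ℝ} {Z : ℝ × ℝ → Plane}
  {w : ℝ → Plane → ℝ} {ν : Plane → ℝ}

/-- Write `w ε (Z (s, t))` as `s + ε ν (Z (s, t))` up to `δ |ε|`. Near the clamped level, uniform
continuity lets `ν` be frozen there at the cost of another `δ |ε|`; farther away, the gap to `l`
exceeds anything of size `ε`. -/
theorem sandwich (h : IsActionAngle Ω Γi Γo (w 0) a b T Z) (hν : HasSmoothDerivAtZero Ω w ν)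
    (l : ℝ) {δ : ℝ} (hδ : 0 < δ) : ∀ᶠ ε in 𝓝[≠] (0 : ℝ), ∀ p ∈ Icc a b ×ˢ Ico (0 : ℝ) 1,
      (p.1 < l - ε * ν (Z (max a (min l b), p.2)) - 2 * δ * |ε| → w ε (Z p) < l) ∧
      (w ε (Z p) < l → p.1 < l - ε * ν (Z (max a (min l b), p.2)) + 2 * δ * |ε|) := by
  have hK : IsCompact (Icc a b ×ˢ Icc (0 : ℝ) 1) := isCompact_Icc.prod isCompact_Icc
  have hKs : Icc a b ×ˢ Icc (0 : ℝ) 1 ⊆ strip a b := prod_mono subset_rfl (subset_univ _)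
  have hc : ContinuousOn (fun p => ν (Z p)) (Icc a b ×ˢ Icc (0 : ℝ) 1) :=
    (hν.1.comp h.smooth fun p hp => h.mem hp).continuousOn.mono hKs
  obtain ⟨M, hM⟩ := hK.exists_bound_of_continuousOn hc
  have hM0 : 0 ≤ M := (norm_nonneg _).trans (hM (a, 0) ⟨left_mem_Icc.2 h.lt.le, by simp⟩)
  obtain ⟨ρ, hρ, hu⟩ := Metric.uniformContinuousOn_iff.1 (hK.uniformContinuousOn_of_continuous hc)
    δ hδ
  have hsmall : ∀ᶠ ε in 𝓝[≠] (0 : ℝ), |ε| < ρ / (M + δ) := by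
    refine Eventually.filter_mono nhdsWithin_le_nhds ?_
    have : Tendsto (fun ε : ℝ => |ε|) (𝓝 0) (𝓝 0) := by simpa using continuous_abs.tendsto (0 : ℝ)
    exact this.eventually (gt_mem_nhds (by positivity))
  filter_upwards [hν.eventually_abs_le hδ, hsmall] with ε hε hεs
  rintro ⟨s, t⟩ ⟨hs, ht⟩
  have hs' : s ∈ Icc a b := hs
  have ht' : t ∈ Icc (0 : ℝ) 1 := Ico_subset_Icc_self ht
  have hcl := clamp_mem_Icc h.lt.le l
  rw [lt_div_iff₀ (by positivity)] at hεs
  have h1 := abs_le.1 (hε (Z (s, t)) (h.mem ⟨hs, mem_univ _⟩))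
  rw [h.level (s, t) ⟨hs, mem_univ _⟩] at h1
  have hF : |ε * ν (Z (s, t))| ≤ |ε| * M := by
    rw [abs_mul]; exact mul_le_mul_of_nonneg_left (hM (s, t) ⟨hs', ht'⟩) (abs_nonneg _)
  have hf : |ε * ν (Z (max a (min l b), t))| ≤ |ε| * M := by
    rw [abs_mul]; exact mul_le_mul_of_nonneg_left (hM _ ⟨hcl, ht'⟩) (abs_nonneg _)
  obtain ⟨hF1, hF2⟩ := abs_le.1 hF
  obtain ⟨hf1, hf2⟩ := abs_le.1 hf
  have hεδ : 0 ≤ |ε| * δ := by positivity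
  simp only at h1 ⊢
  by_cases hd : |s - max a (min l b)| < ρ
  · have h2 : |ε * ν (Z (s, t)) - ε * ν (Z (max a (min l b), t))| ≤ |ε| * δ := by
      rw [← mul_sub, abs_mul]
      refine mul_le_mul_of_nonneg_left ?_ (abs_nonneg _)
      refine (hu (s, t) ⟨hs', ht'⟩ (max a (min l b), t) ⟨hcl, ht'⟩ ?_).le
      rw [Prod.dist_eq]
      simpa [Real.dist_eq, hρ] using hd
    obtain ⟨h2, h3⟩ := abs_le.1 h2
    constructor <;> intro h4 <;> linarith
  -- Here `s` is at distance at least `ρ > |ε| (M + δ)` from `l`, on a definite side, so the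
  -- perturbation cannot change the comparison.
  · rcases le_or_ge_of_le_abs_sub_clamp hs' (not_lt.1 hd) with h2 | h2 <;>
      constructor <;> intro h4 <;> linarith

/-- The sandwich brackets the distribution function between integrals for graphs shifted by `2 δ
|ε|`; as `areaBelow` is Lipschitz and `δ` is arbitrary, the error is `o(ε)`. -/
theorem hasDerivAt_distributionFn_sub (h : IsActionAngle Ω Γi Γo (w 0) a b T Z)
    (hν : HasSmoothDerivAtZero Ω w ν) (l : ℝ) :
    HasDerivAt (fun ε => distributionFn Ω (w ε) l -
      ∫ t in (0 : ℝ)..1, areaBelow a b T (l - ε * ν (Z (max a (min l b), t)))) 0 0 := by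
  obtain ⟨M, hM0, hM⟩ := exists_lipschitz_areaBelow h.lt.le h.continuousOn_T
  have hP := continuous_areaBelow h.lt.le h.continuousOn_T
  have hf := h.continuous_comp_angle hν.1 (clamp_mem_Icc h.lt.le l)
  rw [hasDerivAt_iff_isLittleO, Asymptotics.isLittleO_iff]
  intro c hc
  have h0 : distributionFn Ω (w 0) l - ∫ t in (0 : ℝ)..1,
      areaBelow a b T (l - 0 * ν (Z (max a (min l b), t))) = 0 := by
    simp [h.distributionFn_eq l]
  simp only [h0, sub_zero, smul_zero, Real.norm_eq_abs]
  set δ : ℝ := c / (2 * (M + 1)) with hδ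
  have hδ0 : 0 < δ := by positivity
  have hδc : M * (2 * δ) ≤ c := by
    rw [hδ, show M * (2 * (c / (2 * (M + 1)))) = c * (M / (M + 1)) by field_simp]
    exact mul_le_of_le_one_right hc.le ((div_le_one (by positivity)).2 (by linarith))
  have hev := eventually_nhdsWithin_iff.1 (h.sandwich hν l hδ0)
  filter_upwards [hev] with ε hε
  by_cases hε0 : ε = 0
  · subst hε0
    rw [h0]
    simp
  have hε := hε hε0
  have hy : Continuous fun t => l - ε * ν (Z (max a (min l b), t)) :=
    continuous_const.sub (continuous_const.mul hf)
  have h1 := h.integral_areaBelow_le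
    (y := fun t => l - ε * ν (Z (max a (min l b), t)) - 2 * δ * |ε|) (hy.sub continuous_const)
    (fun p hp => (hε p hp).1)
  have h2 := h.distributionFn_le
    (y := fun t => l - ε * ν (Z (max a (min l b), t)) + 2 * δ * |ε|) (hy.add continuous_const)
    (fun p hp => (hε p hp).2)
  have hi : ∀ {y : ℝ → ℝ}, Continuous y →
      IntervalIntegrable (fun t => areaBelow a b T (y t)) volume 0 1 := fun hy =>
    (hP.comp hy).intervalIntegrable _ _
  have habs : abs (2 * δ * |ε|) = 2 * δ * |ε| := abs_of_nonneg (by positivity)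
  have hbound : M * (2 * δ * |ε|) ≤ c * |ε| := by
    rw [← mul_assoc]
    exact mul_le_mul_of_nonneg_right hδc (abs_nonneg _)
  have h3 : (∫ t in (0 : ℝ)..1, areaBelow a b T (l - ε * ν (Z (max a (min l b), t)))) - c * |ε| ≤
      ∫ t in (0 : ℝ)..1,
        areaBelow a b T (l - ε * ν (Z (max a (min l b), t)) - 2 * δ * |ε|) := by
    have e : (∫ t in (0 : ℝ)..1, areaBelow a b T (l - ε * ν (Z (max a (min l b), t)))) - c * |ε| =
        ∫ t in (0 : ℝ)..1, (areaBelow a b T (l - ε * ν (Z (max a (min l b), t))) - c * |ε|) := by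
      rw [intervalIntegral.integral_sub (hi hy) intervalIntegrable_const]
      simp
    rw [e]
    refine intervalIntegral.integral_mono_on zero_le_one ((hi hy).sub intervalIntegrable_const)
      (hi (hy.sub continuous_const)) fun t _ => ?_
    have := (abs_le.1 (hM (l - ε * ν (Z (max a (min l b), t)))
      (l - ε * ν (Z (max a (min l b), t)) - 2 * δ * |ε|))).1
    rw [sub_sub_cancel_left, abs_neg, habs] at this
    linarith
  have h4 : (∫ t in (0 : ℝ)..1,
        areaBelow a b T (l - ε * ν (Z (max a (min l b), t)) + 2 * δ * |ε|)) ≤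
      (∫ t in (0 : ℝ)..1, areaBelow a b T (l - ε * ν (Z (max a (min l b), t)))) + c * |ε| := by
    have e : (∫ t in (0 : ℝ)..1, areaBelow a b T (l - ε * ν (Z (max a (min l b), t)))) + c * |ε| =
        ∫ t in (0 : ℝ)..1, (areaBelow a b T (l - ε * ν (Z (max a (min l b), t))) + c * |ε|) := by
      rw [intervalIntegral.integral_add (hi hy) intervalIntegrable_const]
      simp
    rw [e]
    refine intervalIntegral.integral_mono_on zero_le_one (hi (hy.add continuous_const))
      ((hi hy).add intervalIntegrable_const) fun t _ => ?_
    have := (abs_le.1 (hM (l - ε * ν (Z (max a (min l b), t)))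
      (l - ε * ν (Z (max a (min l b), t)) + 2 * δ * |ε|))).2
    rw [add_sub_cancel_left, habs] at this
    linarith
  rw [abs_le]
  constructor <;> linarith

theorem hasDerivAt_distributionFn_iff (h : IsActionAngle Ω Γi Γo (w 0) a b T Z)
    (hν : HasSmoothDerivAtZero Ω w ν) (l : ℝ) {d : ℝ} :
    HasDerivAt (fun ε => distributionFn Ω (w ε) l) d 0 ↔
      HasDerivAt (fun ε => ∫ t in (0 : ℝ)..1,
        areaBelow a b T (l - ε * ν (Z (max a (min l b), t)))) d 0 := by
  have h1 := h.hasDerivAt_distributionFn_sub hν l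
  constructor
  · intro h2
    simpa using h2.fun_sub h1
  · intro h2
    simpa using h1.fun_add h2

/-- Differentiation under the integral, dominated by the Lipschitz bound for `areaBelow`. The level
is interior because `areaBelow` has a two-sided derivative only there. -/
theorem hasDerivAt_integral_areaBelow (h : IsActionAngle Ω Γi Γo (w 0) a b T Z)
    (hν : HasSmoothDerivAtZero Ω w ν) {l : ℝ} (hl : l ∈ Ioo a b) :
    HasDerivAt (fun ε => ∫ t in (0 : ℝ)..1, areaBelow a b T (l - ε * ν (Z (max a (min l b), t))))
      (-(T l * ∫ t in (0 : ℝ)..1, ν (Z (l, t)))) 0 := by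
  obtain ⟨M, hM0, hM⟩ := exists_lipschitz_areaBelow h.lt.le h.continuousOn_T
  have hP := continuous_areaBelow h.lt.le h.continuousOn_T
  have hlI := Ioo_subset_Icc_self hl
  have hf := h.continuous_comp_angle hν.1 hlI
  simp only [clamp_of_mem hlI]
  have hFc : ∀ ε : ℝ, Continuous fun t => areaBelow a b T (l - ε * ν (Z (l, t))) := fun ε =>
    hP.comp (continuous_const.sub (continuous_const.mul hf))
  have hPd : HasDerivAt (areaBelow a b T) (T l) l :=
    (hasDerivWithinAt_areaBelow h.lt.le h.continuousOn_T hlI).hasDerivAt (Icc_mem_nhds hl.1 hl.2)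
  have h1 := (intervalIntegral.hasDerivAt_integral_of_dominated_loc_of_lip (μ := volume)
    (F := fun ε t => areaBelow a b T (l - ε * ν (Z (l, t)))) (F' := fun t => T l * -ν (Z (l, t)))
    (x₀ := (0 : ℝ)) (a := 0) (b := 1) (bound := fun t => M * |ν (Z (l, t))|) univ_mem
    (Eventually.of_forall fun ε => (hFc ε).aestronglyMeasurable)
    ((hFc 0).intervalIntegrable _ _) (continuous_const.mul hf.neg).aestronglyMeasurable
    (Eventually.of_forall fun t _ => ?_)
    ((continuous_const.mul hf.abs).intervalIntegrable _ _)
    (Eventually.of_forall fun t _ => ?_)).2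
  · rw [intervalIntegral.integral_const_mul, intervalIntegral.integral_neg, mul_neg] at h1
    exact h1
  · refine LipschitzOnWith.of_dist_le_mul fun x _ y _ => ?_
    rw [Real.dist_eq, Real.dist_eq, Real.coe_nnabs, abs_mul M, abs_of_nonneg hM0, abs_abs]
    refine (hM _ _).trans (le_of_eq ?_)
    rw [show l - x * ν (Z (l, t)) - (l - y * ν (Z (l, t))) = -((x - y) * ν (Z (l, t))) by ring,
      abs_neg, abs_mul]
    ring
  · have h2 : HasDerivAt (fun ε : ℝ => l - ε * ν (Z (l, t))) (-ν (Z (l, t))) 0 := by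
      simpa using ((hasDerivAt_id (0 : ℝ)).mul_const (ν (Z (l, t)))).const_sub l
    have h3 : HasDerivAt (areaBelow a b T) (T l) (l - 0 * ν (Z (l, t))) := by simpa using hPd
    exact h3.comp (0 : ℝ) h2

/-- If `c ≠ 0`, the affine substitution `ε = (l - x) / c` would give `areaBelow` derivative `0` at
`l`, while its derivative within `[a, b]` is `T l > 0`. At an endpoint this is the corner argument.
-/
theorem eq_zero_of_hasDerivAt (h : IsActionAngle Ω Γi Γo (w 0) a b T Z) {l c : ℝ}
    (hl : l ∈ Icc a b) (hd : HasDerivAt (fun ε => areaBelow a b T (l - ε * c)) 0 0) : c = 0 := by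
  by_contra hc
  have h1 : HasDerivAt (fun x : ℝ => (l - x) / c) (-1 / c) l :=
    ((hasDerivAt_id l).const_sub l).div_const c
  have h2 : HasDerivAt (fun ε => areaBelow a b T (l - ε * c)) 0 ((l - l) / c) := by simpa using hd
  have h3 := h2.comp l h1
  have e : (fun ε => areaBelow a b T (l - ε * c)) ∘ (fun x : ℝ => (l - x) / c) =
      areaBelow a b T := by
    funext x
    simp only [Function.comp, div_mul_cancel₀ _ hc, sub_sub_cancel]
  rw [e, zero_mul] at h3
  have h4 := (uniqueDiffOn_Icc h.lt l hl).eq_deriv _ h3.hasDerivWithinAt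
    (hasDerivWithinAt_areaBelow h.lt.le h.continuousOn_T hl)
  exact (h.posT l hl).ne h4

/-- The distribution functions are stationary along a curve exactly when its velocity is tangent
to the orbit. -/
theorem hasDerivAt_distributionFn_zero_iff (h : IsActionAngle Ω Γi Γo (w 0) a b T Z)
    (hΩ : IsAnnularDomain Ω Γi Γo) (hw : ∀ᶠ ε in 𝓝 (0 : ℝ), MemFPlus Ω Γi Γo (w ε))
    (hν : HasSmoothDerivAtZero Ω w ν) :
    (∀ l : ℝ, HasDerivAt (fun ε => distributionFn Ω (w ε) l) 0 0) ↔
      IsTangentToOrbit Ω Γi Γo (w 0) ν := by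
  have hω : MemFPlus Ω Γi Γo (w 0) := hw.self_of_nhds
  have hendpt : ∀ s, s = a ∨ s = b → s ∈ Icc a b := by
    rintro s (rfl | rfl)
    · exact left_mem_Icc.2 h.lt.le
    · exact right_mem_Icc.2 h.lt.le
  simp only [h.hasDerivAt_distributionFn_iff hν]
  constructor
  · intro hd
    have hbd : ∀ s, s = a ∨ s = b → ∀ t, ν (Z (s, t)) = 0 := by
      intro s hs t
      have hsI := hendpt s hs
      have hp : ∀ t, (s, t) ∈ strip a b := fun t => ⟨hsI, mem_univ _⟩
      -- Each nearby `w ε` is constant on the boundary component, and so is the derivative. The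
      -- integral over `t` then reduces to one value, as the corner argument requires.
      have hconst : ∀ t, ν (Z (s, t)) = ν (Z (s, 0)) := fun t => by
        refine hν.eq_of_eventually_eq (h.mem (hp t)) (h.mem (hp 0)) (hw.mono fun ε hε => ?_)
        rcases hs with e | e
        · exact hε.1.2.1 _ ((h.inner _ (hp t)).2 e) _ ((h.inner _ (hp 0)).2 e)
        · exact hε.1.2.2 _ ((h.outer _ (hp t)).2 e) _ ((h.outer _ (hp 0)).2 e)
      have h1 := hd s
      simp only [clamp_of_mem hsI, hconst, intervalIntegral.integral_const, sub_zero,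
        one_smul] at h1
      rw [hconst t]
      exact h.eq_zero_of_hasDerivAt hsI h1
    refine h.exists_stream hΩ hω hν.1 hbd fun s hs => ?_
    rcases eq_endpoints_or_mem_Ioo_of_mem_Icc hs with e | e | e
    · simp [hbd s (Or.inl e)]
    · simp [hbd s (Or.inr e)]
    · have h1 := (hd s).unique (h.hasDerivAt_integral_areaBelow hν e)
      exact (mul_eq_zero.1 (neg_eq_zero.1 h1.symm)).resolve_left (h.posT s hs).ne'
  · rintro ⟨α, hα, hbr⟩ l
    by_cases hl : l ∈ Ioo a b
    · have h1 := h.hasDerivAt_integral_areaBelow hν hl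
      rwa [h.integral_eq_zero_of_bracket hω hν.1 hα.1.1 hbr (Ioo_subset_Icc_self hl), mul_zero,
        neg_zero] at h1
    -- At such a level the clamp is a boundary level, where a bracket with a function constant on
    -- that component vanishes; the expression is then constant in `ε`.
    · have hs : max a (min l b) = a ∨ max a (min l b) = b := by
        rw [mem_Ioo, not_and_or, not_lt, not_lt] at hl
        rcases hl with hl | hl
        · exact Or.inl (max_eq_left ((min_le_left _ _).trans hl))
        · exact Or.inr (by rw [min_eq_right hl, max_eq_right h.lt.le])
      simp only [h.eq_zero_of_bracket hω hα.1 hbr hs, mul_zero, sub_zero]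
      exact hasDerivAt_const _ _

end IsActionAngle

end

/-! ### The three statements -/

theorem mainTheorem3 (Ω Γi Γo : Set Plane) (hΩ : IsAnnularDomain Ω Γi Γo) :
    (∀ ω ω₁ : Plane → ℝ, MemFPlus Ω Γi Γo ω → MemFPlus Ω Γi Γo ω₁ →
      distributionFn Ω ω₁ = distributionFn Ω ω →
        ∃ η : Plane → Plane, IsVolDiffeo Ω η ∧ ∀ x ∈ closure Ω, ω x = ω₁ (η x)) ∧
    (∀ ω ν : Plane → ℝ, MemFPlus Ω Γi Γo ω → MemF Ω Γi Γo ν →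
      (∀ x ∈ frontier Ω, ν x = 0) →
        ((∃ α : Plane → ℝ, MemU Ω Γi Γo α ∧
            ∀ x ∈ closure Ω, ν x = poissonBracket Ω ω α x) ↔
          ∀ l ∈ ω '' closure Ω,
            levelIntegral Ω ω (fun x => ν x / ‖gradientWithin ω (closure Ω) x‖) l = 0)) ∧
    (∀ (w : ℝ → Plane → ℝ) (ν : Plane → ℝ),
      (∀ᶠ ε in 𝓝 (0 : ℝ), MemFPlus Ω Γi Γo (w ε)) → HasSmoothDerivAtZero Ω w ν →
        ((∀ l : ℝ, HasDerivAt (fun ε => distributionFn Ω (w ε) l) 0 0) ↔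
          IsTangentToOrbit Ω Γi Γo (w 0) ν)) := by
  refine ⟨fun ω ω₁ hω hω₁ hA => ?_, fun ω ν hω hν hbd => ?_, fun w ν hw hν => ?_⟩
  · obtain ⟨a, b, T, Z, h⟩ := exists_isActionAngle hΩ hω
    obtain ⟨a₁, b₁, T₁, Z₁, h₁⟩ := exists_isActionAngle hΩ hω₁
    obtain ⟨rfl, rfl, hT⟩ := eq_of_areaBelow_eq h.lt h₁.lt h.continuousOn_T h₁.continuousOn_T
      h.posT h₁.posT fun x => by rw [← h.distributionFn_eq, ← h₁.distributionFn_eq, hA]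
    exact h.exists_volDiffeo h₁ hT
  · obtain ⟨a, b, T, Z, h⟩ := exists_isActionAngle hΩ hω
    exact h.isTangentToOrbit_iff_levelIntegral hΩ hω hν.1 hbd
  · obtain ⟨a, b, T, Z, h⟩ := exists_isActionAngle hΩ hw.self_of_nhds
    exact h.hasDerivAt_distributionFn_zero_iff hΩ hw hν
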